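/- Throughout, $\mathbb{N}=\{1,2,\dots\}$, Hilbert spaces are finite-dimensional and complex, $\mathscr{L}(\mathcal H)$ is the set of linear operators on $\mathcal H$, $\mathscr{P}(\mathcal H)$ the set of positive semidefinite operators and $\mathscr{D}(\mathcal H)$ the set of positive semidefinite operators of trace one; $A\le B$ means $B-A\in\mathscr P(\mathcal H)$; $A\ll B$ means $\mathrm{supp}(A)\subseteq\mathrm{supp}(B)$, where $\mathrm{supp}(A)=(\ker A)^{\perp}$; negative powers of a singular positive semidefinite operator are powers of its Moore–Penrose inverse. For $A,B>0$ let $A\# B=A^{1/2}(A^{-1/2}BA^{-1/2})^{1/2}A^{1/2}$, and for $A,B\ge0$ let $A\#B=\lim_{\epsilon\to0^+}(A+\epsilon I)\#(B+\epsilon I)$. For $k\in\mathbb N$ let $\alpha_k=1+\frac1{2^k-1}$. For $\rho\in\mathscr D(\mathcal H)$ and $\sigma\in\mathscr P(\mathcal H)$ with $\rho\ll\sigma$ the iterated mean divergence is $D_{\alpha_k}(\rho\|\sigma)=\frac{1}{\alpha_k-1}\log Q_{\alpha_k}(\rho\|\sigma)$ with $$Q_{\alpha_k}(\rho\|\sigma)=\max_{V_1,\dots,V_k,Z}\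 \alpha_k\,\mathrm{tr}\Big(\rho\,\tfrac{V_1+V_1^*}{2}\Big)-(\alpha_k-1)\,\mathrm{tr}(\sigma Z),$$ over $V_1,\dots,V_k\in\mathscr L(\mathcal H)$ and $Z\in\mathscr P(\mathcal H)$ subject to $$(\ast)\qquad V_1+V_1^*\ge0,\qquad \begin{pmatrix}I&V_i\\V_i^*&\frac{V_{i+1}+V_{i+1}^*}{2}\end{pmatrix}\ge0\ \ (1\le i<k),\qquad \begin{pmatrix}I&V_k\\V_k^*&Z\end{pmatrix}\ge0 .$$ For $\alpha>1$ let $$D^{\mathbb M}_{\alpha}(\rho\|\sigma)=\tfrac1{\alpha-1}\log\sup_{\{M_i\}}\sum_i\mathrm{tr}(M_i\rho)^{\alpha}\,\mathrm{tr}(M_i\sigma)^{1-\alpha}\quad\text{(supremum over finite POVMs, with $0^{\alpha}0^{1-\alpha}=0$)},$$ $$\widetilde D_\alpha(\rho\|\sigma)=\tfrac1{\alpha-1}\log\mathrm{tr}\Big(\big(\sigma^{\frac{1-\alpha}{2\alpha}}\rho\,\sigma^{\frac{1-\alpha}{2\alpha}}\big)^\alpha\Big),\qquad \widehat D_\alpha(\rho\|\sigma)=\tfrac1{\alpha-1}\log\mathrm{tr}\Big(\sigma^{1/2}\big(\sigma^{-1/2}\rho\,\sigma^{-1/2}\big)^{\alpha}\sigma^{1/2}\Big).$$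 **Proposition.** Let $\rho\in\mathscr D(\mathcal H)$, $\sigma\in\mathscr P(\mathcal H)$ with $\rho\ll\sigma$, and $k\in\mathbb N$. The maximum defining $Q_{\alpha_k}(\rho\|\sigma)$ is attained, and the following hold. 1. (Rescaling) $Q_{\alpha_k}(\rho\|\sigma)=\max\big(\mathrm{tr}\,\rho\frac{V_1+V_1^*}{2}\big)^{\alpha_k}$ over $V_1,\dots,V_k\in\mathscr L(\mathcal H)$ and $Z\in\mathscr P(\mathcal H)$ subject to $\mathrm{tr}(\sigma Z)=1$ and $(\ast)$. 2. (Dual formulations) Consider operators $A_1,\dots,A_k,C_1,\dots,C_k\in\mathscr L(\mathcal H)$ and, with $C_{k+1}:=\sigma$, the constraints $$(\ast\ast)\qquad C_1\ge\rho,\qquad \begin{pmatrix}A_i&C_i\\C_i&C_{i+1}\end{pmatrix}\ge0\quad(1\le i\le k).$$ Then $$Q_{\alpha_k}(\rho\|\sigma)=\min_{(\ast\ast)}\ \frac1{2^k-1}\sum_{i=1}^k2^{k-i}\,\mathrm{tr}(A_i)=\min\{\mathrm{tr}(A_1):(\ast\ast),\ \mathrm{tr}(A_1)=\dots=\mathrm{tr}(A_k)\},$$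 $$Q_{\alpha_k}(\rho\|\sigma)=\min\{\mathrm{tr}(A_1): A_1,\dots,A_k\in\mathscr P(\mathcal H),\ \mathrm{tr}(A_1)=\dots=\mathrm{tr}(A_k),\ \rho\le A_1\#(A_2\#(\cdots\#(A_k\#\sigma)\cdots))\},$$ all minima being attained. 3. (Submultiplicativity) For $\rho_j\in\mathscr D(\mathcal H_j)$, $\sigma_j\in\mathscr P(\mathcal H_j)$ with $\rho_j\ll\sigma_j$ ($j=1,2$), $$D_{\alpha_k}(\rho_1\otimes\rho_2\|\sigma_1\otimes\sigma_2)\le D_{\alpha_k}(\rho_1\|\sigma_1)+D_{\alpha_k}(\rho_2\|\sigma_2).$$ 4. (Relation to other Rényi divergences) $D^{\mathbb M}_{\alpha_k}(\rho\|\sigma)\le\widetilde D_{\alpha_k}(\rho\|\sigma)\le D_{\alpha_k}(\rho\|\sigma)\le\widehat D_{\alpha_k}(\rho\|\sigma)$, where the supremum in $D^{\mathbb M}_{\alpha_k}$ is finite. Moreover, if also $\sigma\ll\rho$, then $\widehat D_{\alpha_k}(\rho\|\sigma)=\frac1{\alpha_k-1}\log\mathrm{tr}\big(\rho^{1/2}(\rho^{-1/2}\sigma\rho^{-1/2})^{1-\alpha_k}\rho^{1/2}\big)$.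 5. (Decreasing in $k$) If $k\ge2$, then $D_{\alpha_k}(\rho\|\sigma)\le D_{\alpha_{k-1}}(\rho\|\sigma)$. 6. (Data processing) For every Hilbert space $\mathcal K$ and every completely positive trace-preserving linear map $\mathcal E:\mathscr L(\mathcal H)\to\mathscr L(\mathcal K)$, $D_{\alpha_k}(\mathcal E(\rho)\|\mathcal E(\sigma))\le D_{\alpha_k}(\rho\|\sigma)$. 7. (Reduction to the classical divergence) If $[\rho,\sigma]=0$, then $D_{\alpha_k}(\rho\|\sigma)=\frac1{\alpha_k-1}\log\mathrm{tr}(\rho^{\alpha_k}\sigma^{1-\alpha_k})$. -/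

import Mathlib

open scoped Matrix Kronecker Topology ComplexOrder

universe u v w x

namespace IteratedMean

noncomputable section

/-! Operators on a finite-dimensional Hilbert space are written as complex matrices in an orthonormal
basis indexed by a finite type `ι`.  `A ≤ B` is written `(B - A).PosSemidef`. -/

variable {ι : Type u} [Fintype ι] [DecidableEq ι]

/-- The orders `α_k = 1 + 1 / (2 ^ k - 1)`. -/
def alpha (k : ℕ) : ℝ := 1 + 1 / ((2 : ℝ) ^ k - 1)

/-- Positive semidefinite with unit trace. -/
def IsDensity (ρ : Matrix ι ι ℂ) : Prop := ρ.PosSemidef ∧ ρ.trace = 1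

/-- The support of an operator: the orthogonal complement of its kernel. -/
def supp (A : Matrix ι ι ℂ) : Submodule ℂ (EuclideanSpace ℂ ι) :=
  (LinearMap.ker (Matrix.toEuclideanLin A))ᗮ

/-- `A ≪ B`: the support of `A` is contained in the support of `B`. -/
def Dominated (A B : Matrix ι ι ℂ) : Prop := supp A ≤ supp B

/-- Real powers of a Hermitian matrix through the functional calculus.  As `(0 : ℝ) ^ r = 0` for
`r ≠ 0`, negative powers of a positive semidefinite matrix are those of its Moore-Penrose inverse. -/
def mpow (A : Matrix ι ι ℂ) (r : ℝ) : Matrix ι ι ℂ := cfc (fun t : ℝ => t ^ r) A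

/-- The real part of the trace (the trace itself wherever it is a real number). -/
def rtr (A : Matrix ι ι ℂ) : ℝ := A.trace.re

/-- The Hermitian part `(V + V*) / 2`. -/
def herm (V : Matrix ι ι ℂ) : Matrix ι ι ℂ := (1 / 2 : ℂ) • (V + Vᴴ)

/-! ### The primal semidefinite program -/

/-- The constraints on `V_1, …, V_k, Z`.  The variables are a sequence of which only the entries with
index `1, …, k` occur. -/
def PrimalFeasible (k : ℕ) (V : ℕ → Matrix ι ι ℂ) (Z : Matrix ι ι ℂ) : Prop :=
  Z.PosSemidef ∧
  (V 1 + (V 1)ᴴ).PosSemidef ∧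
  (∀ i : ℕ, 1 ≤ i → i < k →
    (Matrix.fromBlocks 1 (V i) (V i)ᴴ (herm (V (i + 1)))).PosSemidef) ∧
  (Matrix.fromBlocks 1 (V k) (V k)ᴴ Z).PosSemidef

/-- The set of values of the objective function over the feasible points. -/
def primalValues (k : ℕ) (ρ σ : Matrix ι ι ℂ) : Set ℝ :=
  {q | ∃ (V : ℕ → Matrix ι ι ℂ) (Z : Matrix ι ι ℂ), PrimalFeasible k V Z ∧
    q = alpha k * rtr (ρ * herm (V 1)) - (alpha k - 1) * rtr (σ * Z)}

/-- `Q_{α_k}(ρ ‖ σ)`. -/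
def imQ (k : ℕ) (ρ σ : Matrix ι ι ℂ) : ℝ := sSup (primalValues k ρ σ)

/-- The iterated mean divergence `D_{α_k}(ρ ‖ σ)`. -/
def imD (k : ℕ) (ρ σ : Matrix ι ι ℂ) : ℝ := 1 / (alpha k - 1) * Real.log (imQ k ρ σ)

/-- The values of the rescaled program. -/
def rescaledValues (k : ℕ) (ρ σ : Matrix ι ι ℂ) : Set ℝ :=
  {q | ∃ (V : ℕ → Matrix ι ι ℂ) (Z : Matrix ι ι ℂ), PrimalFeasible k V Z ∧
    (σ * Z).trace = 1 ∧ q = (rtr (ρ * herm (V 1))) ^ alpha k}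

/-! ### The dual programs -/

/-- The constraints on `A_1, …, A_k, C_1, …, C_k`. -/
def DualFeasible (k : ℕ) (ρ σ : Matrix ι ι ℂ) (A C : ℕ → Matrix ι ι ℂ) : Prop :=
  (C 1 - ρ).PosSemidef ∧
  (∀ i : ℕ, 1 ≤ i → i < k →
    (Matrix.fromBlocks (A i) (C i) (C i) (C (i + 1))).PosSemidef) ∧
  (Matrix.fromBlocks (A k) (C k) (C k) σ).PosSemidef

/-- `tr A_1 = tr A_2 = ⋯ = tr A_k`. -/
def EqualTraces (k : ℕ) (A : ℕ → Matrix ι ι ℂ) : Prop :=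
  ∀ i : ℕ, 1 ≤ i → i ≤ k → (A i).trace = (A 1).trace

/-- The values of the dual program with a weighted sum of traces. -/
def dualSumValues (k : ℕ) (ρ σ : Matrix ι ι ℂ) : Set ℝ :=
  {q | ∃ A C : ℕ → Matrix ι ι ℂ, DualFeasible k ρ σ A C ∧
    q = 1 / ((2 : ℝ) ^ k - 1) * ∑ i ∈ Finset.Icc 1 k, (2 : ℝ) ^ (k - i) * rtr (A i)}

/-- The values of the dual program with equal traces. -/
def dualEqualValues (k : ℕ) (ρ σ : Matrix ι ι ℂ) : Set ℝ :=
  {q | ∃ A C : ℕ → Matrix ι ι ℂ, EqualTraces k A ∧ DualFeasible k ρ σ A C ∧ q = rtr (A 1)}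

/-- The geometric mean `A^{1/2} (A^{-1/2} B A^{-1/2})^{1/2} A^{1/2}` of positive definite matrices. -/
def geomMeanPos (A B : Matrix ι ι ℂ) : Matrix ι ι ℂ :=
  mpow A (1 / 2) * mpow (mpow A (-1 / 2) * B * mpow A (-1 / 2)) (1 / 2) * mpow A (1 / 2)

/-- The geometric mean `A # B` of positive semidefinite matrices:
`lim_{ε → 0+} (A + ε I) # (B + ε I)`. -/
def geomMean (A B : Matrix ι ι ℂ) : Matrix ι ι ℂ :=
  Filter.limUnder (𝓝[>] (0 : ℝ)) fun ε : ℝ => geomMeanPos (A + (ε : ℂ) • 1) (B + (ε : ℂ) • 1)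

/-- `A_1 # (A_2 # (⋯ # (A_k # σ) ⋯))`. -/
def iterGeomMean (A : ℕ → Matrix ι ι ℂ) : ℕ → Matrix ι ι ℂ → Matrix ι ι ℂ
  | 0, σ => σ
  | k + 1, σ => iterGeomMean A k (geomMean (A (k + 1)) σ)

/-- The values of the iterated geometric mean program. -/
def dualMeanValues (k : ℕ) (ρ σ : Matrix ι ι ℂ) : Set ℝ :=
  {q | ∃ A : ℕ → Matrix ι ι ℂ, (∀ i : ℕ, 1 ≤ i → i ≤ k → (A i).PosSemidef) ∧
    EqualTraces k A ∧ (iterGeomMean A k σ - ρ).PosSemidef ∧ q = rtr (A 1)}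

/-! ### Other Rényi divergences (for orders `α > 1`) -/

/-- The values `∑ i, tr(M_i ρ)^α tr(M_i σ)^{1-α}` over all finite POVMs. -/
def measuredValues (α : ℝ) (ρ σ : Matrix ι ι ℂ) : Set ℝ :=
  {q | ∃ (n : ℕ) (M : Fin n → Matrix ι ι ℂ), (∀ i, (M i).PosSemidef) ∧ ∑ i, M i = 1 ∧
    q = ∑ i, rtr (M i * ρ) ^ α * rtr (M i * σ) ^ (1 - α)}

/-- The measured Rényi divergence. -/
def measuredD (α : ℝ) (ρ σ : Matrix ι ι ℂ) : ℝ :=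
  1 / (α - 1) * Real.log (sSup (measuredValues α ρ σ))

/-- The sandwiched Rényi divergence. -/
def sandwichedD (α : ℝ) (ρ σ : Matrix ι ι ℂ) : ℝ :=
  1 / (α - 1) * Real.log (rtr (mpow
    (mpow σ ((1 - α) / (2 * α)) * ρ * mpow σ ((1 - α) / (2 * α))) α))

/-- The geometric Rényi divergence, in the form
`tr (σ^{1/2} (σ^{-1/2} ρ σ^{-1/2})^α σ^{1/2})` that applies to every `ρ ≪ σ`. -/
def geometricD (α : ℝ) (ρ σ : Matrix ι ι ℂ) : ℝ :=
  1 / (α - 1) * Real.log (rtr (mpow σ (1 / 2) *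
    mpow (mpow σ (-1 / 2) * ρ * mpow σ (-1 / 2)) α * mpow σ (1 / 2)))

/-- The geometric Rényi divergence in the form
`tr (ρ^{1/2} (ρ^{-1/2} σ ρ^{-1/2})^{1-α} ρ^{1/2})`, for `ρ` and `σ` with the same support. -/
def geometricD' (α : ℝ) (ρ σ : Matrix ι ι ℂ) : ℝ :=
  1 / (α - 1) * Real.log (rtr (mpow ρ (1 / 2) *
    mpow (mpow ρ (-1 / 2) * σ * mpow ρ (-1 / 2)) (1 - α) * mpow ρ (1 / 2)))

/-! ### Channels -/

/-- `id_n ⊗ E` on matrices. -/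
def ampliation {κ : Type v} (n : ℕ) (E : Matrix ι ι ℂ →ₗ[ℂ] Matrix κ κ ℂ)
    (X : Matrix (Fin n × ι) (Fin n × ι) ℂ) : Matrix (Fin n × κ) (Fin n × κ) ℂ :=
  Matrix.of fun p q => E (Matrix.of fun i j => X (p.1, i) (q.1, j)) p.2 q.2

/-- Completely positive and trace preserving maps. -/
def IsCPTP {κ : Type v} [Fintype κ] (E : Matrix ι ι ℂ →ₗ[ℂ] Matrix κ κ ℂ) : Prop :=
  (∀ (n : ℕ) (X : Matrix (Fin n × ι) (Fin n × ι) ℂ), X.PosSemidef →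
    (ampliation n E X).PosSemidef) ∧
  ∀ X : Matrix ι ι ℂ, (E X).trace = X.trace

end

end IteratedMean

open IteratedMean

/-! # The iterated mean divergence -/

namespace IteratedMean

open Matrix

set_option linter.unusedSectionVars false

/-! ### Traces, Hermitian parts and block matrices -/

section Basic

variable {ι : Type*} [Fintype ι]

/-! By Schur complements the primal constraints form a chain `V_iᴴ V_i ≤ herm V_{i+1}`, with `Z` in
the place of `V_{k+1}`. Scaling `V_i` by `t^(2^(i-1))` preserves the chain and multiplies `tr σZ` by
`t^(2^k)`. Let `x` be the largest `tr ρ herm V_1` under `tr σZ ≤ 1`; it is attained because a chain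
may be compressed to the support of `σ`, where it is bounded (`Chain.exists_bounded`). Since `α_k`
and `2^k` are conjugate exponents, Young's inequality gives the value `x^α_k` to both the original
and the rescaled program (`exists_primal_optimum`).

The scalar chain `V_i = 1/4` is a Slater point, so Hahn-Banach separation yields positive
multipliers, which are a dual optimum (`exists_dualChain_le`). Rescaling the dual variables and the
weighted AM-GM inequality make the traces equal (`DualChain.exists_equalTraces`). As `A # B` is the
largest `C` with positive block matrix `[A, C; C, B]` (`geomMean_spec`), the dual constraints amount
to an iterated mean.

Most inequalities then come from exhibiting a feasible point. Channels and tensor products map dual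
points to dual points. Dropping the first link of a primal chain and using the Cauchy-Schwarz
inequality compares `k` with `k - 1`. With `G = σ^{-1/2} ρ σ^{-1/2}`, interpolating between `G` and
`1` by powers of `G` gives a dual point whose value is the geometric quantity.

The sandwiched lower bound needs a primal chain with all links tight. Each link is solved by a
Lyapunov map, a Schur multiplier with kernel `2 e_i e_j / (e_i² + e_j²)` (`exists_lyapunov_map`). It
satisfies Kadison's inequality and does not increase traces, which bounds the cost of the chain. The
same map proves an Araki-Lieb-Thirring inequality (`rtr_conj_pow_le`), and with Young's trace
inequality this bounds the measured quantity by the sandwiched one. For commuting operators the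
sandwiched and geometric bounds coincide. -/

lemma rtr_add (A B : Matrix ι ι ℂ) : rtr (A + B) = rtr A + rtr B := by simp [rtr]

lemma rtr_sub (A B : Matrix ι ι ℂ) : rtr (A - B) = rtr A - rtr B := by simp [rtr]

lemma rtr_neg (A : Matrix ι ι ℂ) : rtr (-A) = -rtr A := by simp [rtr]

lemma rtr_zero : rtr (0 : Matrix ι ι ℂ) = 0 := by simp [rtr]

lemma rtr_smul (c : ℝ) (A : Matrix ι ι ℂ) : rtr ((c : ℂ) • A) = c * rtr A := by
  simp [rtr, Matrix.trace_smul]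

lemma rtr_sum {κ : Type*} (s : Finset κ) (A : κ → Matrix ι ι ℂ) :
    rtr (∑ i ∈ s, A i) = ∑ i ∈ s, rtr (A i) := by
  simp [rtr, Matrix.trace_sum]

lemma rtr_mul_comm {κ : Type*} [Fintype κ] (A : Matrix ι κ ℂ) (B : Matrix κ ι ℂ) :
    rtr (A * B) = rtr (B * A) := by
  simp only [rtr, Matrix.trace_mul_comm A B]

lemma rtr_conjTranspose (A : Matrix ι ι ℂ) : rtr Aᴴ = rtr A := by
  simp [rtr, Matrix.trace_conjTranspose]

lemma rtr_nonneg {A : Matrix ι ι ℂ} (hA : A.PosSemidef) : 0 ≤ rtr A :=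
  (Complex.nonneg_iff.mp hA.trace_nonneg).1

lemma trace_eq_rtr {A : Matrix ι ι ℂ} (hA : A.IsHermitian) : A.trace = (rtr A : ℂ) := by
  have h : (starRingEnd ℂ) A.trace = A.trace := by
    have := Matrix.trace_conjTranspose A
    rw [hA.eq] at this
    exact this.symm
  exact (Complex.conj_eq_iff_re.mp h).symm

lemma PosSemidef.smul_real {A : Matrix ι ι ℂ} (hA : A.PosSemidef) {c : ℝ} (hc : 0 ≤ c) :
    ((c : ℂ) • A).PosSemidef :=
  hA.smul (by exact_mod_cast hc)

lemma rtr_mul_nonneg [DecidableEq ι] {A B : Matrix ι ι ℂ} (hA : A.PosSemidef)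
    (hB : B.PosSemidef) : 0 ≤ rtr (A * B) := by
  obtain ⟨C, rfl⟩ : ∃ C : Matrix ι ι ℂ, A = Cᴴ * C := by
    open scoped MatrixOrder in
    obtain ⟨C, hC⟩ := CStarAlgebra.nonneg_iff_eq_star_mul_self.mp hA.nonneg
    exact ⟨C, hC⟩
  rw [Matrix.mul_assoc, rtr_mul_comm]
  exact rtr_nonneg (hB.mul_mul_conjTranspose_same C)

lemma rtr_mul_le [DecidableEq ι] {A B C : Matrix ι ι ℂ} (hA : A.PosSemidef)
    (h : (C - B).PosSemidef) : rtr (A * B) ≤ rtr (A * C) := by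
  have := rtr_mul_nonneg hA h
  rw [Matrix.mul_sub, rtr_sub] at this
  linarith

lemma rtr_le {B C : Matrix ι ι ℂ} (h : (C - B).PosSemidef) : rtr B ≤ rtr C := by
  have := rtr_nonneg h
  rw [rtr_sub] at this
  linarith

lemma herm_isHermitian (V : Matrix ι ι ℂ) : (herm V).IsHermitian := by
  simp [herm, Matrix.IsHermitian, Matrix.conjTranspose_smul, add_comm]

lemma herm_eq_self {V : Matrix ι ι ℂ} (hV : V.IsHermitian) : herm V = V := by
  rw [herm, hV.eq, ← two_smul ℂ V, smul_smul]; norm_num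

lemma herm_posSemidef_iff {V : Matrix ι ι ℂ} : (V + Vᴴ).PosSemidef ↔ (herm V).PosSemidef := by
  constructor
  · intro h
    exact h.smul (a := (1 / 2 : ℂ)) (by norm_num [Complex.le_def])
  · intro h
    have := h.smul (a := (2 : ℂ)) (by norm_num [Complex.le_def])
    rwa [herm, smul_smul, show (2 : ℂ) * (1 / 2) = 1 by norm_num, one_smul] at this

lemma herm_smul (c : ℝ) (V : Matrix ι ι ℂ) : herm ((c : ℂ) • V) = (c : ℂ) • herm V := by
  simp only [herm, conjTranspose_smul, Complex.star_def, Complex.conj_ofReal, ← smul_add,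
    smul_comm (c : ℂ)]

lemma rtr_mul_herm {A : Matrix ι ι ℂ} (hA : A.IsHermitian) (V : Matrix ι ι ℂ) :
    rtr (A * herm V) = rtr (A * V) := by
  have h : rtr (A * Vᴴ) = rtr (A * V) := by
    rw [← rtr_conjTranspose, conjTranspose_mul, conjTranspose_conjTranspose, hA.eq, rtr_mul_comm]
  have h2 : A * herm V = ((1 / 2 : ℝ) : ℂ) • (A * V + A * Vᴴ) := by
    simp [herm, Matrix.mul_add]
  rw [h2, rtr_smul, rtr_add, h]; ring

lemma rtr_fromBlocks {κ : Type*} [Fintype κ] (A : Matrix ι ι ℂ) (B : Matrix ι κ ℂ)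
    (C : Matrix κ ι ℂ) (D : Matrix κ κ ℂ) : rtr (fromBlocks A B C D) = rtr A + rtr D := by
  simp [rtr, Matrix.trace]

lemma block_one_posSemidef_iff [DecidableEq ι] {V H : Matrix ι ι ℂ} :
    (fromBlocks 1 V Vᴴ H).PosSemidef ↔ (H - Vᴴ * V).PosSemidef := by
  let _ : Invertible (1 : Matrix ι ι ℂ) := invertibleOne
  have := Matrix.PosDef.fromBlocks₁₁ (A := (1 : Matrix ι ι ℂ)) V H Matrix.PosDef.one
  simpa using this

lemma block_posSemidef_of_factor (X Y : Matrix ι ι ℂ) :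
    (fromBlocks (Xᴴ * X) (Xᴴ * Y) (Yᴴ * X) (Yᴴ * Y)).PosSemidef := by
  have := posSemidef_conjTranspose_mul_self (fromBlocks X Y 0 0 : Matrix (ι ⊕ ι) (ι ⊕ ι) ℂ)
  simpa [fromBlocks_conjTranspose, fromBlocks_multiply] using this

lemma block_conj_posSemidef {A B C D : Matrix ι ι ℂ} (h : (fromBlocks A B C D).PosSemidef)
    (X Y : Matrix ι ι ℂ) :
    (fromBlocks (Xᴴ * A * X) (Xᴴ * B * Y) (Yᴴ * C * X) (Yᴴ * D * Y)).PosSemidef := by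
  have := h.conjTranspose_mul_mul_same (fromBlocks X 0 0 Y)
  simpa [fromBlocks_conjTranspose, fromBlocks_multiply] using this

lemma block_left {A B C D : Matrix ι ι ℂ} (h : (fromBlocks A B C D).PosSemidef) :
    A.PosSemidef := by
  have := h.submatrix (Sum.inl : ι → ι ⊕ ι)
  exact this

lemma block_right {A B C D : Matrix ι ι ℂ} (h : (fromBlocks A B C D).PosSemidef) :
    D.PosSemidef := by
  have := h.submatrix (Sum.inr : ι → ι ⊕ ι)
  exact this

lemma block_symm {A B C D : Matrix ι ι ℂ} (h : (fromBlocks A B C D).PosSemidef) : Bᴴ = C := by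
  have := h.1
  rw [IsHermitian, fromBlocks_conjTranspose, fromBlocks_inj] at this
  exact this.2.2.1 ▸ by simp

lemma block_diag_posSemidef {A D : Matrix ι ι ℂ} (hA : A.PosSemidef) (hD : D.PosSemidef) :
    (fromBlocks A 0 0 D).PosSemidef := by
  classical
  open scoped MatrixOrder in
  obtain ⟨X, hX⟩ := CStarAlgebra.nonneg_iff_eq_star_mul_self.mp hA.nonneg
  open scoped MatrixOrder in
  obtain ⟨Y, hY⟩ := CStarAlgebra.nonneg_iff_eq_star_mul_self.mp hD.nonneg
  have := posSemidef_conjTranspose_mul_self (fromBlocks X 0 0 Y : Matrix (ι ⊕ ι) (ι ⊕ ι) ℂ)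
  rw [hX, hY]
  simpa [star_eq_conjTranspose, fromBlocks_conjTranspose, fromBlocks_multiply] using this

lemma block_add_posSemidef {A B C D X Y : Matrix ι ι ℂ} (h : (fromBlocks A B C D).PosSemidef)
    (hX : X.PosSemidef) (hY : Y.PosSemidef) : (fromBlocks (A + X) B C (D + Y)).PosSemidef := by
  have := h.add (block_diag_posSemidef hX hY)
  simpa [fromBlocks_add] using this

/-- One step of weak duality: the trace pairing of two positive block matrices is nonnegative.
Conjugation by `diag(1, -1)` first flips the sign of `C`. -/
lemma two_rtr_mul_le [DecidableEq ι] {A B C V H : Matrix ι ι ℂ}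
    (h : (fromBlocks A C C B).PosSemidef) (hV : (fromBlocks 1 V Vᴴ H).PosSemidef) :
    2 * rtr (C * V) ≤ rtr A + rtr (B * H) := by
  have h1 : (fromBlocks A (-C) (-C) B).PosSemidef := by
    have := block_conj_posSemidef h 1 (-1)
    simpa using this
  have hC : C.IsHermitian := block_symm h
  have h2 := rtr_mul_nonneg h1 hV
  rw [fromBlocks_multiply, rtr_fromBlocks] at h2
  have h3 : rtr (C * Vᴴ) = rtr (C * V) := by
    rw [← rtr_conjTranspose, conjTranspose_mul, conjTranspose_conjTranspose, hC.eq, rtr_mul_comm]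
  simp only [Matrix.mul_one, Matrix.neg_mul, rtr_add, rtr_neg, h3] at h2
  linarith

end Basic

/-! ### Functional calculus of Hermitian matrices -/

section Calculus

variable {ι : Type*} [Fintype ι] [DecidableEq ι]

/-- The spectrum is finite, so continuity never restricts the functional calculus below. -/
lemma continuousOn_spectrum (f : ℝ → ℝ) (A : Matrix ι ι ℂ) : ContinuousOn f (spectrum ℝ A) :=
  A.finite_real_spectrum.continuousOn f

lemma cfc_mul_cfc (f g : ℝ → ℝ) (A : Matrix ι ι ℂ) :
    cfc f A * cfc g A = cfc (fun t => f t * g t) A :=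
  (cfc_mul f g A (continuousOn_spectrum f A) (continuousOn_spectrum g A)).symm

lemma cfc_isHermitian (f : ℝ → ℝ) (A : Matrix ι ι ℂ) : (cfc f A).IsHermitian :=
  cfc_predicate f A

lemma mpow_isHermitian (A : Matrix ι ι ℂ) (r : ℝ) : (mpow A r).IsHermitian :=
  cfc_predicate _ A

lemma spectrum_nonneg {A : Matrix ι ι ℂ} (hA : A.PosSemidef) {t : ℝ} (ht : t ∈ spectrum ℝ A) :
    0 ≤ t := by
  rw [hA.1.spectrum_real_eq_range_eigenvalues] at ht
  obtain ⟨i, rfl⟩ := ht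
  exact hA.eigenvalues_nonneg i

lemma cfc_eq_unitary {A : Matrix ι ι ℂ} (hA : A.IsHermitian) (f : ℝ → ℝ) :
    cfc f A = (hA.eigenvectorUnitary : Matrix ι ι ℂ) *
      diagonal (fun i => ((f (hA.eigenvalues i) : ℝ) : ℂ)) *
      (hA.eigenvectorUnitary : Matrix ι ι ℂ)ᴴ := by
  rw [hA.cfc_eq]; rfl

lemma cfc_posSemidef {A : Matrix ι ι ℂ} {f : ℝ → ℝ} (hf : ∀ t ∈ spectrum ℝ A, 0 ≤ f t) :
    (cfc f A).PosSemidef := by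
  by_cases hA : A.IsHermitian
  · rw [cfc_eq_unitary hA]
    refine PosSemidef.mul_mul_conjTranspose_same (PosSemidef.diagonal ?_) _
    intro i
    have := hf _ (hA.eigenvalues_mem_spectrum_real i)
    simpa using this
  · rw [cfc_apply_of_not_predicate (p := IsSelfAdjoint) A hA]
    exact PosSemidef.zero

lemma mpow_posSemidef {A : Matrix ι ι ℂ} (hA : A.PosSemidef) (r : ℝ) : (mpow A r).PosSemidef :=
  cfc_posSemidef fun _ ht => Real.rpow_nonneg (spectrum_nonneg hA ht) r

lemma cfc_congr_psd {A : Matrix ι ι ℂ} (hA : A.PosSemidef) {f g : ℝ → ℝ}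
    (h : ∀ t, 0 ≤ t → f t = g t) : cfc f A = cfc g A :=
  cfc_congr fun t ht => h t (spectrum_nonneg hA ht)

lemma mpow_mul_mpow {A : Matrix ι ι ℂ} (hA : A.PosSemidef) {a b c : ℝ}
    (h : ∀ t : ℝ, 0 ≤ t → t ^ a * t ^ b = t ^ c) : mpow A a * mpow A b = mpow A c := by
  rw [mpow, mpow, cfc_mul_cfc]
  exact cfc_congr_psd hA h

lemma mpow_mul_mpow_of_nonneg {A : Matrix ι ι ℂ} (hA : A.PosSemidef) {a b : ℝ} (ha : 0 ≤ a)
    (hb : 0 ≤ b) : mpow A a * mpow A b = mpow A (a + b) :=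
  mpow_mul_mpow hA fun _ ht => (Real.rpow_add_of_nonneg ht ha hb).symm

lemma rpow_mul_rpow {t a b : ℝ} (ht : 0 ≤ t) (h : a + b ≠ 0) : t ^ a * t ^ b = t ^ (a + b) :=
  (Real.rpow_add' ht h).symm

/-- The only obstruction is the eigenvalue `0`, where opposite nonzero powers multiply to `0` while
`0 ^ 0 = 1`. -/
lemma mpow_mul_mpow_of_ne {A : Matrix ι ι ℂ} (hA : A.PosSemidef) {a b : ℝ} (h : a + b ≠ 0) :
    mpow A a * mpow A b = mpow A (a + b) :=
  mpow_mul_mpow hA fun _ ht => rpow_mul_rpow ht h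

lemma mpow_one {A : Matrix ι ι ℂ} (hA : A.IsHermitian) : mpow A 1 = A := by
  simp only [mpow, Real.rpow_one]
  exact cfc_id' ℝ A hA

lemma mpow_zero {A : Matrix ι ι ℂ} (hA : A.IsHermitian) : mpow A 0 = 1 := by
  simp only [mpow, Real.rpow_zero]
  exact cfc_const_one ℝ A hA

lemma cfc_pow_eq {A : Matrix ι ι ℂ} (hA : A.IsHermitian) (n : ℕ) :
    cfc (fun t : ℝ => t ^ n) A = A ^ n :=
  cfc_pow_id A n hA

lemma mpow_pow {A : Matrix ι ι ℂ} (hA : A.PosSemidef) (r : ℝ) (n : ℕ) :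
    mpow A r ^ n = mpow A (r * n) := by
  rw [mpow, ← cfc_pow _ n A (continuousOn_spectrum _ A) hA.1.isSelfAdjoint]
  exact cfc_congr_psd hA fun t ht => (Real.rpow_mul_natCast ht r n).symm

lemma mpow_mpow {A : Matrix ι ι ℂ} (hA : A.PosSemidef) (a b : ℝ) :
    mpow (mpow A a) b = mpow A (a * b) := by
  rw [mpow, mpow, ← cfc_comp _ _ A hA.1.isSelfAdjoint ((A.finite_real_spectrum.image _).continuousOn _)
    (continuousOn_spectrum _ A)]
  exact cfc_congr_psd hA fun t ht => (Real.rpow_mul ht a b).symm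

/-- The trace of a product of functions of two Hermitian matrices is a nonnegative combination of
products of function values at their eigenvalues. -/
lemma exists_weights {A B : Matrix ι ι ℂ} (hA : A.IsHermitian) (hB : B.IsHermitian) :
    ∃ w : ι → ι → ℝ, (∀ i j, 0 ≤ w i j) ∧ ∀ f g : ℝ → ℝ, rtr (cfc f A * cfc g B) =
      ∑ i, ∑ j, w i j * (f (hA.eigenvalues i) * g (hB.eigenvalues j)) := by
  set U : Matrix ι ι ℂ := (hA.eigenvectorUnitary : Matrix ι ι ℂ) with hU
  set V : Matrix ι ι ℂ := (hB.eigenvectorUnitary : Matrix ι ι ℂ) with hV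
  -- The weights are the squared overlaps of the two eigenbases.
  refine ⟨fun i j => Complex.normSq ((Uᴴ * V) i j), fun _ _ => Complex.normSq_nonneg _,
    fun f g => ?_⟩
  rw [cfc_eq_unitary hA, cfc_eq_unitary hB, ← hU, ← hV]
  have h1 : U * diagonal (fun i => ((f (hA.eigenvalues i) : ℝ) : ℂ)) * Uᴴ *
      (V * diagonal (fun i => ((g (hB.eigenvalues i) : ℝ) : ℂ)) * Vᴴ) =
      U * (diagonal (fun i => ((f (hA.eigenvalues i) : ℝ) : ℂ)) * (Uᴴ * V) *
        diagonal (fun i => ((g (hB.eigenvalues i) : ℝ) : ℂ)) * Vᴴ) := by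
    simp only [Matrix.mul_assoc]
  rw [h1, rtr_mul_comm, Matrix.mul_assoc _ Vᴴ U,
    show Vᴴ * U = (Uᴴ * V)ᴴ by rw [conjTranspose_mul, conjTranspose_conjTranspose]]
  generalize Uᴴ * V = W
  have h2 : ∀ M : Matrix ι ι ℂ, rtr (M * Wᴴ) = ∑ i, ∑ j, (M i j * star (W i j)).re := fun M => by
    simp only [rtr, Matrix.trace, Matrix.diag, Matrix.mul_apply, conjTranspose_apply,
      Complex.re_sum]
  rw [h2]
  refine Finset.sum_congr rfl fun i _ => Finset.sum_congr rfl fun j _ => ?_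
  rw [Matrix.mul_diagonal, Matrix.diagonal_mul]
  beta_reduce
  rw [Complex.normSq_apply]
  simp
  ring

/-- Klein's argument: the weights of `exists_weights` are nonnegative and do not depend on the
functions, so a scalar inequality can be summed against them even when `A` and `B` do not commute.
-/
lemma rtr_comparison {A B : Matrix ι ι ℂ} (hA : A.PosSemidef) (hB : B.PosSemidef) {κ : Type*}
    (s : Finset κ) (f g : κ → ℝ → ℝ)
    (h : ∀ a b : ℝ, 0 ≤ a → 0 ≤ b → 0 ≤ ∑ l ∈ s, f l a * g l b) :
    0 ≤ ∑ l ∈ s, rtr (cfc (f l) A * cfc (g l) B) := by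
  obtain ⟨w, hw, H⟩ := exists_weights hA.1 hB.1
  simp only [H]
  rw [Finset.sum_comm]
  refine Finset.sum_nonneg fun i _ => ?_
  rw [Finset.sum_comm]
  refine Finset.sum_nonneg fun j _ => ?_
  rw [← Finset.mul_sum]
  exact mul_nonneg (hw i j) (h _ _ (hA.eigenvalues_nonneg i) (hB.eigenvalues_nonneg j))

lemma pow_tangent_le {a b : ℝ} (ha : 0 ≤ a) (hb : 0 ≤ b) (n : ℕ) :
    a ^ (n + 1) + (n + 1) * a ^ n * (b - a) ≤ b ^ (n + 1) := by
  induction n with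
  | zero => simp
  | succ n ih =>
    have h1 := mul_le_mul_of_nonneg_left ih hb
    -- This is exactly what is lost when the induction hypothesis is multiplied by `b`.
    have h2 : 0 ≤ (n + 1) * a ^ n * (b - a) ^ 2 := by positivity
    push_cast
    calc _ ≤ b * (a ^ (n + 1) + (n + 1) * a ^ n * (b - a)) := by
          rw [← sub_nonneg]; convert h2 using 1; ring
      _ ≤ b * b ^ (n + 1) := h1
      _ = _ := by ring

/-- Tangent-line inequality for `tr A ^ (n + 1)`. -/
lemma rtr_pow_tangent_le {A B : Matrix ι ι ℂ} (hA : A.PosSemidef) (hB : B.PosSemidef) (n : ℕ) :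
    rtr (A ^ (n + 1)) + (n + 1) * rtr (A ^ n * (B - A)) ≤ rtr (B ^ (n + 1)) := by
  -- The four products expand `b^(n+1) - a^(n+1) - (n+1) a^n (b - a)`.
  have h := rtr_comparison hA hB (Finset.univ : Finset (Fin 4))
    ![fun _ => 1, fun a => -a ^ (n + 1), fun a => -(n + 1) * a ^ n, fun a => (n + 1) * a ^ (n + 1)]
    ![fun b => b ^ (n + 1), fun _ => 1, fun b => b, fun _ => 1] (by
      intro a b ha hb
      have := pow_tangent_le ha hb n
      simp only [Fin.sum_univ_four, Matrix.cons_val]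
      calc (0 : ℝ) ≤ b ^ (n + 1) - (a ^ (n + 1) + (n + 1) * a ^ n * (b - a)) := by linarith
        _ = _ := by ring)
  simp only [Fin.sum_univ_four, Matrix.cons_val] at h
  have e1 : ∀ M : Matrix ι ι ℂ, M.PosSemidef → cfc (fun _ : ℝ => (1 : ℝ)) M = 1 :=
    fun M hM => cfc_const_one ℝ M hM.1
  have e2 : cfc (fun b : ℝ => b) B = B := cfc_id' ℝ B hB.1
  have e3 : ∀ (c : ℝ) (m : ℕ), cfc (fun a : ℝ => c * a ^ m) A = (c : ℂ) • A ^ m := by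
    intro c m
    rw [cfc_const_mul c _ A (continuousOn_spectrum _ A), cfc_pow_eq hA.1, Complex.coe_smul]
  have e4 : cfc (fun a : ℝ => -a ^ (n + 1)) A = -A ^ (n + 1) := by
    rw [cfc_neg, cfc_pow_eq hA.1]
  have e5 := e3 (n + 1) (n + 1)
  have e6 := e3 (-(n + 1)) n
  rw [e1 _ hA, e1 _ hB, e2, e4, e5, e6, cfc_pow_eq hB.1, Matrix.one_mul, Matrix.mul_one,
    Matrix.mul_one, Matrix.smul_mul, rtr_smul, rtr_smul, rtr_neg] at h
  rw [Matrix.mul_sub, rtr_sub, ← pow_succ]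
  linarith

/-- In the tangent inequality at `A` the linear term pairs two positive matrices. -/
lemma rtr_pow_mono {A B : Matrix ι ι ℂ} (hA : A.PosSemidef) (h : (B - A).PosSemidef) (n : ℕ) :
    rtr (A ^ (n + 1)) ≤ rtr (B ^ (n + 1)) := by
  have hB : B.PosSemidef := by simpa using hA.add h
  have := rtr_pow_tangent_le hA hB n
  have h2 := rtr_mul_nonneg (hA.pow n) h
  have : 0 ≤ ((n : ℝ) + 1) * rtr (A ^ n * (B - A)) := by positivity
  linarith

/-- The tangent inequalities at the midpoint are added; their linear terms cancel. -/
lemma rtr_pow_midpoint_le {P Q : Matrix ι ι ℂ} (hP : P.PosSemidef) (hQ : Q.PosSemidef) (n : ℕ) :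
    2 * rtr ((((1 / 2 : ℝ) : ℂ) • (P + Q)) ^ (n + 1)) ≤ rtr (P ^ (n + 1)) + rtr (Q ^ (n + 1)) := by
  set A := ((1 / 2 : ℝ) : ℂ) • (P + Q) with hAdef
  have hA : A.PosSemidef := PosSemidef.smul_real (hP.add hQ) (by norm_num)
  have h1 := rtr_pow_tangent_le hA hP n
  have h2 := rtr_pow_tangent_le hA hQ n
  have h3 : rtr (A ^ n * (P - A)) + rtr (A ^ n * (Q - A)) = 0 := by
    rw [← rtr_add, ← Matrix.mul_add]
    have : P - A + (Q - A) = 0 := by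
      have : A + A = P + Q := by
        rw [hAdef, ← add_smul]; norm_num
      rw [sub_add_sub_comm, this, sub_self]
    rw [this, Matrix.mul_zero, rtr_zero]
  nlinarith

/-- Young's inequality for traces. -/
lemma rtr_mul_le_young {R T : Matrix ι ι ℂ} (hR : R.PosSemidef) (hT : T.PosSemidef) {α : ℝ}
    {N : ℕ} (hα : 1 < α) (hN : (N : ℝ) = α / (α - 1)) :
    α * rtr (R * T) ≤ rtr (mpow R α) + (α - 1) * rtr (T ^ N) := by
  have hα0 : 0 < α - 1 := by linarith
  have h := rtr_comparison hR hT (Finset.univ : Finset (Fin 3))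
    ![fun a => a ^ α, fun _ => α - 1, fun a => -α * a]
    ![fun _ => 1, fun b => b ^ N, fun b => b] (by
      intro a b ha hb
      have hpq : α.HolderConjugate (α / (α - 1)) := Real.HolderConjugate.conjExponent hα
      have := Real.young_inequality_of_nonneg ha hb hpq
      rw [← hN, Real.rpow_natCast] at this
      have h2 := mul_le_mul_of_nonneg_left this (show (0 : ℝ) ≤ α by linarith)
      rw [hN, show α * (a ^ α / α + b ^ N / (α / (α - 1))) = a ^ α + (α - 1) * b ^ N by
        field_simp] at h2
      simp [Fin.sum_univ_three]
      nlinarith)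
  simp only [Fin.sum_univ_three, Matrix.cons_val] at h
  have e1 : cfc (fun _ : ℝ => (1 : ℝ)) T = 1 := cfc_const_one ℝ T hT.1
  have e2 : cfc (fun b : ℝ => b) T = T := cfc_id' ℝ T hT.1
  have e3 : cfc (fun _ : ℝ => α - 1) R = ((α - 1 : ℝ) : ℂ) • 1 := by
    rw [cfc_const _ R hR.1.isSelfAdjoint, Algebra.algebraMap_eq_smul_one, Complex.coe_smul]
  have e4 : cfc (fun a : ℝ => -α * a) R = ((-α : ℝ) : ℂ) • R := by
    rw [cfc_const_mul _ _ R (continuousOn_spectrum _ R), cfc_id' ℝ R hR.1.isSelfAdjoint, Complex.coe_smul]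
  rw [e1, e2, e3, e4, cfc_pow_eq hT.1, Matrix.mul_one, Matrix.smul_mul, Matrix.smul_mul,
    Matrix.one_mul, rtr_smul, rtr_smul] at h
  rw [mpow]
  linarith

end Calculus

/-! ### Orders -/

section Orders

lemma one_lt_two_pow_real {k : ℕ} (hk : 1 ≤ k) : (1 : ℝ) < 2 ^ k :=
  one_lt_pow₀ (by norm_num) (by omega)

lemma alpha_sub_one (k : ℕ) : alpha k - 1 = 1 / ((2 : ℝ) ^ k - 1) := by
  simp [alpha]

lemma alpha_sub_one_pos {k : ℕ} (hk : 1 ≤ k) : 0 < alpha k - 1 := by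
  rw [alpha_sub_one]
  have := one_lt_two_pow_real hk
  exact one_div_pos.mpr (by linarith)

lemma one_lt_alpha {k : ℕ} (hk : 1 ≤ k) : 1 < alpha k := by
  linarith [alpha_sub_one_pos hk]

lemma alpha_eq {k : ℕ} (hk : 1 ≤ k) : alpha k = (2 : ℝ) ^ k / ((2 : ℝ) ^ k - 1) := by
  have := one_lt_two_pow_real hk
  have h : (2 : ℝ) ^ k - 1 ≠ 0 := by linarith
  rw [alpha]; field_simp; ring

lemma alpha_sub_one_mul {k : ℕ} (hk : 1 ≤ k) : (alpha k - 1) * (2 : ℝ) ^ k = alpha k := by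
  rw [alpha_sub_one, alpha_eq hk]; ring

lemma two_pow_eq_div {k : ℕ} (hk : 1 ≤ k) :
    (((2 ^ k : ℕ)) : ℝ) = alpha k / (alpha k - 1) := by
  rw [eq_div_iff (alpha_sub_one_pos hk).ne', mul_comm, Nat.cast_pow, Nat.cast_ofNat,
    alpha_sub_one_mul hk]

/-- The exponents `alpha k` and `2 ^ k` are conjugate, which is what ties these orders to chains of
`k` quadratic constraints. -/
lemma young_rpow_pow {k : ℕ} (hk : 1 ≤ k) {a b : ℝ} (ha : 0 ≤ a) (hb : 0 ≤ b) :
    alpha k * (a * b) ≤ a ^ alpha k + (alpha k - 1) * b ^ (2 ^ k) := by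
  have h1 := one_lt_alpha hk
  have h0 := alpha_sub_one_pos hk
  have := Real.young_inequality_of_nonneg ha hb (Real.HolderConjugate.conjExponent h1)
  have e : Real.conjExponent (alpha k) = ((2 ^ k : ℕ) : ℝ) := (two_pow_eq_div hk).symm
  rw [e, Real.rpow_natCast, two_pow_eq_div hk] at this
  have h2 := mul_le_mul_of_nonneg_left this (show (0 : ℝ) ≤ alpha k by linarith)
  refine h2.trans_eq ?_
  have : alpha k ≠ 0 := by linarith
  field_simp

lemma sum_two_pow_succ (k : ℕ) (f : ℕ → ℝ) :
    ∑ i ∈ Finset.Icc 1 (k + 1), (2 : ℝ) ^ (k + 1 - i) * f i =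
      2 * ∑ i ∈ Finset.Icc 1 k, (2 : ℝ) ^ (k - i) * f i + f (k + 1) := by
  rw [Finset.sum_Icc_succ_top (by omega), Nat.sub_self, pow_zero, one_mul, Finset.mul_sum]
  congr 1
  refine Finset.sum_congr rfl fun i hi => ?_
  rw [Finset.mem_Icc] at hi
  rw [show k + 1 - i = (k - i) + 1 by omega, pow_succ]; ring

/-- The weights halve at each index, so `y (i + 1)` receives `2 * 2^(k-i-1)` from one term and
`-2^(k-i)` from the previous one. -/
lemma sum_two_pow_telescope (k : ℕ) (y : ℕ → ℝ) :
    ∑ i ∈ Finset.Icc 1 k, (2 : ℝ) ^ (k - i) * (2 * y i - y (i + 1)) = 2 ^ k * y 1 - y (k + 1) := by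
  induction k with
  | zero => simp
  | succ k ih => rw [sum_two_pow_succ k (fun i => 2 * y i - y (i + 1)), ih]; ring

lemma sum_two_pow (k : ℕ) : ∑ i ∈ Finset.Icc 1 k, (2 : ℝ) ^ (k - i) = 2 ^ k - 1 := by
  have := sum_two_pow_telescope k (fun _ => 1)
  norm_num at this
  exact this

end Orders

/-! ### Closedness and bounds for positive semidefinite matrices -/

section Psd

variable {ι : Type*} [Fintype ι] [DecidableEq ι]

lemma posSemidef_iff_re {A : Matrix ι ι ℂ} :
    A.PosSemidef ↔ A.IsHermitian ∧ ∀ x : ι → ℂ, 0 ≤ (star x ⬝ᵥ (A *ᵥ x)).re := by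
  constructor
  · exact fun h => ⟨h.1, fun x => h.re_dotProduct_nonneg x⟩
  · rintro ⟨h1, h2⟩
    refine PosSemidef.of_dotProduct_mulVec_nonneg h1 fun x => ?_
    rw [Complex.nonneg_iff]
    exact ⟨h2 x, (h1.im_star_dotProduct_mulVec_self x).symm⟩

lemma isClosed_posSemidef : IsClosed {A : Matrix ι ι ℂ | A.PosSemidef} := by
  simp only [posSemidef_iff_re, Set.ofPred_and, Set.ofPred_forall]
  refine IsClosed.inter ?_ (isClosed_iInter fun x => ?_)
  · exact isClosed_eq (by fun_prop) continuous_id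
  · exact isClosed_le continuous_const (by fun_prop)

lemma continuous_rtr : Continuous (rtr : Matrix ι ι ℂ → ℝ) :=
  Complex.continuous_re.comp (by fun_prop)

lemma continuous_herm : Continuous (herm : Matrix ι ι ℂ → Matrix ι ι ℂ) := by
  unfold herm; fun_prop

lemma rtr_one : rtr (1 : Matrix ι ι ℂ) = Fintype.card ι := by
  simp [rtr]

/-- Each eigenvalue is at most the sum of all of them, these being nonnegative. -/
lemma rtr_smul_one_sub_posSemidef {M : Matrix ι ι ℂ} (hM : M.PosSemidef) :
    (((rtr M : ℝ) : ℂ) • (1 : Matrix ι ι ℂ) - M).PosSemidef := by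
  have h : ((rtr M : ℝ) : ℂ) • (1 : Matrix ι ι ℂ) - M = cfc (fun t : ℝ => rtr M - t) M := by
    rw [cfc_sub _ _ M (continuousOn_spectrum _ M) (continuousOn_spectrum _ M),
      cfc_const _ M hM.1.isSelfAdjoint, cfc_id' ℝ M hM.1.isSelfAdjoint,
      Algebra.algebraMap_eq_smul_one, Complex.coe_smul]
  rw [h]
  refine cfc_posSemidef fun t ht => ?_
  rw [hM.1.spectrum_real_eq_range_eigenvalues] at ht
  obtain ⟨i, rfl⟩ := ht
  have h2 : rtr M = ∑ i, hM.1.eigenvalues i := by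
    rw [rtr, hM.1.trace_eq_sum_eigenvalues]
    simp
  rw [h2, sub_nonneg]
  exact Finset.single_le_sum (f := hM.1.eigenvalues) (fun j _ => hM.eigenvalues_nonneg j)
    (Finset.mem_univ i)

lemma rtr_mul_self_le {M : Matrix ι ι ℂ} (hM : M.PosSemidef) : rtr (M * M) ≤ rtr M ^ 2 := by
  have := rtr_mul_le hM (rtr_smul_one_sub_posSemidef hM)
  rw [Matrix.mul_smul, Matrix.mul_one, rtr_smul] at this
  rwa [sq]

lemma rtr_conjTranspose_mul_self (V : Matrix ι ι ℂ) :
    rtr (Vᴴ * V) = ∑ a, ∑ b, ‖V b a‖ ^ 2 := by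
  simp only [rtr, Matrix.trace, Matrix.diag, Matrix.mul_apply, conjTranspose_apply, Complex.re_sum]
  refine Finset.sum_congr rfl fun a _ => Finset.sum_congr rfl fun b _ => ?_
  rw [Complex.star_def, Complex.sq_norm, Complex.normSq_apply]
  simp

lemma norm_apply_sq_le (V : Matrix ι ι ℂ) (a b : ι) : ‖V a b‖ ^ 2 ≤ rtr (Vᴴ * V) := by
  rw [rtr_conjTranspose_mul_self]
  refine le_trans ?_ (Finset.single_le_sum (f := fun b => ∑ a, ‖V a b‖ ^ 2)
    (fun b _ => Finset.sum_nonneg fun a _ => by positivity) (Finset.mem_univ b))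
  exact Finset.single_le_sum (f := fun a => ‖V a b‖ ^ 2) (fun a _ => by positivity)
    (Finset.mem_univ a)

lemma norm_apply_le_rtr {M : Matrix ι ι ℂ} (hM : M.PosSemidef) (a b : ι) : ‖M a b‖ ≤ rtr M := by
  have h1 := norm_apply_sq_le M a b
  rw [hM.1.eq] at h1
  exact abs_le_of_sq_le_sq' (h1.trans (rtr_mul_self_le hM)) (rtr_nonneg hM) |>.2

/-- Expand `tr (V - 1)ᴴ (V - 1) ≥ 0`. This lets a trace bound descend along a chain. -/
lemma two_rtr_le (V : Matrix ι ι ℂ) : 2 * rtr V ≤ Fintype.card ι + rtr (Vᴴ * V) := by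
  have h := rtr_nonneg (posSemidef_conjTranspose_mul_self (V - 1))
  simp only [conjTranspose_sub, conjTranspose_one, Matrix.sub_mul, Matrix.mul_sub, Matrix.mul_one,
    Matrix.one_mul, rtr_sub, rtr_conjTranspose, rtr_one] at h
  linarith

lemma rtr_herm (V : Matrix ι ι ℂ) : rtr (herm V) = rtr V := by
  have := rtr_mul_herm (isHermitian_one (n := ι) (α := ℂ)) V
  simpa using this

/-- The orthogonal projection onto the support. -/
noncomputable def suppProj (σ : Matrix ι ι ℂ) : Matrix ι ι ℂ :=
  cfc (fun t : ℝ => if t = 0 then 0 else 1) σ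

lemma suppProj_isHermitian (σ : Matrix ι ι ℂ) : (suppProj σ).IsHermitian := cfc_isHermitian _ _

lemma suppProj_mul_self (σ : Matrix ι ι ℂ) : suppProj σ * suppProj σ = suppProj σ := by
  rw [suppProj, cfc_mul_cfc]
  congr 1; ext t; simp

lemma mul_suppProj {σ : Matrix ι ι ℂ} (hσ : σ.IsHermitian) : σ * suppProj σ = σ := by
  have h := cfc_mul_cfc (fun t => t) (fun t : ℝ => if t = 0 then 0 else 1) σ
  rw [cfc_id' ℝ σ hσ.isSelfAdjoint] at h
  rw [suppProj, h]
  conv_rhs => rw [← cfc_id' ℝ σ hσ.isSelfAdjoint]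
  congr 1; ext t; by_cases ht : t = 0 <;> simp [ht]

lemma suppProj_mul {σ : Matrix ι ι ℂ} (hσ : σ.IsHermitian) : suppProj σ * σ = σ := by
  have := congrArg conjTranspose (mul_suppProj hσ)
  rwa [conjTranspose_mul, hσ.eq, (suppProj_isHermitian σ).eq] at this

lemma one_sub_suppProj_posSemidef (σ : Matrix ι ι ℂ) : (1 - suppProj σ).PosSemidef := by
  have h := posSemidef_conjTranspose_mul_self (1 - suppProj σ)
  have e : (1 - suppProj σ)ᴴ * (1 - suppProj σ) = 1 - suppProj σ := by
    rw [conjTranspose_sub, (suppProj_isHermitian σ).eq, conjTranspose_one, Matrix.sub_mul,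
      Matrix.mul_sub, Matrix.mul_sub, suppProj_mul_self]
    simp
  rwa [e] at h

lemma exists_smul_sub_suppProj_posSemidef {σ : Matrix ι ι ℂ} (hσ : σ.PosSemidef) :
    ∃ c : ℝ, 0 ≤ c ∧ ((c : ℂ) • σ - suppProj σ).PosSemidef := by
  -- The sum dominates every inverse eigenvalue; as `0⁻¹ = 0`, the kernel contributes nothing.
  refine ⟨∑ i, (hσ.1.eigenvalues i)⁻¹,
    Finset.sum_nonneg fun i _ => inv_nonneg.mpr (hσ.eigenvalues_nonneg i), ?_⟩
  set c := ∑ i, (hσ.1.eigenvalues i)⁻¹ with hc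
  have h : (c : ℂ) • σ - suppProj σ = cfc (fun t : ℝ => c * t - if t = 0 then 0 else 1) σ := by
    rw [cfc_sub _ _ σ (continuousOn_spectrum _ σ) (continuousOn_spectrum _ σ),
      cfc_const_mul _ _ σ (continuousOn_spectrum _ σ), cfc_id' ℝ σ hσ.1.isSelfAdjoint,
      Complex.coe_smul, suppProj]
  rw [h]
  refine cfc_posSemidef fun t ht => ?_
  have ht0 := spectrum_nonneg hσ ht
  rw [hσ.1.spectrum_real_eq_range_eigenvalues] at ht
  obtain ⟨i, rfl⟩ := ht
  split_ifs with h0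
  · simp [h0]
  · have h1 : (hσ.1.eigenvalues i)⁻¹ ≤ c := Finset.single_le_sum
      (f := fun i => (hσ.1.eigenvalues i)⁻¹)
      (fun j _ => inv_nonneg.mpr (hσ.eigenvalues_nonneg j)) (Finset.mem_univ i)
    have h2 := mul_le_mul_of_nonneg_right h1 ht0
    rw [inv_mul_cancel₀ h0] at h2
    linarith

/-- Orthogonal complements turn the inclusion of supports into `ker σ ⊆ ker ρ`, and the columns of
`1 - suppProj σ` lie in `ker σ`. -/
lemma Dominated.mul_suppProj {ρ σ : Matrix ι ι ℂ} (hσ : σ.IsHermitian) (h : Dominated ρ σ) :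
    ρ * suppProj σ = ρ := by
  have hk : LinearMap.ker (Matrix.toEuclideanLin σ) ≤ LinearMap.ker (Matrix.toEuclideanLin ρ) := by
    have := Submodule.orthogonal_le h
    rwa [supp, supp, Submodule.orthogonal_orthogonal, Submodule.orthogonal_orthogonal] at this
  have h0 : σ * (1 - suppProj σ) = 0 := by
    rw [Matrix.mul_sub, IteratedMean.mul_suppProj hσ, Matrix.mul_one, sub_self]
  have h1 : ρ * (1 - suppProj σ) = 0 := by
    ext i j
    have hv : σ *ᵥ (fun a => (1 - suppProj σ) a j) = 0 := by
      ext a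
      exact congrFun (congrFun h0 a) j
    have hm : WithLp.toLp 2 (fun a => (1 - suppProj σ) a j) ∈
        LinearMap.ker (Matrix.toEuclideanLin σ) := by
      rw [LinearMap.mem_ker]
      ext a
      exact congrFun hv a
    have := hk hm
    rw [LinearMap.mem_ker] at this
    exact congrArg (fun z : EuclideanSpace ℂ ι => z i) this
  rw [Matrix.mul_sub, Matrix.mul_one, sub_eq_zero] at h1
  exact h1.symm

lemma Dominated.suppProj_mul {ρ σ : Matrix ι ι ℂ} (hρ : ρ.IsHermitian) (hσ : σ.IsHermitian)
    (h : Dominated ρ σ) : suppProj σ * ρ = ρ := by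
  have := congrArg conjTranspose (h.mul_suppProj hσ)
  rwa [conjTranspose_mul, hρ.eq, (suppProj_isHermitian σ).eq] at this

end Psd

/-! ### Chains of operators -/

section Chains

variable {ι : Type*} [Fintype ι] [DecidableEq ι]

/-- The primal constraints, with `V (k + 1)` in the place of `Z`. -/
def Chain (k : ℕ) (V : ℕ → Matrix ι ι ℂ) : Prop :=
  (herm (V 1)).PosSemidef ∧ ∀ i, 1 ≤ i → i ≤ k → (herm (V (i + 1)) - (V i)ᴴ * V i).PosSemidef

lemma Chain.herm_posSemidef {k : ℕ} {V : ℕ → Matrix ι ι ℂ} (h : Chain k V) {i : ℕ} (h1 : 1 ≤ i)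
    (h2 : i ≤ k + 1) : (herm (V i)).PosSemidef := by
  rcases i with _ | _ | i
  · omega
  · exact h.1
  · have := (h.2 (i + 1) (by omega) (by omega)).add
      (posSemidef_conjTranspose_mul_self (V (i + 1)))
    simpa using this

lemma Chain.primalFeasible {k : ℕ} (hk : 1 ≤ k) {V : ℕ → Matrix ι ι ℂ} (h : Chain k V) :
    PrimalFeasible k V (herm (V (k + 1))) := by
  refine ⟨h.herm_posSemidef (by omega) le_rfl, herm_posSemidef_iff.mpr h.1, fun i h1 h2 => ?_, ?_⟩
  · exact block_one_posSemidef_iff.mpr (h.2 i h1 h2.le)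
  · exact block_one_posSemidef_iff.mpr (h.2 k hk le_rfl)

lemma exists_chain_of_primalFeasible {k : ℕ} (hk : 1 ≤ k) {V : ℕ → Matrix ι ι ℂ}
    {Z : Matrix ι ι ℂ} (h : PrimalFeasible k V Z) :
    ∃ W, Chain k W ∧ W 1 = V 1 ∧ herm (W (k + 1)) = Z := by
  obtain ⟨hZ, h1, hi, hl⟩ := h
  have e : herm Z = Z := herm_eq_self hZ.1
  refine ⟨fun i => if i ≤ k then V i else Z, ⟨?_, fun i hi1 hi2 => ?_⟩, by simp [hk], by simp [e]⟩
  · simpa [hk] using herm_posSemidef_iff.mp h1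
  · rcases hi2.lt_or_eq with hlt | rfl
    · simpa [hi2, Nat.succ_le_of_lt hlt] using block_one_posSemidef_iff.mp (hi i hi1 hlt)
    · simpa [e] using block_one_posSemidef_iff.mp hl

lemma primalValues_eq {k : ℕ} (hk : 1 ≤ k) (ρ σ : Matrix ι ι ℂ) :
    primalValues k ρ σ = {q | ∃ V, Chain k V ∧
      q = alpha k * rtr (ρ * herm (V 1)) - (alpha k - 1) * rtr (σ * herm (V (k + 1)))} := by
  ext q
  constructor
  · rintro ⟨V, Z, h, rfl⟩
    obtain ⟨W, hW, e1, e2⟩ := exists_chain_of_primalFeasible hk h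
    exact ⟨W, hW, by rw [e1, e2]⟩
  · rintro ⟨V, h, rfl⟩
    exact ⟨V, _, h.primalFeasible hk, rfl⟩

lemma trace_mul_eq_one_iff {σ Z : Matrix ι ι ℂ} (hσ : σ.IsHermitian) (hZ : Z.IsHermitian) :
    (σ * Z).trace = 1 ↔ rtr (σ * Z) = 1 := by
  have h : (σ * Z).trace = (rtr (σ * Z) : ℂ) := by
    have h : (starRingEnd ℂ) (σ * Z).trace = (σ * Z).trace := by
      have := Matrix.trace_conjTranspose (σ * Z)
      rw [conjTranspose_mul, hσ.eq, hZ.eq, Matrix.trace_mul_comm] at this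
      exact this.symm
    exact (Complex.conj_eq_iff_re.mp h).symm
  rw [h]
  exact_mod_cast Iff.rfl

lemma rescaledValues_eq {k : ℕ} (hk : 1 ≤ k) (ρ : Matrix ι ι ℂ) {σ : Matrix ι ι ℂ}
    (hσ : σ.IsHermitian) :
    rescaledValues k ρ σ = {q | ∃ V, Chain k V ∧ rtr (σ * herm (V (k + 1))) = 1 ∧
      q = rtr (ρ * herm (V 1)) ^ alpha k} := by
  ext q
  constructor
  · rintro ⟨V, Z, h, hZ, rfl⟩
    obtain ⟨W, hW, e1, e2⟩ := exists_chain_of_primalFeasible hk h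
    exact ⟨W, hW, by rw [e2]; exact (trace_mul_eq_one_iff hσ h.1.1).mp hZ, by rw [e1]⟩
  · rintro ⟨V, h, hZ, rfl⟩
    exact ⟨V, _, h.primalFeasible hk, (trace_mul_eq_one_iff hσ (herm_isHermitian _)).mpr hZ, rfl⟩

/-- A link is quadratic in `V i` and linear in `V (i + 1)`, so the exponent of `t` doubles at each
index. -/
lemma Chain.scale {k : ℕ} {V : ℕ → Matrix ι ι ℂ} (h : Chain k V) {t : ℝ} (ht : 0 ≤ t) :
    Chain k (fun i => ((t ^ (2 ^ (i - 1)) : ℝ) : ℂ) • V i) := by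
  refine ⟨?_, fun i h1 h2 => ?_⟩
  · rw [herm_smul]
    exact PosSemidef.smul_real h.1 (by positivity)
  · obtain ⟨j, rfl⟩ : ∃ j, i = j + 1 := ⟨i - 1, by omega⟩
    have := PosSemidef.smul_real (h.2 (j + 1) h1 h2) (show 0 ≤ t ^ (2 ^ (j + 1)) by positivity)
    convert this using 1
    simp only [Nat.add_sub_cancel, herm_smul, conjTranspose_smul, smul_sub, Matrix.smul_mul,
      Matrix.mul_smul, smul_smul, Complex.star_def, Complex.conj_ofReal]
    rw [← Complex.ofReal_mul, ← pow_add, ← two_mul, ← pow_succ']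

lemma rtr_mul_herm_smul (A V : Matrix ι ι ℂ) (c : ℝ) :
    rtr (A * herm ((c : ℂ) • V)) = c * rtr (A * herm V) := by
  rw [herm_smul, Matrix.mul_smul, rtr_smul]

lemma chain_one (k : ℕ) : Chain k (fun _ => (1 : Matrix ι ι ℂ)) := by
  have : herm (1 : Matrix ι ι ℂ) = 1 := herm_eq_self isHermitian_one
  refine ⟨by rw [this]; exact PosSemidef.one, fun i _ _ => ?_⟩
  rw [this]
  simpa using PosSemidef.zero

lemma herm_conj {P : Matrix ι ι ℂ} (hP : P.IsHermitian) (V : Matrix ι ι ℂ) :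
    herm (P * V * P) = P * herm V * P := by
  simp only [herm, conjTranspose_mul, hP.eq, Matrix.mul_smul, Matrix.smul_mul, Matrix.mul_add,
    Matrix.add_mul, Matrix.mul_assoc]

lemma rtr_mul_conj (A P V : Matrix ι ι ℂ) : rtr (A * (P * V * P)) = rtr (P * A * P * V) := by
  rw [← Matrix.mul_assoc, rtr_mul_comm]
  simp only [Matrix.mul_assoc]

/-- Every chain may be replaced by a bounded one supported on the support of `σ`. -/
lemma Chain.exists_bounded (k : ℕ) {ρ σ : Matrix ι ι ℂ} (hρ : ρ.IsHermitian)
    (hσ : σ.PosSemidef) (hd : Dominated ρ σ) :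
    ∃ R : ℝ, ∀ V, Chain k V → rtr (σ * herm (V (k + 1))) ≤ 1 → ∃ W, Chain k W ∧
      rtr (σ * herm (W (k + 1))) ≤ 1 ∧ rtr (ρ * herm (W 1)) = rtr (ρ * herm (V 1)) ∧
      ∀ i a b, ‖W i a b‖ ≤ R := by
  obtain ⟨c, hc0, hc⟩ := exists_smul_sub_suppProj_posSemidef hσ
  set P := suppProj σ with hPdef
  have hP : P.IsHermitian := suppProj_isHermitian σ
  have hPP : P * P = P := suppProj_mul_self σ
  set M : ℝ := max (Fintype.card ι) c with hM
  have hM0 : 0 ≤ M := le_max_of_le_right hc0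
  refine ⟨1 + M, fun V hV hz => ?_⟩
  -- Compression to the support of `σ`. The entries outside `1, …, k + 1` are free and set to zero,
  -- and the last one is made Hermitian, so that one bound covers the whole sequence.
  let W : ℕ → Matrix ι ι ℂ := fun i => if i = 0 then 0 else if i ≤ k then P * V i * P else
    if i = k + 1 then P * herm (V i) * P else 0
  have hherm : ∀ i, 1 ≤ i → i ≤ k + 1 → herm (W i) = P * herm (V i) * P := by
    intro i h1 h2
    by_cases h : i ≤ k
    · simp only [W, if_neg (show i ≠ 0 by omega), if_pos h, herm_conj hP]
    · obtain rfl : i = k + 1 := by omega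
      simp only [W, if_neg (show k + 1 ≠ 0 by omega), if_neg h, if_true, herm_conj hP,
        herm_eq_self (herm_isHermitian _)]
  have hpsd : ∀ X : Matrix ι ι ℂ, X.PosSemidef → (P * X * P).PosSemidef := fun X hX => by
    have := hX.conjTranspose_mul_mul_same P
    rwa [hP.eq] at this
  have hWc : Chain k W := by
    refine ⟨?_, fun i h1 h2 => ?_⟩
    · rw [hherm 1 le_rfl (by omega)]
      exact hpsd _ hV.1
    · rw [hherm (i + 1) (by omega) (by omega)]
      simp only [W, if_neg (show i ≠ 0 by omega), if_pos h2]
      -- Compression inserts `P` between `(V i)ᴴ` and `V i`; the defect involves `1 - P ≥ 0`, so the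
      -- link only gets slacker.
      have e : P * herm (V (i + 1)) * P - (P * V i * P)ᴴ * (P * V i * P) =
          P * (herm (V (i + 1)) - (V i)ᴴ * V i) * P +
            P * ((V i)ᴴ * (1 - P) * V i) * P := by
        rw [← Matrix.add_mul, ← Matrix.mul_add]
        have : (P * V i * P)ᴴ * (P * V i * P) = P * ((V i)ᴴ * P * V i) * P := by
          rw [conjTranspose_mul, conjTranspose_mul, hP.eq]
          calc _ = P * (V i)ᴴ * (P * P) * V i * P := by simp only [Matrix.mul_assoc]
            _ = _ := by rw [hPP]; simp only [Matrix.mul_assoc]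
        rw [this, ← Matrix.sub_mul, ← Matrix.mul_sub]
        congr 2
        simp only [Matrix.mul_sub, Matrix.sub_mul, Matrix.mul_one]
        abel
      rw [e]
      exact (hpsd _ (hV.2 i h1 h2)).add
        (hpsd _ ((one_sub_suppProj_posSemidef σ).conjTranspose_mul_mul_same _))
  have hσP : P * σ * P = σ := by rw [suppProj_mul hσ.1, mul_suppProj hσ.1]
  have hρP : P * ρ * P = ρ := by rw [hd.suppProj_mul hρ hσ.1, hd.mul_suppProj hσ.1]
  have hzW : rtr (σ * herm (W (k + 1))) = rtr (σ * herm (V (k + 1))) := by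
    rw [hherm (k + 1) (by omega) le_rfl, rtr_mul_conj, hσP]
  refine ⟨W, hWc, hzW ▸ hz, by rw [hherm 1 le_rfl (by omega), rtr_mul_conj, hρP], ?_⟩
  -- On the support `P ≤ c σ`, so the cost bound controls the full trace of the last entry.
  have hlast : rtr (W (k + 1)) ≤ c := by
    rw [← rtr_herm, hherm (k + 1) (by omega) le_rfl, ← Matrix.one_mul (P * _ * P), rtr_mul_conj,
      Matrix.mul_one, hPP, rtr_mul_comm]
    refine (rtr_mul_le (hV.herm_posSemidef (by omega) le_rfl) hc).trans ?_
    rw [Matrix.mul_smul, rtr_smul, rtr_mul_comm]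
    nlinarith
  have hN : ∀ i, 1 ≤ i → i ≤ k → rtr ((W i)ᴴ * W i) ≤ rtr (W (i + 1)) := fun i h1 h2 => by
    rw [← rtr_herm (W (i + 1))]
    exact rtr_le (hWc.2 i h1 h2)
  -- Backwards induction: `2 tr W_i ≤ card ι + tr W_iᴴ W_i ≤ card ι + tr W_{i+1} ≤ 2 M`.
  have ht : ∀ j, j ≤ k → rtr (W (k + 1 - j)) ≤ M := by
    intro j
    induction j with
    | zero => exact fun _ => hlast.trans (le_max_right _ _)
    | succ j ih =>
      intro hj
      have h1 := ih (by omega)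
      have h2 := hN (k + 1 - (j + 1)) (by omega) (by omega)
      rw [show k + 1 - (j + 1) + 1 = k + 1 - j by omega] at h2
      have h3 := two_rtr_le (W (k + 1 - (j + 1)))
      have h4 : (Fintype.card ι : ℝ) ≤ M := le_max_left _ _
      linarith
  intro i a b
  by_cases h0 : i = 0
  · simp only [W, if_pos h0]; simpa using by linarith
  by_cases h1 : i ≤ k
  · have h2 := norm_apply_sq_le (W i) a b
    have h3 := hN i (by omega) h1
    have h4 := ht (k - i) (by omega)
    rw [show k + 1 - (k - i) = i + 1 by omega] at h4
    nlinarith [norm_nonneg (W i a b)]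
  by_cases h2 : i = k + 1
  · have hps : (W i).PosSemidef := by
      simp only [W, if_neg h0, if_neg h1, if_pos h2]
      exact hpsd _ (hV.herm_posSemidef (by omega) (by omega))
    have := norm_apply_le_rtr hps a b
    rw [h2] at this ⊢
    linarith [le_max_right (Fintype.card ι : ℝ) c]
  · simp only [W, if_neg h0, if_neg h1, if_neg h2]; simpa using by linarith

lemma isClosed_chain (k : ℕ) : IsClosed {V : ℕ → Matrix ι ι ℂ | Chain k V} := by
  have h : ∀ i : ℕ, Continuous fun V : ℕ → Matrix ι ι ℂ => V i := fun i => continuous_apply i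
  have hh : ∀ i : ℕ, Continuous fun V : ℕ → Matrix ι ι ℂ => herm (V i) :=
    fun i => continuous_herm.comp (h i)
  simp only [Chain, Set.ofPred_and, Set.ofPred_forall]
  refine IsClosed.inter (isClosed_posSemidef.preimage (hh 1)) (isClosed_iInter fun i =>
    isClosed_iInter fun _ => isClosed_iInter fun _ => isClosed_posSemidef.preimage ?_)
  exact (hh (i + 1)).sub ((h i).matrix_conjTranspose.matrix_mul (h i))

/-- Sequences with entries in a fixed disc are compact for the product topology and the constraints
are closed. By `Chain.exists_bounded` the maximum over this compact set is the maximum over all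
chains. -/
lemma Chain.exists_maximizer (k : ℕ) {ρ σ : Matrix ι ι ℂ} (hρ : ρ.IsHermitian)
    (hσ : σ.PosSemidef) (hd : Dominated ρ σ) :
    ∃ V, Chain k V ∧ rtr (σ * herm (V (k + 1))) ≤ 1 ∧ ∀ W, Chain k W →
      rtr (σ * herm (W (k + 1))) ≤ 1 → rtr (ρ * herm (W 1)) ≤ rtr (ρ * herm (V 1)) := by
  obtain ⟨R, hR⟩ := Chain.exists_bounded k hρ hσ hd
  let B : Set (ℕ → Matrix ι ι ℂ) := {V | ∀ i a b, ‖V i a b‖ ≤ R}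
  have hB : IsCompact B := by
    have : IsCompact (Set.univ.pi fun _ : ℕ => Set.univ.pi fun _ : ι => Set.univ.pi fun _ : ι =>
        Metric.closedBall (0 : ℂ) R) :=
      isCompact_univ_pi fun _ => isCompact_univ_pi fun _ => isCompact_univ_pi fun _ =>
        isCompact_closedBall 0 R
    have e : B = Set.univ.pi fun _ : ℕ => Set.univ.pi fun _ : ι => Set.univ.pi fun _ : ι =>
        Metric.closedBall (0 : ℂ) R := by
      ext V
      exact ⟨fun h i _ a _ b _ => mem_closedBall_zero_iff.mpr (h i a b),
        fun h i a b => mem_closedBall_zero_iff.mp (h i trivial a trivial b trivial)⟩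
    rw [e]
    exact this
  have hx : ∀ (A : Matrix ι ι ℂ) (i : ℕ),
      Continuous fun V : ℕ → Matrix ι ι ℂ => rtr (A * herm (V i)) := fun A i =>
    continuous_rtr.comp (continuous_const.matrix_mul (continuous_herm.comp (continuous_apply i)))
  let S : Set (ℕ → Matrix ι ι ℂ) := B ∩ ({V | Chain k V} ∩ {V | rtr (σ * herm (V (k + 1))) ≤ 1})
  have hS : IsCompact S :=
    hB.inter_right ((isClosed_chain k).inter (isClosed_le (hx σ (k + 1)) continuous_const))
  have hz0 : Chain k (fun _ => (0 : Matrix ι ι ℂ)) := by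
    refine ⟨?_, fun i _ _ => ?_⟩ <;> simpa [herm] using PosSemidef.zero
  obtain ⟨W0, hW0, hW1, -, hW2⟩ := hR _ hz0 (by simp [herm, rtr])
  obtain ⟨V, ⟨-, hV1, hV2⟩, hmax⟩ := hS.exists_isMaxOn ⟨W0, hW2, hW0, hW1⟩ (hx ρ 1).continuousOn
  refine ⟨V, hV1, hV2, fun W hW hWz => ?_⟩
  obtain ⟨W', h1, h2, h3, h4⟩ := hR W hW hWz
  rw [← h3]
  exact hmax ⟨h4, h1, h2⟩

/-- The solution of the primal program, in its original and in its rescaled form. -/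
theorem exists_primal_optimum {k : ℕ} (hk : 1 ≤ k) {ρ σ : Matrix ι ι ℂ} (hρ : IsDensity ρ)
    (hσ : σ.PosSemidef) (hd : Dominated ρ σ) :
    ∃ x : ℝ, 0 < x ∧ (∃ V, Chain k V ∧ rtr (σ * herm (V (k + 1))) = 1 ∧
      rtr (ρ * herm (V 1)) = x) ∧
      (∀ V, Chain k V → rtr (σ * herm (V (k + 1))) ≤ 1 → rtr (ρ * herm (V 1)) ≤ x) ∧
      IsGreatest (primalValues k ρ σ) (x ^ alpha k) ∧
      IsGreatest (rescaledValues k ρ σ) (x ^ alpha k) := by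
  obtain ⟨V, hV, hVz, hmax⟩ := Chain.exists_maximizer k hρ.1.1 hσ hd
  set x := rtr (ρ * herm (V 1)) with hx
  set z := rtr (σ * herm (V (k + 1))) with hz
  have hα := alpha_sub_one_pos hk
  have hα1 := one_lt_alpha hk
  have hscale : ∀ (t : ℝ) (W : ℕ → Matrix ι ι ℂ), 0 ≤ t → Chain k W →
      t ^ (2 ^ k) * rtr (σ * herm (W (k + 1))) ≤ 1 → t * rtr (ρ * herm (W 1)) ≤ x := by
    intro t W ht hW h
    have h1 := hmax _ (hW.scale ht)
    simp only [rtr_mul_herm_smul, Nat.add_sub_cancel, Nat.sub_self, pow_zero, pow_one] at h1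
    exact h1 h
  have hznn : ∀ W, Chain k W → 0 ≤ rtr (σ * herm (W (k + 1))) := fun W hW =>
    rtr_mul_nonneg hσ (hW.herm_posSemidef (by omega) le_rfl)
  have hxnn : ∀ W, Chain k W → 0 ≤ rtr (ρ * herm (W 1)) := fun W hW => rtr_mul_nonneg hρ.1 hW.1
  -- The constant chain `1`, scaled by `1 / (tr σ + 1)`, costs at most `1` and has positive value.
  have hxpos : 0 < x := by
    have h1 : (herm (1 : Matrix ι ι ℂ)) = 1 := herm_eq_self isHermitian_one
    have hs : 0 ≤ rtr σ := rtr_nonneg hσ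
    have ht0 : (0 : ℝ) < 1 / (rtr σ + 1) := by positivity
    have ht1 : 1 / (rtr σ + 1) ≤ 1 := by rw [div_le_one (by positivity)]; linarith
    have := hscale (1 / (rtr σ + 1)) _ ht0.le (chain_one k) (by
      rw [h1, Matrix.mul_one]
      calc (1 / (rtr σ + 1)) ^ (2 ^ k) * rtr σ ≤ (1 / (rtr σ + 1)) * rtr σ := by
            refine mul_le_mul_of_nonneg_right ?_ hs
            exact pow_le_of_le_one ht0.le ht1 (by positivity)
        _ ≤ 1 := by rw [div_mul_eq_mul_div, one_mul, div_le_one (by positivity)]; linarith)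
    have hr : rtr ρ = 1 := by simp [rtr, hρ.2]
    rw [h1, Matrix.mul_one, hr, mul_one] at this
    linarith
  -- a chain of cost zero has value zero
  have hzero : ∀ W, Chain k W → rtr (σ * herm (W (k + 1))) = 0 → rtr (ρ * herm (W 1)) = 0 := by
    intro W hW h0
    by_contra hne
    have hpos : 0 < rtr (ρ * herm (W 1)) := lt_of_le_of_ne (hxnn W hW) (Ne.symm hne)
    have := hscale ((x + 1) / rtr (ρ * herm (W 1))) W (by positivity) hW (by rw [h0]; simp)
    rw [div_mul_cancel₀ _ hne] at this
    linarith
  -- Normalize the cost to `1`, dividing by its `2^k`-th root.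
  have hroot : ∀ W, Chain k W → 0 < rtr (σ * herm (W (k + 1))) →
      rtr (ρ * herm (W 1)) ≤ x * rtr (σ * herm (W (k + 1))) ^ (1 / (2 : ℝ) ^ k) := by
    intro W hW hpos
    set y := rtr (σ * herm (W (k + 1))) ^ (1 / (2 : ℝ) ^ k) with hy
    have hy0 : 0 < y := Real.rpow_pos_of_pos hpos _
    have hyk : y ^ (2 ^ k) = rtr (σ * herm (W (k + 1))) := by
      rw [hy, ← Real.rpow_natCast, ← Real.rpow_mul hpos.le]; simp
    have := hscale y⁻¹ W (by positivity) hW (by rw [inv_pow, hyk, inv_mul_cancel₀ hpos.ne'])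
    rwa [inv_mul_le_iff₀ hy0, mul_comm] at this
  have hzpos : 0 < z := by
    refine lt_of_le_of_ne (hznn V hV) fun h => ?_
    exact hxpos.ne' (hzero V hV h.symm)
  -- A maximizer of smaller cost could be scaled up and improved.
  have hz1 : z = 1 := by
    refine le_antisymm hVz ?_
    have h1 := hroot V hV hzpos
    rw [← hx, ← hz] at h1
    have h2 : 1 ≤ z ^ (1 / (2 : ℝ) ^ k) := by
      by_contra h
      push Not at h
      nlinarith
    by_contra h
    push Not at h
    exact absurd (Real.rpow_lt_one hzpos.le h (by positivity)) (not_lt.mpr h2)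
  have hbound : ∀ W, Chain k W → alpha k * rtr (ρ * herm (W 1)) -
      (alpha k - 1) * rtr (σ * herm (W (k + 1))) ≤ x ^ alpha k := by
    intro W hW
    rcases (hznn W hW).eq_or_lt with h0 | hpos
    · rw [hzero W hW h0.symm, ← h0]
      have : 0 ≤ x ^ alpha k := by positivity
      linarith
    · have h1 := hroot W hW hpos
      set y := rtr (σ * herm (W (k + 1))) ^ (1 / (2 : ℝ) ^ k) with hy
      have hyk : y ^ (2 ^ k) = rtr (σ * herm (W (k + 1))) := by
        rw [hy, ← Real.rpow_natCast, ← Real.rpow_mul hpos.le]; simp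
      have h2 := young_rpow_pow hk hxpos.le (show 0 ≤ y by positivity)
      rw [hyk] at h2
      have h3 : alpha k * rtr (ρ * herm (W 1)) ≤ alpha k * (x * y) :=
        mul_le_mul_of_nonneg_left h1 (by linarith)
      linarith
  refine ⟨x, hxpos, ⟨V, hV, hz1, rfl⟩, hmax, ⟨?_, ?_⟩, ⟨?_, ?_⟩⟩
  · rw [primalValues_eq hk]
    -- The equality case of Young's inequality: since `(alpha k - 1) * 2^k = alpha k`, both the gain
    -- and the cost become `x ^ alpha k`.
    refine ⟨_, hV.scale (t := x ^ (alpha k - 1)) (by positivity), ?_⟩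
    simp only [rtr_mul_herm_smul, Nat.add_sub_cancel, Nat.sub_self, pow_zero, pow_one]
    rw [← hx, ← hz, hz1, ← Real.rpow_natCast, ← Real.rpow_mul hxpos.le, Nat.cast_pow,
      Nat.cast_ofNat, alpha_sub_one_mul hk]
    have : x ^ (alpha k - 1) * x = x ^ alpha k := by
      conv_lhs => rw [← Real.rpow_one x, ← Real.rpow_mul hxpos.le, ← Real.rpow_add hxpos]
      congr 1; ring
    rw [this]; ring
  · rintro q hq
    rw [primalValues_eq hk] at hq
    obtain ⟨W, hW, rfl⟩ := hq
    exact hbound W hW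
  · rw [rescaledValues_eq hk ρ hσ.1]
    exact ⟨V, hV, hz1, rfl⟩
  · rintro q hq
    rw [rescaledValues_eq hk ρ hσ.1] at hq
    obtain ⟨W, hW, hWz, rfl⟩ := hq
    exact Real.rpow_le_rpow (hxnn W hW) (hmax W hW hWz.le) (by linarith)

end Chains

/-! ### Lagrange duality -/

section Lagrange

/-- Lagrange duality for an affine program with a cone constraint satisfying Slater's condition. -/
lemma exists_multiplier {X Y : Type*} [AddCommGroup Y] [Module ℝ Y] [TopologicalSpace Y]
    [IsTopologicalAddGroup Y] [ContinuousSMul ℝ Y] {U : Set Y} (hUo : IsOpen U)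
    (hUc : Convex ℝ U) (hUs : ∀ u ∈ U, ∀ t : ℝ, 0 < t → t • u ∈ U) (f : X → ℝ) (G : X → Y)
    (hfG : Convex ℝ (Set.range fun x => (G x, f x))) {p : ℝ} (hp : ∀ x, G x ∈ U → f x ≤ p)
    {x₀ : X} (hx₀ : G x₀ ∈ U) :
    ∃ φ : Y →L[ℝ] ℝ, (∀ u ∈ U, 0 ≤ φ u) ∧ ∀ x, f x + φ (G x) ≤ p := by
  -- No point satisfies the strict constraints with a value above `p`; separate these two convex
  -- sets and read the multiplier off the separating functional.
  have hdisj : Disjoint (U ×ˢ Set.Ioi p) (Set.range fun x => (G x, f x)) := by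
    rw [Set.disjoint_left]
    rintro _ ⟨h1, h2⟩ ⟨x, rfl⟩
    exact absurd (hp x h1) (not_le.mpr h2)
  obtain ⟨F, c, hF1, hF2⟩ := geometric_hahn_banach_open (hUc.prod (convex_Ioi p))
    (hUo.prod isOpen_Ioi) hfG hdisj
  set ψ : Y →L[ℝ] ℝ := F.comp (ContinuousLinearMap.inl ℝ Y ℝ) with hψ
  set τ : ℝ := F (0, 1) with hτ
  have hF : ∀ y s, F (y, s) = ψ y + τ * s := by
    intro y s
    have : ((y, s) : Y × ℝ) = (y, 0) + s • (0, 1) := by simp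
    rw [this, map_add, map_smul, hτ, smul_eq_mul, mul_comm s]
    rfl
  have h1 : ∀ u ∈ U, ∀ s, p < s → ψ u + τ * s < c := fun u hu s hs => by
    rw [← hF]; exact hF1 _ ⟨hu, hs⟩
  have h2 : ∀ x, c ≤ ψ (G x) + τ * f x := fun x => by
    rw [← hF]; exact hF2 _ ⟨x, rfl⟩
  -- At the Slater point both separation bounds contain the same `ψ (G x₀)`, which cancels and fixes
  -- the sign of `τ`.
  have hτ0 : τ < 0 := by
    have ha := h1 _ hx₀ (max p (f x₀) + 1) (by linarith [le_max_left p (f x₀)])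
    have hb := h2 x₀
    have hc : 0 < max p (f x₀) + 1 - f x₀ := by linarith [le_max_right p (f x₀)]
    by_contra h
    push Not at h
    nlinarith [mul_nonneg h hc.le]
  refine ⟨τ⁻¹ • ψ, fun u hu => ?_, fun x => ?_⟩
  · rw [_root_.smul_apply, smul_eq_mul]
    -- Since `U` is a cone, a positive value could be scaled past the bound `c`.
    have : ψ u ≤ 0 := by
      by_contra h
      push Not at h
      have ht : 0 < (|c - τ * (p + 1)| + 1) / ψ u := by positivity
      have := h1 _ (hUs u hu _ ht) (p + 1) (by linarith)
      rw [map_smul, smul_eq_mul, div_mul_cancel₀ _ h.ne'] at this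
      linarith [le_abs_self (c - τ * (p + 1))]
    exact mul_nonneg_of_nonpos_of_nonpos (inv_nonpos.mpr hτ0.le) this
  -- Approach the apex along the ray through `G x₀` while the value decreases to `p`.
  · have hc : τ * p ≤ c := by
      have ht : Filter.Tendsto (fun t : ℝ => ψ (t • G x₀) + τ * (p + t)) (𝓝[>] 0)
          (𝓝 (ψ ((0 : ℝ) • G x₀) + τ * (p + 0))) := by
        refine Filter.Tendsto.mono_left ?_ nhdsWithin_le_nhds
        exact Continuous.tendsto (by fun_prop) 0
      simp only [zero_smul, map_zero, zero_add, add_zero] at ht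
      refine le_of_tendsto ht ?_
      filter_upwards [self_mem_nhdsWithin] with t ht
      exact (h1 _ (hUs _ hx₀ t ht) _ (by linarith [Set.mem_Ioi.mp ht])).le
    have h3 := (hc.trans (h2 x))
    rw [_root_.smul_apply, smul_eq_mul]
    have h4 := mul_le_mul_of_nonpos_left h3 (inv_nonpos.mpr hτ0.le)
    rw [mul_add, inv_mul_cancel_left₀ hτ0.ne, inv_mul_cancel_left₀ hτ0.ne] at h4
    linarith

end Lagrange

/-! ### Matrices with positive Hermitian part and the functionals nonnegative on them -/

section Cone

variable {n : Type*} [Fintype n] [DecidableEq n]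

/-- The complement is the projection of a closed set along the compact unit sphere. Using `M + Mᴴ`
makes the cone open among all matrices, not only the Hermitian ones. -/
lemma isOpen_add_conjTranspose_posDef :
    IsOpen {M : Matrix n n ℂ | (M + Mᴴ).PosDef} := by
  have hc : IsClosed {q : Metric.sphere (0 : n → ℂ) 1 × Matrix n n ℂ |
      (star q.1.1 ⬝ᵥ ((q.2 + q.2ᴴ) *ᵥ q.1.1)).re ≤ 0} := by
    refine isClosed_le ?_ continuous_const
    have h1 : Continuous fun q : Metric.sphere (0 : n → ℂ) 1 × Matrix n n ℂ => q.1.1 := by fun_prop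
    have h2 : Continuous fun q : Metric.sphere (0 : n → ℂ) 1 × Matrix n n ℂ => q.2 := by fun_prop
    exact Complex.continuous_re.comp
      (h1.star.dotProduct ((h2.add h2.matrix_conjTranspose).matrix_mulVec h1))
  have hs : CompactSpace (Metric.sphere (0 : n → ℂ) 1) :=
    isCompact_iff_compactSpace.mp (isCompact_sphere _ _)
  have hcl := isClosedMap_snd_of_compactSpace _ hc
  convert hcl.isOpen_compl using 1
  ext M
  have hH : (M + Mᴴ).IsHermitian := by simp [IsHermitian, add_comm]
  constructor
  · rintro h ⟨⟨⟨x, hx⟩, N⟩, h1, rfl⟩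
    have hx0 : x ≠ 0 := by
      rintro rfl
      simp at hx
    exact absurd (h.re_dotProduct_pos hx0) (not_lt.mpr h1)
  · intro h
    refine PosDef.of_dotProduct_mulVec_pos hH fun {x} hx => ?_
    rw [Complex.pos_iff]
    refine ⟨?_, (hH.im_star_dotProduct_mulVec_self x).symm⟩
    by_contra hneg
    push Not at hneg
    have hxn : ‖x‖ ≠ 0 := norm_ne_zero_iff.mpr hx
    refine h ⟨(⟨((‖x‖⁻¹ : ℝ) : ℂ) • x, ?_⟩, M), ?_, rfl⟩
    · simp [norm_smul, hxn]
    · have : (star (((‖x‖⁻¹ : ℝ) : ℂ) • x) ⬝ᵥ ((M + Mᴴ) *ᵥ (((‖x‖⁻¹ : ℝ) : ℂ) • x))) =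
          ((‖x‖⁻¹ * ‖x‖⁻¹ : ℝ) : ℂ) * (star x ⬝ᵥ ((M + Mᴴ) *ᵥ x)) := by
        rw [Matrix.mulVec_smul, star_smul, smul_dotProduct, dotProduct_smul]
        simp [mul_assoc]
      show (star (((‖x‖⁻¹ : ℝ) : ℂ) • x) ⬝ᵥ ((M + Mᴴ) *ᵥ (((‖x‖⁻¹ : ℝ) : ℂ) • x))).re ≤ 0
      rw [this, Complex.re_ofReal_mul]
      exact mul_nonpos_of_nonneg_of_nonpos (by positivity) hneg

lemma convex_add_conjTranspose_posDef :
    Convex ℝ {M : Matrix n n ℂ | (M + Mᴴ).PosDef} := by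
  refine convex_iff_forall_pos.mpr fun M hM N hN a b ha hb _ => ?_
  have h1 := (hM.smul (a := (a : ℂ)) (by exact_mod_cast ha)).add
    (hN.smul (a := (b : ℂ)) (by exact_mod_cast hb))
  show ((a • M + b • N) + (a • M + b • N)ᴴ).PosDef
  convert h1 using 1
  simp only [conjTranspose_add, conjTranspose_smul, star_trivial, smul_add, Complex.coe_smul]
  abel

lemma smul_add_conjTranspose_posDef {M : Matrix n n ℂ} (hM : (M + Mᴴ).PosDef) {t : ℝ}
    (ht : 0 < t) : (t • M + (t • M)ᴴ).PosDef := by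
  have h1 := (hM.smul (a := (t : ℂ)) (by exact_mod_cast ht))
  convert h1 using 1
  simp [conjTranspose_smul, smul_add]

lemma rtr_mul_conjTranspose_eq_zero {X : Matrix n n ℂ} (h : rtr (X * Xᴴ) = 0) : X = 0 := by
  have h1 := trace_eq_rtr (posSemidef_self_mul_conjTranspose X).1
  rw [h, Complex.ofReal_zero] at h1
  exact trace_mul_conjTranspose_self_eq_zero_iff.mp h1

lemma eq_zero_of_rtr_mul {X : Matrix n n ℂ} (h : ∀ M, rtr (X * M) = 0) : X = 0 :=
  rtr_mul_conjTranspose_eq_zero (h Xᴴ)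

/-- A functional that is nonnegative on the matrices with positive semidefinite Hermitian part is
given by a positive semidefinite matrix. -/
lemma exists_posSemidef_rtr (φ : Matrix n n ℂ →ₗ[ℝ] ℝ)
    (h : ∀ M : Matrix n n ℂ, (M + Mᴴ).PosSemidef → 0 ≤ φ M) :
    ∃ W : Matrix n n ℂ, W.PosSemidef ∧ ∀ M, φ M = rtr (W * M) := by
  -- Values on the real basis `E_ab`, `i E_ab`; the minus sign comes from `Re (i w) = -Im w`.
  let W : Matrix n n ℂ := Matrix.of fun b a =>
    (φ (Matrix.single a b 1) : ℂ) - Complex.I * φ (Matrix.single a b Complex.I)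
  have hW : ∀ M, φ M = rtr (W * M) := by
    intro M
    have h1 : M = ∑ a, ∑ b, ((M a b).re • Matrix.single a b (1 : ℂ) +
        (M a b).im • Matrix.single a b Complex.I) := by
      conv_lhs => rw [Matrix.matrix_eq_sum_single M]
      refine Finset.sum_congr rfl fun a _ => Finset.sum_congr rfl fun b _ => ?_
      rw [Matrix.smul_single, Matrix.smul_single, ← Matrix.single_add]
      congr 1
      simp
    conv_lhs => rw [h1]
    simp only [map_sum, map_add, map_smul, smul_eq_mul]
    simp only [rtr, Matrix.trace, Matrix.diag, Matrix.mul_apply, Complex.re_sum]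
    rw [Finset.sum_comm]
    refine Finset.sum_congr rfl fun b _ => Finset.sum_congr rfl fun a _ => ?_
    simp [W]
    ring
  refine ⟨W, ?_, hW⟩
  -- Both signs of the anti-Hermitian matrix `M - Mᴴ` lie in the cone, so `φ` vanishes on it.
  have hstar : ∀ M : Matrix n n ℂ, φ Mᴴ = φ M := by
    intro M
    have h1 := h (M - Mᴴ) (by simpa using PosSemidef.zero)
    have h2 := h (Mᴴ - M) (by simpa using PosSemidef.zero)
    rw [map_sub] at h1 h2
    linarith
  have hWH : W.IsHermitian := by
    have : Wᴴ - W = 0 := eq_zero_of_rtr_mul fun M => by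
      rw [Matrix.sub_mul, rtr_sub, ← hW, ← hstar, hW, ← rtr_conjTranspose, conjTranspose_mul,
        conjTranspose_conjTranspose, rtr_mul_comm, sub_self]
    exact sub_eq_zero.mp this
  refine posSemidef_iff_re.mpr ⟨hWH, fun x => ?_⟩
  have h1 := h (vecMulVec x (star x)) (by
    have := posSemidef_vecMulVec_self_star x
    rw [this.1.eq]
    exact this.add this)
  rw [hW, rtr, Matrix.mul_vecMulVec, Matrix.trace_vecMulVec, dotProduct_comm] at h1
  exact h1

end Cone

/-! ### The dual programs -/

section Dual

variable {ι : Type*} [Fintype ι] [DecidableEq ι]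

/-- The dual constraints, with `C (k + 1) = σ`. -/
def DualChain (k : ℕ) (ρ σ : Matrix ι ι ℂ) (A C : ℕ → Matrix ι ι ℂ) : Prop :=
  (C 1 - ρ).PosSemidef ∧ C (k + 1) = σ ∧
    ∀ i, 1 ≤ i → i ≤ k → (fromBlocks (A i) (C i) (C i) (C (i + 1))).PosSemidef

/-- The objective function of the dual program. -/
noncomputable def dualValue (k : ℕ) (A : ℕ → Matrix ι ι ℂ) : ℝ :=
  1 / ((2 : ℝ) ^ k - 1) * ∑ i ∈ Finset.Icc 1 k, (2 : ℝ) ^ (k - i) * rtr (A i)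

lemma DualChain.dualFeasible {k : ℕ} (hk : 1 ≤ k) {ρ σ : Matrix ι ι ℂ} {A C : ℕ → Matrix ι ι ℂ}
    (h : DualChain k ρ σ A C) : DualFeasible k ρ σ A C := by
  refine ⟨h.1, fun i h1 h2 => h.2.2 i h1 h2.le, ?_⟩
  have := h.2.2 k hk le_rfl
  rwa [h.2.1] at this

lemma exists_dualChain {k : ℕ} (hk : 1 ≤ k) {ρ σ : Matrix ι ι ℂ} {A C : ℕ → Matrix ι ι ℂ}
    (h : DualFeasible k ρ σ A C) : ∃ C', DualChain k ρ σ A C' := by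
  refine ⟨fun i => if i ≤ k then C i else σ, by simpa [hk] using h.1, by simp, fun i h1 h2 => ?_⟩
  rcases h2.lt_or_eq with hlt | rfl
  · simpa [h2, Nat.succ_le_of_lt hlt] using h.2.1 i h1 hlt
  · simpa using h.2.2

lemma dualSumValues_eq {k : ℕ} (hk : 1 ≤ k) (ρ σ : Matrix ι ι ℂ) :
    dualSumValues k ρ σ = {q | ∃ A C, DualChain k ρ σ A C ∧ q = dualValue k A} := by
  ext q
  constructor
  · rintro ⟨A, C, h, rfl⟩
    obtain ⟨C', h'⟩ := exists_dualChain hk h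
    exact ⟨A, C', h', rfl⟩
  · rintro ⟨A, C, h, rfl⟩
    exact ⟨A, C, h.dualFeasible hk, rfl⟩

lemma dualEqualValues_eq {k : ℕ} (hk : 1 ≤ k) (ρ σ : Matrix ι ι ℂ) :
    dualEqualValues k ρ σ =
      {q | ∃ A C, EqualTraces k A ∧ DualChain k ρ σ A C ∧ q = rtr (A 1)} := by
  ext q
  constructor
  · rintro ⟨A, C, he, h, rfl⟩
    obtain ⟨C', h'⟩ := exists_dualChain hk h
    exact ⟨A, C', he, h', rfl⟩
  · rintro ⟨A, C, he, h, rfl⟩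
    exact ⟨A, C, he, h.dualFeasible hk, rfl⟩

lemma dualValue_of_equal {k : ℕ} (hk : 1 ≤ k) {A : ℕ → Matrix ι ι ℂ}
    (h : ∀ i, 1 ≤ i → i ≤ k → rtr (A i) = rtr (A 1)) : dualValue k A = rtr (A 1) := by
  have h1 := one_lt_two_pow_real hk
  rw [dualValue, Finset.sum_congr rfl fun i hi => by
    rw [h i (Finset.mem_Icc.mp hi).1 (Finset.mem_Icc.mp hi).2], ← Finset.sum_mul, sum_two_pow]
  have : (2 : ℝ) ^ k - 1 ≠ 0 := by linarith
  field_simp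

lemma EqualTraces.rtr_eq {k : ℕ} {A : ℕ → Matrix ι ι ℂ} (h : EqualTraces k A) (i : ℕ)
    (h1 : 1 ≤ i) (h2 : i ≤ k) : rtr (A i) = rtr (A 1) := by
  rw [rtr, h i h1 h2, rtr]

/-- Weak duality. -/
lemma Chain.value_le_dualValue {k : ℕ} (hk : 1 ≤ k) {ρ σ : Matrix ι ι ℂ}
    {V A C : ℕ → Matrix ι ι ℂ} (hV : Chain k V) (h : DualChain k ρ σ A C) :
    alpha k * rtr (ρ * herm (V 1)) - (alpha k - 1) * rtr (σ * herm (V (k + 1))) ≤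
      dualValue k A := by
  obtain ⟨h1, h2, h3⟩ := h
  set y : ℕ → ℝ := fun i => rtr (C i * herm (V i)) with hy
  have hstep : ∀ i, 1 ≤ i → i ≤ k → 2 * y i - y (i + 1) ≤ rtr (A i) := fun i hi1 hi2 => by
    have h4 := two_rtr_mul_le (h3 i hi1 hi2) (block_one_posSemidef_iff.mpr (hV.2 i hi1 hi2))
    rw [← rtr_mul_herm (block_symm (h3 i hi1 hi2))] at h4
    simp only [hy]
    linarith
  have hsum : ∑ i ∈ Finset.Icc 1 k, (2 : ℝ) ^ (k - i) * (2 * y i - y (i + 1)) ≤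
      ∑ i ∈ Finset.Icc 1 k, (2 : ℝ) ^ (k - i) * rtr (A i) :=
    Finset.sum_le_sum fun i hi => mul_le_mul_of_nonneg_left
      (hstep i (Finset.mem_Icc.mp hi).1 (Finset.mem_Icc.mp hi).2) (by positivity)
  rw [sum_two_pow_telescope] at hsum
  have h5 : rtr (ρ * herm (V 1)) ≤ y 1 := by
    simp only [hy]
    rw [rtr_mul_comm ρ, rtr_mul_comm (C 1)]
    exact rtr_mul_le hV.1 h1
  have h6 := one_lt_two_pow_real hk
  have h7 : 0 < 1 / ((2 : ℝ) ^ k - 1) := one_div_pos.mpr (by linarith)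
  have h8 := mul_le_mul_of_nonneg_left hsum h7.le
  have h9 : y (k + 1) = rtr (σ * herm (V (k + 1))) := by simp only [hy, h2]
  rw [← h9]
  calc _ ≤ alpha k * y 1 - (alpha k - 1) * y (k + 1) := by
        have := mul_le_mul_of_nonneg_left h5 (by linarith [one_lt_alpha hk] : 0 ≤ alpha k)
        linarith
    _ = 1 / ((2 : ℝ) ^ k - 1) * (2 ^ k * y 1 - y (k + 1)) := by
        rw [alpha_sub_one, alpha_eq hk]; ring
    _ ≤ _ := h8

lemma primalValues_le_dualValue {k : ℕ} (hk : 1 ≤ k) {ρ σ : Matrix ι ι ℂ}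
    {A C : ℕ → Matrix ι ι ℂ} (h : DualChain k ρ σ A C) :
    dualValue k A ∈ upperBounds (primalValues k ρ σ) := by
  rw [primalValues_eq hk]
  rintro _ ⟨V, hV, rfl⟩
  exact hV.value_le_dualValue hk h

lemma imQ_le_dualValue {k : ℕ} (hk : 1 ≤ k) {ρ σ : Matrix ι ι ℂ}
    {A C : ℕ → Matrix ι ι ℂ} (h : DualChain k ρ σ A C) : imQ k ρ σ ≤ dualValue k A := by
  refine csSup_le ?_ (primalValues_le_dualValue hk h)
  rw [primalValues_eq hk]
  exact ⟨_, _, chain_one k, rfl⟩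

lemma herm_add (V W : Matrix ι ι ℂ) : herm (V + W) = herm V + herm W := by
  simp only [herm, conjTranspose_add, ← smul_add]
  congr 1; abel

lemma herm_real_smul (c : ℝ) (V : Matrix ι ι ℂ) : herm (c • V) = c • herm V := by
  rw [← Complex.coe_smul, herm_smul, Complex.coe_smul]

lemma rtr_real_smul (c : ℝ) (V : Matrix ι ι ℂ) : rtr (c • V) = c * rtr V := by
  rw [← Complex.coe_smul, rtr_smul]

/-- The sum of the block and its adjoint is `(1/4) I`, plus the rank-type block `[1, 2c; 2c, 4c²]`,
plus `diag(3/4, 1/4 - 4c²)`. The cases `c = 1/4` and `c = 0` give the Slater point `V_i = 1/4`. -/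
lemma slater_block_posDef {c : ℝ} (hc : 4 * c ^ 2 ≤ 1 / 4) :
    ((fromBlocks 1 ((c : ℂ) • 1) ((c : ℂ) • 1)ᴴ (((1 / 4 : ℝ) : ℂ) • 1) :
      Matrix (ι ⊕ ι) (ι ⊕ ι) ℂ) + (fromBlocks 1 ((c : ℂ) • 1) ((c : ℂ) • 1)ᴴ
        (((1 / 4 : ℝ) : ℂ) • 1))ᴴ).PosDef := by
  have h1 := block_posSemidef_of_factor (1 : Matrix ι ι ℂ) (((2 * c : ℝ) : ℂ) • 1)
  have h2 : (fromBlocks (((3 / 4 : ℝ) : ℂ) • 1) 0 0 (((1 / 4 - 4 * c ^ 2 : ℝ) : ℂ) • 1) :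
      Matrix (ι ⊕ ι) (ι ⊕ ι) ℂ).PosSemidef :=
    block_diag_posSemidef (PosSemidef.smul_real PosSemidef.one (by norm_num))
      (PosSemidef.smul_real PosSemidef.one (by linarith))
  have h3 : (((1 / 4 : ℝ) : ℂ) • (1 : Matrix (ι ⊕ ι) (ι ⊕ ι) ℂ)).PosDef :=
    PosDef.one.smul (by exact_mod_cast (by norm_num : (0 : ℝ) < 1 / 4))
  have h4 := h3.add_posSemidef (h1.add h2)
  convert h4 using 1
  rw [← fromBlocks_one]
  simp only [fromBlocks_conjTranspose, fromBlocks_add, fromBlocks_smul, conjTranspose_smul,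
    conjTranspose_one, Matrix.mul_smul, Matrix.mul_one, smul_smul,
    smul_zero, Complex.star_def, Complex.conj_ofReal]
  congr 1
  all_goals
    ext i j
    simp only [Matrix.add_apply, Matrix.smul_apply, Matrix.zero_apply, smul_eq_mul]
    push_cast
    ring

/-- Positive semidefinite multipliers for an affine program with finitely many semidefinite
constraints. -/
lemma exists_posSemidef_multipliers {X S m : Type*} [Fintype S] [DecidableEq S] [Fintype m]
    [DecidableEq m] (f : X → ℝ) (G : X → S → Matrix m m ℂ) (hG : ∀ x i, (G x i).IsHermitian)
    (hfG : Convex ℝ (Set.range fun x => (G x, f x))) {p : ℝ}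
    (hp : ∀ x, (∀ i, (G x i).PosSemidef) → f x ≤ p) {x₀ : X}
    (hx₀ : ∀ i, (G x₀ i + (G x₀ i)ᴴ).PosDef) :
    ∃ W : S → Matrix m m ℂ, (∀ i, (W i).PosSemidef) ∧
      ∀ x, f x + ∑ i, rtr (W i * G x i) ≤ p := by
  let U : Set (S → Matrix m m ℂ) := Set.univ.pi fun _ => {M | (M + Mᴴ).PosDef}
  have hUs : ∀ u ∈ U, ∀ t : ℝ, 0 < t → t • u ∈ U := fun u hu t ht i hi =>
    smul_add_conjTranspose_posDef (hu i hi) ht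
  have hp' : ∀ x, G x ∈ U → f x ≤ p := fun x hx => hp x fun i => by
    have := herm_posSemidef_iff.mp (hx i trivial).posSemidef
    rwa [herm_eq_self (hG x i)] at this
  obtain ⟨φ, hφ1, hφ2⟩ := exists_multiplier
    (isOpen_set_pi Set.finite_univ fun _ _ => isOpen_add_conjTranspose_posDef)
    (convex_pi fun _ _ => convex_add_conjTranspose_posDef) hUs f G hfG hp' (x₀ := x₀)
    fun i _ => hx₀ i
  -- Nonnegativity extends from the open cone to its closure by adding a vanishing multiple of the
  -- Slater value.
  have hφK : ∀ y : S → Matrix m m ℂ, (∀ i, (y i + (y i)ᴴ).PosSemidef) → 0 ≤ φ y := by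
    intro y h2
    have h3 : ∀ t : ℝ, 0 < t → 0 ≤ φ y + t * φ (G x₀) := by
      intro t ht
      rw [← smul_eq_mul, ← map_smul, ← map_add]
      refine hφ1 _ fun i _ => ?_
      show ((y i + t • G x₀ i) + (y i + t • G x₀ i)ᴴ).PosDef
      rw [conjTranspose_add, add_add_add_comm]
      exact PosDef.posSemidef_add (h2 i) (smul_add_conjTranspose_posDef (hx₀ i) ht)
    have ht : Filter.Tendsto (fun t : ℝ => φ y + t * φ (G x₀)) (𝓝[>] 0)
        (𝓝 (φ y + 0 * φ (G x₀))) :=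
      Filter.Tendsto.mono_left (Continuous.tendsto (by fun_prop) 0) nhdsWithin_le_nhds
    rw [zero_mul, add_zero] at ht
    refine ge_of_tendsto ht ?_
    filter_upwards [self_mem_nhdsWithin] with t ht using h3 t ht
  have hW := fun i : S => exists_posSemidef_rtr
    ((φ : (S → Matrix m m ℂ) →ₗ[ℝ] ℝ).comp (LinearMap.single ℝ (fun _ : S => Matrix m m ℂ) i))
    fun M hM => hφK (Pi.single i M) fun j => by
      by_cases hj : j = i
      · subst hj; simpa using hM
      · simpa [Pi.single_eq_of_ne hj] using PosSemidef.zero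
  choose W hW1 hW2 using hW
  refine ⟨W, hW1, fun x => ?_⟩
  have h1 : φ (G x) = ∑ i, rtr (W i * G x i) := by
    conv_lhs => rw [← Finset.univ_sum_single (G x)]
    rw [map_sum]
    exact Finset.sum_congr rfl fun i _ => hW2 i _
  rw [← h1]
  exact hφ2 x

/-- The block matrices of the primal program; the one with index `0` encodes that the Hermitian
part of `V 1` is positive semidefinite. -/
noncomputable def chainBlock (V : ℕ → Matrix ι ι ℂ) (i : ℕ) : Matrix (ι ⊕ ι) (ι ⊕ ι) ℂ :=
  fromBlocks 1 (if i = 0 then 0 else V i) (if i = 0 then 0 else V i)ᴴ (herm (V (i + 1)))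

/-- The constant identity corner makes the block affine, not linear, in `V`; hence the need for `a +
b = 1`. -/
lemma chainBlock_convex {a b : ℝ} (hab : a + b = 1) (V W : ℕ → Matrix ι ι ℂ) (i : ℕ) :
    chainBlock (a • V + b • W) i = a • chainBlock V i + b • chainBlock W i := by
  simp only [chainBlock, fromBlocks_smul, fromBlocks_add, Pi.add_apply, Pi.smul_apply, herm_add,
    herm_real_smul]
  rw [← add_smul, hab, one_smul]
  split_ifs
  · simp
  · simp only [conjTranspose_add, conjTranspose_smul, star_trivial]

/-- Multipliers for the primal program. -/
lemma exists_primal_multipliers {k : ℕ} (hk : 1 ≤ k) {ρ σ : Matrix ι ι ℂ} {p : ℝ}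
    (hp : p ∈ upperBounds (primalValues k ρ σ)) :
    ∃ W : ℕ → Matrix (ι ⊕ ι) (ι ⊕ ι) ℂ,
      (∀ i, (W i).PosSemidef) ∧ ∀ V : ℕ → Matrix ι ι ℂ,
        alpha k * rtr (ρ * herm (V 1)) - (alpha k - 1) * rtr (σ * herm (V (k + 1))) +
          ∑ i ∈ Finset.range (k + 1), rtr (W i * chainBlock V i) ≤ p := by
  obtain ⟨W, hW1, hW2⟩ := exists_posSemidef_multipliers (S := Fin (k + 1))
    (fun V : ℕ → Matrix ι ι ℂ =>
      alpha k * rtr (ρ * herm (V 1)) - (alpha k - 1) * rtr (σ * herm (V (k + 1))))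
    (fun V i => chainBlock V i) (fun V i => by
      simp [chainBlock, IsHermitian, fromBlocks_conjTranspose, (herm_isHermitian _).eq]) (by
      rintro _ ⟨V, rfl⟩ _ ⟨W, rfl⟩ a b ha hb hab
      refine ⟨a • V + b • W, Prod.ext (funext fun i => chainBlock_convex hab V W i) ?_⟩
      simp only [Pi.add_apply, Pi.smul_apply, herm_add, herm_real_smul, Matrix.mul_add,
        Matrix.mul_smul, rtr_add, rtr_real_smul, Prod.smul_mk, Prod.mk_add_mk, smul_eq_mul]
      ring) (p := p) (by
      intro V hV
      refine hp ?_
      rw [primalValues_eq hk]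
      refine ⟨V, ⟨block_right (hV 0), fun i h1 h2 => ?_⟩, rfl⟩
      have h3 := hV ⟨i, by omega⟩
      simp only [chainBlock, if_neg (show i ≠ 0 by omega)] at h3
      exact block_one_posSemidef_iff.mp h3) (x₀ := fun i => ((1 / 4 : ℝ) : ℂ) • 1) (by
      intro i
      have hH : (((1 / 4 : ℝ) : ℂ) • (1 : Matrix ι ι ℂ)).IsHermitian := by
        simp [IsHermitian, conjTranspose_smul]
      simp only [chainBlock, herm_eq_self hH]
      split_ifs
      · have := slater_block_posDef (ι := ι) (c := 0) (by norm_num)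
        simpa only [Complex.ofReal_zero, zero_smul] using this
      · exact slater_block_posDef (by norm_num))
  refine ⟨fun i => if h : i < k + 1 then W ⟨i, h⟩ else 0, fun i => ?_, fun V => ?_⟩
  · dsimp only
    split_ifs with h
    · exact hW1 _
    · exact PosSemidef.zero
  · have h := hW2 V
    rw [Finset.sum_range]
    refine le_of_eq_of_le ?_ h
    congr 1
    exact Finset.sum_congr rfl fun i _ => by simp only [dif_pos i.2]

/-- Strong duality, with a dual optimum. -/
theorem exists_dualChain_le {k : ℕ} (hk : 1 ≤ k) {ρ σ : Matrix ι ι ℂ} (hρ : ρ.IsHermitian)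
    (hσ : σ.IsHermitian) {p : ℝ} (hp : p ∈ upperBounds (primalValues k ρ σ)) :
    ∃ A C, DualChain k ρ σ A C ∧ dualValue k A ≤ p := by
  obtain ⟨W, hW, hWp⟩ := exists_primal_multipliers hk hp
  set a : ℕ → Matrix ι ι ℂ := fun i => (W i).toBlocks₁₁ with ha
  set c : ℕ → Matrix ι ι ℂ := fun i => (W i).toBlocks₂₁ with hc
  set e : ℕ → Matrix ι ι ℂ := fun i => (W i).toBlocks₂₂ with he
  have hWb : ∀ i, W i = fromBlocks (a i) (c i)ᴴ (c i) (e i) := fun i => by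
    have h1 : W i = fromBlocks (a i) (W i).toBlocks₁₂ (c i) (e i) := (fromBlocks_toBlocks _).symm
    have h2 := hW i
    rw [h1] at h2
    have h3 : (c i)ᴴ = (W i).toBlocks₁₂ := by
      rw [← block_symm h2, conjTranspose_conjTranspose]
    rw [h3]
    exact h1
  have hpsd : ∀ i, (fromBlocks (a i) (c i)ᴴ (c i) (e i)).PosSemidef := fun i => hWb i ▸ hW i
  have hea : ∀ i, (e i).PosSemidef := fun i => block_right (hpsd i)
  have haa : ∀ i, (a i).PosSemidef := fun i => block_left (hpsd i)
  -- the Lagrangian is affine in `V`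
  set L : (ℕ → Matrix ι ι ℂ) → ℝ := fun V =>
    rtr (((alpha k : ℝ) : ℂ) • ρ * V 1) - rtr (((alpha k - 1 : ℝ) : ℂ) • σ * V (k + 1)) +
      (rtr (e 0 * V 1) + ∑ i ∈ Finset.Icc 1 k, (2 * rtr (c i * V i) + rtr (e i * V (i + 1))))
    with hL
  have hval : ∀ (V : ℕ → Matrix ι ι ℂ) (i : ℕ), i ≠ 0 →
      rtr (W i * chainBlock V i) = rtr (a i) + (2 * rtr (c i * V i) + rtr (e i * V (i + 1))) := by
    intro V i hi
    rw [hWb, chainBlock, if_neg hi, fromBlocks_multiply, rtr_fromBlocks, rtr_add, rtr_add,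
      Matrix.mul_one, rtr_mul_herm (hea i).1]
    have : rtr ((c i)ᴴ * (V i)ᴴ) = rtr (c i * V i) := by
      rw [← conjTranspose_mul, rtr_conjTranspose, rtr_mul_comm]
    rw [this]; ring
  have hval0 : ∀ V : ℕ → Matrix ι ι ℂ,
      rtr (W 0 * chainBlock V 0) = rtr (a 0) + rtr (e 0 * V 1) := by
    intro V
    rw [hWb, chainBlock, if_pos rfl, fromBlocks_multiply, rtr_fromBlocks, rtr_add, rtr_add,
      Matrix.mul_one, rtr_mul_herm (hea 0).1]
    simp [rtr_zero]
  have hLp : ∀ V, L V + (rtr (a 0) + ∑ i ∈ Finset.Icc 1 k, rtr (a i)) ≤ p := by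
    intro V
    refine le_of_eq_of_le ?_ (hWp V)
    rw [Finset.range_eq_Ico, Finset.sum_eq_sum_Ico_succ_bot (by omega), hval0, zero_add,
      show Finset.Ico 1 (k + 1) = Finset.Icc 1 k by ext; simp,
      Finset.sum_congr rfl fun i hi => hval V i (by rw [Finset.mem_Icc] at hi; omega),
      Finset.sum_add_distrib, rtr_mul_herm hρ, rtr_mul_herm hσ]
    simp only [hL, Matrix.smul_mul, rtr_smul]
    ring
  have hLs : ∀ (t : ℝ) V, L (t • V) = t * L V := by
    intro t V
    simp only [hL, Pi.smul_apply, Matrix.mul_smul, rtr_real_smul, mul_add, mul_sub, Finset.mul_sum]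
    congr 2
    exact Finset.sum_congr rfl fun i _ => by ring
  -- A real-homogeneous function of degree one that is bounded above vanishes.
  have hL0 : ∀ V, L V = 0 := by
    intro V
    by_contra hne
    have := hLp (((|p| + |rtr (a 0) + ∑ i ∈ Finset.Icc 1 k, rtr (a i)| + 1) / L V) • V)
    rw [hLs, div_mul_cancel₀ _ hne] at this
    have h1 := le_abs_self p
    have h2 := neg_abs_le (rtr (a 0) + ∑ i ∈ Finset.Icc 1 k, rtr (a i))
    linarith
  have hsum : ∑ i ∈ Finset.Icc 1 k, rtr (a i) ≤ p := by
    have := hLp 0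
    rw [hL0] at this
    linarith [rtr_nonneg (haa 0)]
  -- Stationarity: testing on sequences supported at one index isolates the coefficient of each `V
  -- j`.
  have hsplit : ∀ (j : ℕ) (M : Matrix ι ι ℂ), 1 ≤ j → j ≤ k + 1 →
      (if j = 1 then rtr (((alpha k : ℝ) : ℂ) • ρ * M) + rtr (e 0 * M) else 0) -
        (if j = k + 1 then rtr (((alpha k - 1 : ℝ) : ℂ) • σ * M) else 0) +
        ((if j ≤ k then 2 * rtr (c j * M) else 0) + (if 2 ≤ j then rtr (e (j - 1) * M) else 0)) =
      0 := by
    intro j M h1 h2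
    refine Eq.trans ?_ (hL0 (Pi.single j M))
    simp only [hL, Finset.sum_add_distrib]
    have hz : ∀ (X : Matrix ι ι ℂ) (i : ℕ), rtr (X * (Pi.single j M : ℕ → Matrix ι ι ℂ) i) =
        if j = i then rtr (X * M) else 0 := by
      intro X i
      by_cases h : i = j
      · subst h; simp
      · rw [Pi.single_eq_of_ne h, if_neg (Ne.symm h), Matrix.mul_zero, rtr_zero]
    simp only [hz, mul_ite, mul_zero]
    have s1 : ∑ i ∈ Finset.Icc 1 k, (if j = i then 2 * rtr (c i * M) else 0) =
        if j ≤ k then 2 * rtr (c j * M) else 0 := by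
      rw [Finset.sum_ite_eq]
      simp [h1]
    have s2 : ∑ i ∈ Finset.Icc 1 k, (if j = i + 1 then rtr (e i * M) else 0) =
        if 2 ≤ j then rtr (e (j - 1) * M) else 0 := by
      obtain ⟨l, rfl⟩ : ∃ l, j = l + 1 := ⟨j - 1, by omega⟩
      simp only [Nat.add_right_cancel_iff, Nat.add_sub_cancel]
      rw [Finset.sum_ite_eq]
      by_cases hl : 1 ≤ l
      · rw [if_pos (Finset.mem_Icc.mpr ⟨hl, by omega⟩), if_pos (by omega)]
      · rw [if_neg (by rw [Finset.mem_Icc]; omega), if_neg (by omega)]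
    rw [s1, s2]
    split_ifs <;> ring
  have e1 : ((alpha k : ℝ) : ℂ) • ρ + e 0 + (2 : ℂ) • c 1 = 0 := eq_zero_of_rtr_mul fun M => by
    have := hsplit 1 M le_rfl (by omega)
    rw [if_pos rfl, if_neg (by omega), if_pos hk, if_neg (by omega)] at this
    have h2 := rtr_smul 2 (c 1 * M)
    rw [Matrix.add_mul, Matrix.add_mul, rtr_add, rtr_add, Matrix.smul_mul (2 : ℂ)]
    push_cast at h2
    rw [h2]
    linarith
  have e2 : ∀ j, 1 ≤ j → j < k → (2 : ℂ) • c (j + 1) + e j = 0 := fun j h1 h2 =>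
    eq_zero_of_rtr_mul fun M => by
      have := hsplit (j + 1) M (by omega) (by omega)
      rw [if_neg (by omega), if_neg (by omega), if_pos (by omega), if_pos (by omega),
        Nat.add_sub_cancel] at this
      have h3 := rtr_smul 2 (c (j + 1) * M)
      rw [Matrix.add_mul, rtr_add, Matrix.smul_mul]
      push_cast at h3
      rw [h3]
      linarith
  have e3 : e k = ((alpha k - 1 : ℝ) : ℂ) • σ := by
    refine sub_eq_zero.mp (eq_zero_of_rtr_mul fun M => ?_)
    have := hsplit (k + 1) M (by omega) le_rfl
    rw [if_neg (by omega), if_pos rfl, if_neg (by omega), if_pos (by omega),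
      Nat.add_sub_cancel] at this
    rw [Matrix.sub_mul, rtr_sub]
    linarith
  have hk2 := one_lt_two_pow_real hk
  have hk0 : (2 : ℝ) ^ k - 1 ≠ 0 := by linarith
  have hα := one_lt_alpha hk
  -- The weights of the dual objective. Dividing the multipliers by them gives `A` and, up to sign,
  -- `C`; as `2 * l (i + 1) = l i`, stationarity becomes `e i = l i • C (i + 1)`.
  set l : ℕ → ℝ := fun i => 2 ^ (k - i) / (2 ^ k - 1) with hl
  have hlpos : ∀ i, 0 < l i := fun i => div_pos (by positivity) (by linarith)
  have hlne : ∀ i, ((l i : ℝ) : ℂ) ≠ 0 := fun i => by exact_mod_cast (hlpos i).ne'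
  have hlk : l k = alpha k - 1 := by simp [hl, alpha_sub_one]
  have hl1 : 2 * l 1 = alpha k := by
    simp only [hl]
    rw [alpha_eq hk, ← mul_div_assoc, ← pow_succ', show k - 1 + 1 = k by omega]
  have hls : ∀ i, i < k → 2 * l (i + 1) = l i := fun i hi => by
    simp only [hl]
    rw [← mul_div_assoc, ← pow_succ', show k - (i + 1) + 1 = k - i by omega]
  set C : ℕ → Matrix ι ι ℂ := fun i => if i ≤ k then ((-(l i)⁻¹ : ℝ) : ℂ) • c i else σ with hC
  have hCi : ∀ i, i ≤ k → c i = ((-l i : ℝ) : ℂ) • C i := fun i hi => by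
    simp only [hC, if_pos hi]
    rw [smul_smul, ← Complex.ofReal_mul, neg_mul_neg, mul_inv_cancel₀ (hlpos i).ne',
      Complex.ofReal_one, one_smul]
  have hE : ∀ i, 1 ≤ i → i ≤ k → e i = ((l i : ℝ) : ℂ) • C (i + 1) := by
    intro i h1 h2
    rcases h2.lt_or_eq with hlt | rfl
    · have h3 := e2 i h1 hlt
      rw [hCi (i + 1) (by omega), smul_smul, add_comm, ← eq_neg_iff_add_eq_zero, ← neg_smul] at h3
      rw [h3, ← hls i hlt]
      push_cast
      congr 1; ring
    · rw [e3, hlk]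
      simp [hC]
  have hC1 : C 1 = ρ + (((alpha k)⁻¹ : ℝ) : ℂ) • e 0 := by
    rw [hCi 1 hk, smul_smul, ← eq_neg_iff_add_eq_zero, ← neg_smul] at e1
    have : -((2 : ℂ) * ((-l 1 : ℝ) : ℂ)) = (alpha k : ℝ) := by
      rw [← hl1]; push_cast; ring
    rw [this] at e1
    have hα0 : ((alpha k : ℝ) : ℂ) ≠ 0 := by exact_mod_cast (by linarith : alpha k ≠ 0)
    have h3 := congrArg (fun X => ((alpha k : ℝ) : ℂ)⁻¹ • X) e1
    simp only [smul_add, smul_smul, inv_mul_cancel₀ hα0, one_smul] at h3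
    rw [← h3, Complex.ofReal_inv]
  -- A multiplier need not have Hermitian off-diagonal blocks; stationarity forces it by expressing
  -- `C i` through the positive corner `e (i - 1)`.
  have hCH : ∀ i, 1 ≤ i → i ≤ k → (C i).IsHermitian := by
    intro i h1 h2
    rcases i with _ | _ | i
    · omega
    · rw [zero_add, hC1]
      exact hρ.add (PosSemidef.smul_real (hea 0) (by positivity)).1
    · have h3 := hE (i + 1) (by omega) (by omega)
      have h4 : C (i + 1 + 1) = (((l (i + 1))⁻¹ : ℝ) : ℂ) • e (i + 1) := by
        rw [h3, smul_smul, ← Complex.ofReal_mul, inv_mul_cancel₀ (hlpos _).ne',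
          Complex.ofReal_one, one_smul]
      rw [h4]
      exact (PosSemidef.smul_real (hea _) (inv_nonneg.mpr (hlpos _).le)).1
  refine ⟨fun i => (((l i)⁻¹ : ℝ) : ℂ) • a i, C, ⟨?_, by simp [hC], fun i h1 h2 => ?_⟩, ?_⟩
  · rw [hC1, add_sub_cancel_left]
    exact PosSemidef.smul_real (hea 0) (by positivity)
  · have h3 := PosSemidef.smul_real (hpsd i) (inv_nonneg.mpr (hlpos i).le)
    -- Conjugation by `diag(1, -1)` absorbs the sign in `C`.
    have h4 := block_conj_posSemidef (by rwa [fromBlocks_smul] at h3) 1 (-1)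
    rw [hCi i h2, hE i h1 h2] at h4
    simp only [conjTranspose_one, conjTranspose_neg, conjTranspose_smul, (hCH i h1 h2).eq,
      Matrix.one_mul, Matrix.mul_one, Matrix.neg_mul, neg_neg, smul_neg, smul_smul,
      Complex.star_def, Complex.conj_ofReal, ← Complex.ofReal_mul, mul_neg,
      inv_mul_cancel₀ (hlpos i).ne', Complex.ofReal_neg, neg_smul, Complex.ofReal_one,
      one_smul] at h4
    exact h4
  · refine le_trans (le_of_eq ?_) hsum
    rw [dualValue, Finset.mul_sum]
    refine Finset.sum_congr rfl fun i _ => ?_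
    rw [rtr_smul]
    simp only [hl]
    have : (2 : ℝ) ^ (k - i) ≠ 0 := by positivity
    field_simp

end Dual

/-! ### Equalizing the dual traces, positivity, and monotonicity in `k` -/

section EqualTraces

variable {ι : Type*} [Fintype ι] [DecidableEq ι]

/-- Pair the block with the test data `V = t C`, `H = t² C²`. -/
lemma block_two_mul_le {A B C : Matrix ι ι ℂ} (h : (fromBlocks A C C B).PosSemidef) (t : ℝ) :
    2 * (t * rtr (C * C)) ≤ rtr A + t ^ 2 * rtr (B * (C * C)) := by
  have hC : C.IsHermitian := block_symm h
  have h1 := two_rtr_mul_le h (V := (t : ℂ) • C) (H := ((t : ℂ) • C)ᴴ * ((t : ℂ) • C))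
    (block_one_posSemidef_iff.mpr (by simpa using PosSemidef.zero))
  simp only [conjTranspose_smul, hC.eq, Complex.star_def, Complex.conj_ofReal, Matrix.smul_mul,
    Matrix.mul_smul, smul_smul, ← Complex.ofReal_mul, rtr_smul] at h1
  rwa [sq]

lemma block_eq_zero_of_left {B C : Matrix ι ι ℂ} (h : (fromBlocks 0 C C B).PosSemidef) :
    C = 0 := by
  have hC : C.IsHermitian := block_symm h
  have hs : 0 ≤ rtr (C * C) := by
    have := rtr_nonneg (posSemidef_conjTranspose_mul_self C)
    rwa [hC.eq] at this
  have hb : 0 ≤ rtr (B * (C * C)) := by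
    refine rtr_mul_nonneg (block_right h) ?_
    have := posSemidef_conjTranspose_mul_self C
    rwa [hC.eq] at this
  have h0 : rtr (C * C) = 0 := by
    by_contra hne
    have hpos : 0 < rtr (C * C) := lt_of_le_of_ne hs (Ne.symm hne)
    -- For this `t` the quadratic term is at most half of the linear one, which is impossible when
    -- the latter is positive.
    have h1 := block_two_mul_le h (rtr (C * C) / (rtr (B * (C * C)) + 1))
    rw [rtr_zero, zero_add] at h1
    set s := rtr (C * C)
    set b := rtr (B * (C * C))
    have e1 : (s / (b + 1)) ^ 2 * b = s / (b + 1) * s * (b / (b + 1)) := by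
      have : b + 1 ≠ 0 := by positivity
      field_simp
    have e2 : b / (b + 1) ≤ 1 := by rw [div_le_one (by positivity)]; linarith
    have e3 : 0 < s / (b + 1) * s := by positivity
    rw [e1] at h1
    nlinarith
  refine rtr_mul_conjTranspose_eq_zero ?_
  rwa [hC.eq]

lemma block_eq_zero_of_right {A C : Matrix ι ι ℂ} (h : (fromBlocks A C C 0).PosSemidef) :
    C = 0 := by
  have h1 := h.submatrix (Sum.swap : ι ⊕ ι → ι ⊕ ι)
  rw [fromBlocks_submatrix_sum_swap_sum_swap] at h1
  exact block_eq_zero_of_left h1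

/-- If `C (j + 1)` vanished, so would `C j`; hence `C 1 ≠ 0`, which holds as `C 1 ≥ ρ`, propagates
upwards. A zero `A i` would in turn force `C i = 0`. -/
lemma DualChain.rtr_pos {k : ℕ} {ρ σ : Matrix ι ι ℂ} (hρ : 0 < rtr ρ)
    {A C : ℕ → Matrix ι ι ℂ} (h : DualChain k ρ σ A C) {i : ℕ} (h1 : 1 ≤ i) (h2 : i ≤ k) :
    0 < rtr (A i) := by
  have hC : ∀ j, 1 ≤ j → j ≤ k → C j ≠ 0 := by
    intro j hj1
    induction j, hj1 using Nat.le_induction with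
    | base =>
      intro _ h0
      have := rtr_le h.1
      rw [h0, rtr_zero] at this
      linarith
    | succ j hj ih =>
      intro hjk h0
      refine ih (by omega) ?_
      have := h.2.2 j hj (by omega)
      rw [h0] at this
      exact block_eq_zero_of_right this
  refine lt_of_le_of_ne (rtr_nonneg (block_left (h.2.2 i h1 h2))) fun h0 => hC i h1 h2 ?_
  have hA := block_left (h.2.2 i h1 h2)
  have : A i = 0 := hA.trace_eq_zero_iff.mp (by rw [trace_eq_rtr hA.1, ← h0, Complex.ofReal_zero])
  have h3 := h.2.2 i h1 h2
  rw [this] at h3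
  exact block_eq_zero_of_left h3

/-- The scaling that makes all traces equal to their weighted geometric mean. -/
noncomputable def equalizer (T : ℝ) (τ : ℕ → ℝ) : ℕ → ℝ
  | 0 => 1
  | j + 1 => equalizer T τ j ^ 2 * τ (j + 1) / T

lemma equalizer_pos {T : ℝ} {τ : ℕ → ℝ} {k : ℕ} (hT : 0 < T)
    (hτ : ∀ i, 1 ≤ i → i ≤ k → 0 < τ i) (j : ℕ) (hj : j ≤ k) : 0 < equalizer T τ j := by
  induction j with
  | zero => exact one_pos
  | succ j ih =>
    have h1 := ih (by omega)
    have h2 := hτ (j + 1) (by omega) hj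
    exact div_pos (by positivity) hT

/-- The logarithm of the recursion telescopes with weights `2^(k-i)`. The hypothesis makes `T` the
weighted geometric mean, the one value for which the recursion returns to `1`. -/
lemma equalizer_eq_one {T : ℝ} {τ : ℕ → ℝ} {k : ℕ} (hT : 0 < T)
    (hτ : ∀ i, 1 ≤ i → i ≤ k → 0 < τ i)
    (h : ((2 : ℝ) ^ k - 1) * Real.log T = ∑ i ∈ Finset.Icc 1 k, 2 ^ (k - i) * Real.log (τ i)) :
    equalizer T τ k = 1 := by
  have h1 := sum_two_pow_telescope k (fun i => Real.log (equalizer T τ (i - 1)))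
  have h2 : ∀ i ∈ Finset.Icc 1 k, (2 : ℝ) ^ (k - i) *
      (2 * Real.log (equalizer T τ (i - 1)) - Real.log (equalizer T τ (i + 1 - 1))) =
      2 ^ (k - i) * Real.log T - 2 ^ (k - i) * Real.log (τ i) := by
    intro i hi
    rw [Finset.mem_Icc] at hi
    obtain ⟨j, rfl⟩ : ∃ j, i = j + 1 := ⟨i - 1, by omega⟩
    have hp := equalizer_pos hT hτ j (by omega)
    have hq := hτ (j + 1) hi.1 hi.2
    simp only [Nat.add_sub_cancel]
    rw [equalizer, Real.log_div (by positivity) hT.ne', Real.log_mul (by positivity) hq.ne',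
      Real.log_pow]
    push_cast; ring
  rw [Finset.sum_congr rfl h2, Finset.sum_sub_distrib, ← Finset.sum_mul, sum_two_pow, h,
    sub_self] at h1
  simp only [Nat.sub_self, equalizer, Real.log_one, Nat.add_sub_cancel] at h1
  exact Real.eq_one_of_pos_of_log_eq_zero (equalizer_pos hT hτ k le_rfl) (by linarith)

/-- Replacing `C i` by `c_{i-1} C i` and `A i` by `(c_{i-1}² / c_i) A i` is a congruence of each
block. The factors `c_0 = c_k = 1` leave the constraints at `ρ` and `σ` unchanged, and AM-GM
compares the common trace with the objective. -/
lemma DualChain.exists_equalTraces {k : ℕ} (hk : 1 ≤ k) {ρ σ : Matrix ι ι ℂ} (hρ : 0 < rtr ρ)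
    {A C : ℕ → Matrix ι ι ℂ} (h : DualChain k ρ σ A C) :
    ∃ A' C', DualChain k ρ σ A' C' ∧ EqualTraces k A' ∧ rtr (A' 1) ≤ dualValue k A := by
  have hτ : ∀ i, 1 ≤ i → i ≤ k → 0 < rtr (A i) := fun i h1 h2 => h.rtr_pos hρ h1 h2
  have hk2 := one_lt_two_pow_real hk
  have hk0 : (2 : ℝ) ^ k - 1 ≠ 0 := by linarith
  set wt : ℕ → ℝ := fun i => 2 ^ (k - i) / (2 ^ k - 1) with hwt
  have hwt0 : ∀ i, 0 ≤ wt i := fun i => div_nonneg (by positivity) (by linarith)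
  set T : ℝ := ∏ i ∈ Finset.Icc 1 k, rtr (A i) ^ wt i with hTdef
  have hT : 0 < T := Finset.prod_pos fun i hi => Real.rpow_pos_of_pos
    (hτ i (Finset.mem_Icc.mp hi).1 (Finset.mem_Icc.mp hi).2) _
  have hlog : ((2 : ℝ) ^ k - 1) * Real.log T =
      ∑ i ∈ Finset.Icc 1 k, 2 ^ (k - i) * Real.log (rtr (A i)) := by
    rw [hTdef, Real.log_prod (fun i hi => (Real.rpow_pos_of_pos
      (hτ i (Finset.mem_Icc.mp hi).1 (Finset.mem_Icc.mp hi).2) _).ne'), Finset.mul_sum]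
    refine Finset.sum_congr rfl fun i hi => ?_
    rw [Real.log_rpow (hτ i (Finset.mem_Icc.mp hi).1 (Finset.mem_Icc.mp hi).2)]
    simp only [hwt]
    field_simp
  have hTle : T ≤ dualValue k A := by
    refine (Real.geom_mean_le_arith_mean_weighted (Finset.Icc 1 k) wt (fun i => rtr (A i))
      (fun i _ => hwt0 i) ?_ fun i hi =>
        (hτ i (Finset.mem_Icc.mp hi).1 (Finset.mem_Icc.mp hi).2).le).trans_eq ?_
    · simp only [hwt]
      rw [← Finset.sum_div, sum_two_pow, div_self hk0]
    · rw [dualValue, Finset.mul_sum]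
      refine Finset.sum_congr rfl fun i _ => ?_
      simp only [hwt]; ring
  set c : ℕ → ℝ := equalizer T (fun i => rtr (A i)) with hc
  have hcpos : ∀ j, j ≤ k → 0 < c j := fun j hj => equalizer_pos hT hτ j hj
  have hck : c k = 1 := equalizer_eq_one hT hτ hlog
  have htr : ∀ i, 1 ≤ i → i ≤ k →
      rtr (((c (i - 1) ^ 2 / c i : ℝ) : ℂ) • A i) = T := by
    intro i h1 h2
    obtain ⟨j, rfl⟩ : ∃ j, i = j + 1 := ⟨i - 1, by omega⟩
    have hp := hcpos j (by omega)
    have hq := hτ (j + 1) h1 h2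
    rw [rtr_smul, Nat.add_sub_cancel]
    rw [show c (j + 1) = c j ^ 2 * rtr (A (j + 1)) / T from rfl]
    field_simp
  have hpsd : ∀ i, 1 ≤ i → i ≤ k → (((c (i - 1) ^ 2 / c i : ℝ) : ℂ) • A i).PosSemidef :=
    fun i h1 h2 => PosSemidef.smul_real (block_left (h.2.2 i h1 h2))
      (div_nonneg (by positivity) (hcpos i h2).le)
  refine ⟨fun i => ((c (i - 1) ^ 2 / c i : ℝ) : ℂ) • A i, fun i => ((c (i - 1) : ℝ) : ℂ) • C i,
    ⟨?_, ?_, fun i h1 h2 => ?_⟩, fun i h1 h2 => ?_, (htr 1 le_rfl hk).trans_le hTle⟩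
  · simpa [hc, equalizer] using h.1
  · simp [hck, h.2.1]
  · have h3 := hcpos i h2
    have h4 := block_conj_posSemidef (h.2.2 i h1 h2)
      (((c (i - 1) / Real.sqrt (c i) : ℝ) : ℂ) • 1) (((Real.sqrt (c i) : ℝ) : ℂ) • 1)
    simp only [conjTranspose_smul, conjTranspose_one, Complex.star_def, Complex.conj_ofReal,
      Matrix.smul_mul, Matrix.mul_smul, Matrix.one_mul, Matrix.mul_one, smul_smul,
      ← Complex.ofReal_mul] at h4
    have hs : Real.sqrt (c i) ≠ 0 := (Real.sqrt_pos.mpr h3).ne'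
    rw [div_mul_div_comm, Real.mul_self_sqrt h3.le, div_mul_cancel₀ _ hs, mul_div_cancel₀ _ hs,
      ← sq] at h4
    exact h4
  · dsimp only
    rw [trace_eq_rtr (hpsd i h1 h2).1, trace_eq_rtr (hpsd 1 le_rfl hk).1, htr i h1 h2,
      htr 1 le_rfl hk]

lemma IsDensity.rtr_eq_one {ρ : Matrix ι ι ℂ} (h : IsDensity ρ) : rtr ρ = 1 := by
  rw [rtr, h.2, Complex.one_re]

/-- The dual optimum with equal traces. -/
theorem exists_dual_optimum {k : ℕ} (hk : 1 ≤ k) {ρ σ : Matrix ι ι ℂ} (hρ : IsDensity ρ)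
    (hσ : σ.PosSemidef) (hd : Dominated ρ σ) :
    ∃ A C, DualChain k ρ σ A C ∧ EqualTraces k A ∧ rtr (A 1) = imQ k ρ σ ∧
      dualValue k A = imQ k ρ σ := by
  obtain ⟨x, -, -, -, hx, -⟩ := exists_primal_optimum hk hρ hσ hd
  have hQ : imQ k ρ σ = x ^ alpha k := hx.csSup_eq
  obtain ⟨A, C, h, hle⟩ := exists_dualChain_le hk hρ.1.1 hσ.1 hx.2
  obtain ⟨A', C', h', he, hle'⟩ := h.exists_equalTraces hk (by rw [hρ.rtr_eq_one]; exact one_pos)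
  have h1 := imQ_le_dualValue hk h'
  rw [dualValue_of_equal hk he.rtr_eq] at h1
  have h2 : rtr (A' 1) = imQ k ρ σ := le_antisymm (hQ ▸ hle'.trans hle) h1
  exact ⟨A', C', h', he, h2, by rw [dualValue_of_equal hk he.rtr_eq, h2]⟩

theorem isLeast_dualSumValues {k : ℕ} (hk : 1 ≤ k) {ρ σ : Matrix ι ι ℂ} (hρ : IsDensity ρ)
    (hσ : σ.PosSemidef) (hd : Dominated ρ σ) : IsLeast (dualSumValues k ρ σ) (imQ k ρ σ) := by
  obtain ⟨A, C, h, -, -, hv⟩ := exists_dual_optimum hk hρ hσ hd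
  rw [dualSumValues_eq hk]
  refine ⟨⟨A, C, h, hv.symm⟩, ?_⟩
  rintro _ ⟨A', C', h', rfl⟩
  exact imQ_le_dualValue hk h'

theorem isLeast_dualEqualValues {k : ℕ} (hk : 1 ≤ k) {ρ σ : Matrix ι ι ℂ} (hρ : IsDensity ρ)
    (hσ : σ.PosSemidef) (hd : Dominated ρ σ) : IsLeast (dualEqualValues k ρ σ) (imQ k ρ σ) := by
  obtain ⟨A, C, h, he, hv, -⟩ := exists_dual_optimum hk hρ hσ hd
  rw [dualEqualValues_eq hk]
  refine ⟨⟨A, C, he, h, hv.symm⟩, ?_⟩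
  rintro _ ⟨A', C', he', h', rfl⟩
  have := imQ_le_dualValue hk h'
  rwa [dualValue_of_equal hk he'.rtr_eq] at this

/-- The chain `t^(2^(i-1)) • 1` with `t = 1 / (tr σ + 1)` has value at least `t`. Only boundedness
is required, so a dual point suffices for images under channels and tensor products, with no check
of supports. -/
lemma imQ_pos {k : ℕ} (hk : 1 ≤ k) {ρ σ : Matrix ι ι ℂ} (hρ : IsDensity ρ) (hσ : σ.PosSemidef)
    (hb : BddAbove (primalValues k ρ σ)) : 0 < imQ k ρ σ := by
  have h1 : herm (1 : Matrix ι ι ℂ) = 1 := herm_eq_self isHermitian_one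
  have hs : 0 ≤ rtr σ := rtr_nonneg hσ
  set t : ℝ := 1 / (rtr σ + 1) with ht
  have ht0 : 0 < t := by positivity
  have ht1 : t ≤ 1 := by rw [ht, div_le_one (by positivity)]; linarith
  have hts : t * rtr σ ≤ 1 := by
    rw [ht, div_mul_eq_mul_div, one_mul, div_le_one (by positivity)]; linarith
  have hα := alpha_sub_one_pos hk
  have hmem : alpha k * t - (alpha k - 1) * (t ^ (2 ^ k) * rtr σ) ∈ primalValues k ρ σ := by
    rw [primalValues_eq hk]
    refine ⟨_, (chain_one k).scale ht0.le, ?_⟩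
    simp only [rtr_mul_herm_smul, Nat.add_sub_cancel, Nat.sub_self, pow_zero, pow_one, h1,
      hρ.rtr_eq_one, mul_one]
  refine lt_of_lt_of_le ?_ (le_csSup hb hmem)
  have h2 : t ^ (2 ^ k) ≤ t ^ 2 :=
    pow_le_pow_of_le_one ht0.le ht1 (by calc 2 = 2 ^ 1 := rfl
      _ ≤ 2 ^ k := Nat.pow_le_pow_right (by norm_num) hk)
  have h3 : t ^ (2 ^ k) * rtr σ ≤ t := by
    calc t ^ (2 ^ k) * rtr σ ≤ t ^ 2 * rtr σ := mul_le_mul_of_nonneg_right h2 hs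
      _ = t * (t * rtr σ) := by ring
      _ ≤ t * 1 := mul_le_mul_of_nonneg_left hts ht0.le
      _ = t := mul_one t
  have h4 := mul_le_mul_of_nonneg_left h3 hα.le
  linarith

lemma imQ_pos_of_dominated {k : ℕ} (hk : 1 ≤ k) {ρ σ : Matrix ι ι ℂ} (hρ : IsDensity ρ)
    (hσ : σ.PosSemidef) (hd : Dominated ρ σ) : 0 < imQ k ρ σ := by
  obtain ⟨x, -, -, -, hx, -⟩ := exists_primal_optimum hk hρ hσ hd
  exact imQ_pos hk hρ hσ ⟨_, hx.2⟩

/-- The iterated mean divergence decreases along the orders. -/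
theorem imD_le_imD_pred {k : ℕ} (hk : 2 ≤ k) {ρ σ : Matrix ι ι ℂ} (hρ : IsDensity ρ)
    (hσ : σ.PosSemidef) (hd : Dominated ρ σ) : imD k ρ σ ≤ imD (k - 1) ρ σ := by
  obtain ⟨l, rfl⟩ : ∃ l, k = l + 1 := ⟨k - 1, by omega⟩
  rw [Nat.add_sub_cancel]
  have hl : 1 ≤ l := by omega
  obtain ⟨x, hx0, ⟨V, hV, hVz, hVx⟩, -, hx, -⟩ := exists_primal_optimum (k := l + 1) (by omega)
    hρ hσ hd
  obtain ⟨y, hy0, -, hymax, hy, -⟩ := exists_primal_optimum hl hρ hσ hd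
  have e : ∀ (m : ℕ) (z : ℝ), 1 ≤ m → 0 < z →
      1 / (alpha m - 1) * Real.log (z ^ alpha m) = 2 ^ m * Real.log z := by
    intro m z hm hz
    have h0 := (alpha_sub_one_pos hm).ne'
    rw [Real.log_rpow hz, div_mul_eq_mul_div, one_mul, div_eq_iff h0]
    conv_lhs => rw [← alpha_sub_one_mul hm]
    ring
  rw [imD, imD, show imQ (l + 1) ρ σ = _ from hx.csSup_eq, show imQ l ρ σ = _ from hy.csSup_eq,
    e _ _ (by omega) hx0, e _ _ hl hy0]
  -- Without its first link, the optimal chain of length `l + 1` is a chain of length `l`.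
  have h1 : rtr (ρ * herm (V 2)) ≤ y := by
    refine hymax (fun i => V (i + 1)) ⟨?_, fun i h1 h2 => hV.2 (i + 1) (by omega) (by omega)⟩
      hVz.le
    exact hV.herm_posSemidef (by omega) (by omega)
  -- The variance of `V 1` in the state `ρ` is nonnegative.
  have h2 : x ^ 2 ≤ rtr (ρ * herm (V 2)) := by
    have h3 := rtr_mul_le hρ.1 (hV.2 1 le_rfl (by omega))
    have h4 := rtr_mul_nonneg hρ.1
      (posSemidef_conjTranspose_mul_self (V 1 - ((x : ℝ) : ℂ) • 1))
    rw [rtr_mul_herm hρ.1.1] at hVx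
    have h5 : rtr (ρ * (V 1)ᴴ) = x := by
      rw [← hVx, ← rtr_conjTranspose, conjTranspose_mul, conjTranspose_conjTranspose, hρ.1.1.eq,
        rtr_mul_comm]
    simp only [conjTranspose_sub, conjTranspose_smul, conjTranspose_one, Complex.star_def,
      Complex.conj_ofReal, Matrix.mul_sub, Matrix.sub_mul, Matrix.smul_mul, Matrix.mul_smul,
      Matrix.mul_one, Matrix.one_mul, rtr_sub, rtr_smul, hVx, h5,
      hρ.rtr_eq_one] at h4
    nlinarith
  have h3 : 2 * Real.log x ≤ Real.log y := by
    have := Real.log_le_log (by positivity) (h2.trans h1)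
    rwa [Real.log_pow, Nat.cast_ofNat] at this
  rw [pow_succ, mul_assoc]
  exact mul_le_mul_of_nonneg_left h3 (by positivity)

end EqualTraces

/-! ### Data processing -/

section Channels

variable {ι : Type*} [Fintype ι] [DecidableEq ι] {κ : Type*} [Fintype κ] [DecidableEq κ]

/-- Two-positivity: a two-by-two block matrix is an element of the ampliation with `n = 2`. -/
lemma IsCPTP.block_posSemidef {E : Matrix ι ι ℂ →ₗ[ℂ] Matrix κ κ ℂ} (hE : IsCPTP E)
    {A B C D : Matrix ι ι ℂ} (h : (fromBlocks A B C D).PosSemidef) :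
    (fromBlocks (E A) (E B) (E C) (E D)).PosSemidef := by
  have h1 := hE.1 2 _ (h.submatrix fun p : Fin 2 × ι => if p.1 = 0 then Sum.inl p.2 else Sum.inr p.2)
  have h2 := h1.submatrix (Sum.elim (fun a => (0, a)) (fun a => (1, a)) : κ ⊕ κ → Fin 2 × κ)
  convert h2 using 1
  ext (i | i) (j | j) <;> rfl

lemma IsCPTP.map_posSemidef {E : Matrix ι ι ℂ →ₗ[ℂ] Matrix κ κ ℂ} (hE : IsCPTP E)
    {A : Matrix ι ι ℂ} (h : A.PosSemidef) : (E A).PosSemidef :=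
  block_left (hE.block_posSemidef (block_diag_posSemidef h PosSemidef.zero))

/-- Data processing. -/
theorem imD_map_le {k : ℕ} (hk : 1 ≤ k) {ρ σ : Matrix ι ι ℂ} (hρ : IsDensity ρ)
    (hσ : σ.PosSemidef) (hd : Dominated ρ σ) {E : Matrix ι ι ℂ →ₗ[ℂ] Matrix κ κ ℂ}
    (hE : IsCPTP E) : imD k (E ρ) (E σ) ≤ imD k ρ σ := by
  obtain ⟨A, C, h, -, -, hv⟩ := exists_dual_optimum hk hρ hσ hd
  -- The channel carries a dual optimum to a dual point with the same traces, so weak duality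
  -- suffices.
  have h' : DualChain k (E ρ) (E σ) (fun i => E (A i)) (fun i => E (C i)) := by
    refine ⟨?_, by simp only [h.2.1], fun i h1 h2 => hE.block_posSemidef (h.2.2 i h1 h2)⟩
    rw [← map_sub]
    exact hE.map_posSemidef h.1
  have hle : imQ k (E ρ) (E σ) ≤ imQ k ρ σ := by
    refine (imQ_le_dualValue hk h').trans_eq ?_
    rw [← hv]
    simp only [dualValue, rtr, hE.2]
  have hpos : 0 < imQ k (E ρ) (E σ) :=
    imQ_pos hk ⟨hE.map_posSemidef hρ.1, by rw [hE.2, hρ.2]⟩ (hE.map_posSemidef hσ)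
      ⟨_, primalValues_le_dualValue hk h'⟩
  exact mul_le_mul_of_nonneg_left (Real.log_le_log hpos hle)
    (one_div_pos.mpr (alpha_sub_one_pos hk)).le

end Channels

/-! ### Submultiplicativity under tensor products -/

section Tensor

variable {ι : Type*} [Fintype ι] [DecidableEq ι] {κ : Type*} [Fintype κ] [DecidableEq κ]

lemma kronecker_posSemidef {A : Matrix ι ι ℂ} {B : Matrix κ κ ℂ} (hA : A.PosSemidef)
    (hB : B.PosSemidef) : (A ⊗ₖ B).PosSemidef :=
  hA.kronecker hB

/-- The block of Kronecker products is a principal submatrix of the Kronecker product of the blocks.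
-/
lemma block_kronecker_posSemidef {A B C D : Matrix ι ι ℂ} {A' B' C' D' : Matrix κ κ ℂ}
    (h : (fromBlocks A B C D).PosSemidef) (h' : (fromBlocks A' B' C' D').PosSemidef) :
    (fromBlocks (A ⊗ₖ A') (B ⊗ₖ B') (C ⊗ₖ C') (D ⊗ₖ D')).PosSemidef := by
  have h1 := (kronecker_posSemidef h h').submatrix (Sum.elim (fun p => (Sum.inl p.1, Sum.inl p.2))
    (fun p => (Sum.inr p.1, Sum.inr p.2)) : (ι × κ) ⊕ (ι × κ) → (ι ⊕ ι) × (κ ⊕ κ))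
  convert h1 using 1
  ext (i | i) (j | j) <;> rfl

lemma rtr_kronecker {A : Matrix ι ι ℂ} {B : Matrix κ κ ℂ} (hA : A.IsHermitian)
    (hB : B.IsHermitian) : rtr (A ⊗ₖ B) = rtr A * rtr B := by
  have h : (A ⊗ₖ B).trace = ((rtr A * rtr B : ℝ) : ℂ) := by
    rw [trace_kronecker, trace_eq_rtr hA, trace_eq_rtr hB, Complex.ofReal_mul]
  rw [rtr, h, Complex.ofReal_re]

/-- Submultiplicativity. -/
theorem imD_kronecker_le {k : ℕ} (hk : 1 ≤ k) {ρ σ : Matrix ι ι ℂ} {ρ' σ' : Matrix κ κ ℂ}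
    (hρ : IsDensity ρ) (hσ : σ.PosSemidef) (hd : Dominated ρ σ)
    (hρ' : IsDensity ρ') (hσ' : σ'.PosSemidef) (hd' : Dominated ρ' σ') :
    imD k (ρ ⊗ₖ ρ') (σ ⊗ₖ σ') ≤ imD k ρ σ + imD k ρ' σ' := by
  obtain ⟨A, C, h, he, hA, -⟩ := exists_dual_optimum hk hρ hσ hd
  obtain ⟨A', C', h', he', hA', -⟩ := exists_dual_optimum hk hρ' hσ' hd'
  have hAH : ∀ i, 1 ≤ i → i ≤ k → (A i).IsHermitian := fun i h1 h2 =>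
    (block_left (h.2.2 i h1 h2)).1
  have hAH' : ∀ i, 1 ≤ i → i ≤ k → (A' i).IsHermitian := fun i h1 h2 =>
    (block_left (h'.2.2 i h1 h2)).1
  have hC' : (C' 1).PosSemidef := by
    have := h'.1.add hρ'.1
    rwa [sub_add_cancel] at this
  have hch : DualChain k (ρ ⊗ₖ ρ') (σ ⊗ₖ σ') (fun i => A i ⊗ₖ A' i) (fun i => C i ⊗ₖ C' i) := by
    refine ⟨?_, by simp only [h.2.1, h'.2.1], fun i h1 h2 =>
      block_kronecker_posSemidef (h.2.2 i h1 h2) (h'.2.2 i h1 h2)⟩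
    -- `C ⊗ C' - ρ ⊗ ρ' = (C - ρ) ⊗ C' + ρ ⊗ (C' - ρ')`.
    have h1 := (kronecker_posSemidef h.1 hC').add (kronecker_posSemidef hρ.1 h'.1)
    convert h1 using 1
    ext p q
    simp only [Matrix.add_apply, Matrix.sub_apply, kroneckerMap_apply]
    ring
  -- Equal traces make the dual objective multiplicative; a weighted sum of traces would not be.
  have hle : imQ k (ρ ⊗ₖ ρ') (σ ⊗ₖ σ') ≤ imQ k ρ σ * imQ k ρ' σ' := by
    refine (imQ_le_dualValue hk hch).trans_eq ?_
    rw [dualValue_of_equal hk fun i h1 h2 => ?_, rtr_kronecker (hAH 1 le_rfl hk)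
      (hAH' 1 le_rfl hk), hA, hA']
    rw [rtr_kronecker (hAH i h1 h2) (hAH' i h1 h2), rtr_kronecker (hAH 1 le_rfl hk)
      (hAH' 1 le_rfl hk), he.rtr_eq i h1 h2, he'.rtr_eq i h1 h2]
  have hpos : 0 < imQ k (ρ ⊗ₖ ρ') (σ ⊗ₖ σ') :=
    imQ_pos hk ⟨kronecker_posSemidef hρ.1 hρ'.1, by rw [trace_kronecker, hρ.2, hρ'.2, mul_one]⟩
      (kronecker_posSemidef hσ hσ') ⟨_, primalValues_le_dualValue hk hch⟩
  have h1 := Real.log_le_log hpos hle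
  rw [Real.log_mul (imQ_pos_of_dominated hk hρ hσ hd).ne'
    (imQ_pos_of_dominated hk hρ' hσ' hd').ne'] at h1
  rw [imD, imD, imD, ← mul_add]
  exact mul_le_mul_of_nonneg_left h1 (one_div_pos.mpr (alpha_sub_one_pos hk)).le

end Tensor

/-! ### The geometric mean -/

section GeometricMean

variable {ι : Type*} [Fintype ι] [DecidableEq ι]

/-- Operator monotonicity of the square root. -/
lemma sub_posSemidef_of_sq {W X : Matrix ι ι ℂ} (hW : W.PosSemidef) (hX : X.IsHermitian)
    (h : (W * W - X * X).PosSemidef) : (W - X).PosSemidef := by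
  have hD : (W - X).IsHermitian := hW.1.sub hX
  rw [hD.posSemidef_iff_eigenvalues_nonneg]
  intro i
  by_contra hneg
  simp only [Pi.zero_apply, not_le] at hneg
  set μ : ℝ := hD.eigenvalues i with hμ
  set v : ι → ℂ := ⇑(hD.eigenvectorBasis i) with hv
  have hDv : (W - X) *ᵥ v = (μ : ℂ) • v := by
    have := hD.mulVec_eigenvectorBasis i
    rw [← hv, ← hμ] at this
    rw [this, Complex.coe_smul]
  have hvD : star v ᵥ* (W - X) = (μ : ℂ) • star v := by
    have := congrArg star hDv
    rw [star_mulVec, hD.eq, star_smul] at this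
    rw [this, Complex.star_def, Complex.conj_ofReal]
  -- On an eigenvector `v` of `W - X` with eigenvalue `μ < 0` this form equals `2 μ ⟨v, W v⟩ - μ²
  -- ‖v‖²`, which is negative.
  have e : W * W - X * X = W * (W - X) + (W - X) * W - (W - X) * (W - X) := by noncomm_ring
  have hq := h.re_dotProduct_nonneg v
  have hvv : 0 < (star v ⬝ᵥ v).re := by
    have hne : v ≠ 0 := by
      intro h0
      have := hD.eigenvectorBasis.orthonormal.ne_zero i
      exact this (by ext a; exact congrFun h0 a)
    exact (Complex.pos_iff.mp (dotProduct_star_self_pos_iff.mpr hne)).1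
  have hWv : 0 ≤ (star v ⬝ᵥ (W *ᵥ v)).re := hW.re_dotProduct_nonneg v
  rw [e, sub_mulVec, add_mulVec, ← mulVec_mulVec, ← mulVec_mulVec, ← mulVec_mulVec, hDv,
    dotProduct_sub, dotProduct_add, dotProduct_mulVec _ (W - X), dotProduct_mulVec _ (W - X), hvD,
    mulVec_smul] at hq
  simp only [smul_dotProduct, dotProduct_smul, smul_eq_mul, map_sub, map_add, RCLike.re_to_complex,
    Complex.re_ofReal_mul] at hq
  nlinarith [mul_pos hvv (mul_pos_of_neg_of_neg hneg hneg)]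

lemma mpow_half_mul_neg_half {A : Matrix ι ι ℂ} (hA : A.PosDef) :
    mpow A (1 / 2) * mpow A (-1 / 2) = 1 := by
  rw [mpow, mpow, cfc_mul_cfc, ← cfc_const_one ℝ A hA.1.isSelfAdjoint]
  refine cfc_congr fun t ht => ?_
  rw [hA.1.spectrum_real_eq_range_eigenvalues] at ht
  obtain ⟨i, rfl⟩ := ht
  have := hA.eigenvalues_pos i
  show _ * _ = (1 : ℝ)
  rw [← Real.rpow_add this]
  norm_num

lemma mpow_neg_half_mul_half {A : Matrix ι ι ℂ} (hA : A.PosDef) :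
    mpow A (-1 / 2) * mpow A (1 / 2) = 1 :=
  mul_eq_one_comm.mp (mpow_half_mul_neg_half hA)

lemma mpow_half_mul_half {A : Matrix ι ι ℂ} (hA : A.PosSemidef) :
    mpow A (1 / 2) * mpow A (1 / 2) = A := by
  rw [mpow_mul_mpow_of_nonneg hA (by norm_num) (by norm_num)]
  norm_num [mpow_one hA.1]

/-- The block is congruent, via `A^{1/2}`, to `[1, s; s, s²]`, where `s` is the square root of
`A^{-1/2} B A^{-1/2}`. -/
lemma geomMeanPos_block {A B : Matrix ι ι ℂ} (hA : A.PosDef) (hB : B.PosSemidef) :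
    (fromBlocks A (geomMeanPos A B) (geomMeanPos A B) B).PosSemidef := by
  set a := mpow A (1 / 2) with ha
  set a' := mpow A (-1 / 2) with ha'
  have haH : aᴴ = a := (mpow_isHermitian A _).eq
  have haH' : a'ᴴ = a' := (mpow_isHermitian A _).eq
  have hT : (a' * B * a').PosSemidef := by
    have := hB.conjTranspose_mul_mul_same a'
    rwa [haH'] at this
  set s := mpow (a' * B * a') (1 / 2) with hs
  have hsH : sᴴ = s := (mpow_isHermitian _ _).eq
  have h1 := block_conj_posSemidef (block_posSemidef_of_factor 1 s) a a
  rw [haH, hsH, conjTranspose_one, Matrix.one_mul, Matrix.one_mul, Matrix.mul_one, Matrix.mul_one,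
    hs, mpow_half_mul_half hT, ← hs, ha, mpow_half_mul_half hA.posSemidef, ← ha] at h1
  have e : a * (a' * B * a') * a = B := by
    calc _ = (a * a') * B * (a' * a) := by simp only [Matrix.mul_assoc]
      _ = B := by
        rw [mpow_half_mul_neg_half hA, mpow_neg_half_mul_half hA, Matrix.one_mul, Matrix.mul_one]
  rwa [e] at h1

/-- Congruence by `A^{-1/2}` reduces to `A = 1`, where the block condition reads `K² ≤ T`; operator
monotonicity of the square root gives `K ≤ T^{1/2}`. -/
lemma geomMeanPos_max {A B C : Matrix ι ι ℂ} (hA : A.PosDef)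
    (h : (fromBlocks A C C B).PosSemidef) : (geomMeanPos A B - C).PosSemidef := by
  set a := mpow A (1 / 2) with ha
  set a' := mpow A (-1 / 2) with ha'
  have haH : aᴴ = a := (mpow_isHermitian A _).eq
  have haH' : a'ᴴ = a' := (mpow_isHermitian A _).eq
  have hT : (a' * B * a').PosSemidef := by
    have := (block_right h).conjTranspose_mul_mul_same a'
    rwa [haH'] at this
  have hC : C.IsHermitian := block_symm h
  have hK : (a' * C * a').IsHermitian := by
    have := isHermitian_conjTranspose_mul_mul a' hC
    rwa [haH'] at this
  have h1 := block_conj_posSemidef h a' a'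
  have e1 : a' * A * a' = 1 := by
    calc a' * A * a' = (a' * a) * (a * a') := by
          conv_lhs => rw [← mpow_half_mul_half hA.posSemidef, ← ha]
          simp only [Matrix.mul_assoc]
      _ = 1 := by
        rw [mpow_half_mul_neg_half hA, mpow_neg_half_mul_half hA, Matrix.one_mul]
  rw [haH', e1] at h1
  have h2 := block_one_posSemidef_iff.mp (show (fromBlocks 1 (a' * C * a') (a' * C * a')ᴴ
    (a' * B * a')).PosSemidef by rwa [hK.eq])
  rw [hK.eq] at h2
  have h3 := sub_posSemidef_of_sq (mpow_posSemidef hT (1 / 2)) hK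
    (by rwa [mpow_half_mul_half hT])
  have h4 := h3.conjTranspose_mul_mul_same a
  rw [haH, Matrix.mul_sub, Matrix.sub_mul] at h4
  have e : a * (a' * C * a') * a = C := by
    calc _ = (a * a') * C * (a' * a) := by simp only [Matrix.mul_assoc]
      _ = C := by
        rw [mpow_half_mul_neg_half hA, mpow_neg_half_mul_half hA, Matrix.one_mul, Matrix.mul_one]
  rwa [e] at h4

lemma add_smul_one_posDef {A : Matrix ι ι ℂ} (hA : A.PosSemidef) {ε : ℝ} (hε : 0 < ε) :
    (A + (ε : ℂ) • 1).PosDef :=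
  PosDef.posSemidef_add hA (PosDef.one.smul (by exact_mod_cast hε))

lemma geomMeanPos_posSemidef {A B : Matrix ι ι ℂ} (hA : A.PosDef) (hB : B.PosSemidef) :
    (geomMeanPos A B).PosSemidef := by
  have := geomMeanPos_max hA (block_diag_posSemidef hA.posSemidef hB)
  rwa [sub_zero] at this

/-- The traces are monotone and bounded below, hence Cauchy. Every entry of a positive difference is
bounded by its trace, so the entries are Cauchy as well. -/
lemma tendsto_of_monotone_psd {M : ℝ → Matrix ι ι ℂ} (h0 : ∀ ε, 0 < ε → (M ε).PosSemidef)
    (hm : ∀ ε δ, 0 < ε → ε ≤ δ → (M δ - M ε).PosSemidef) :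
    ∃ L, Filter.Tendsto M (𝓝[>] 0) (𝓝 L) := by
  have ht : Filter.Tendsto (fun ε => rtr (M ε)) (𝓝[>] 0)
      (𝓝 (sInf ((fun ε => rtr (M ε)) '' Set.Ioi 0))) := by
    refine MonotoneOn.tendsto_nhdsGT ?_ ?_
    · intro ε hε δ _ h
      exact rtr_le (hm ε δ hε h)
    · refine ⟨0, ?_⟩
      rintro _ ⟨ε, hε, rfl⟩
      exact rtr_nonneg (h0 ε hε)
  have hc := ht.cauchy_map
  rw [cauchy_map_iff'] at hc
  have hd := tendsto_uniformity_iff_dist_tendsto_zero.mp hc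
  have hentry : ∀ a b, ∃ l, Filter.Tendsto (fun ε => M ε a b) (𝓝[>] 0) (𝓝 l) := by
    intro a b
    refine CompleteSpace.complete ?_
    rw [cauchy_map_iff']
    refine tendsto_uniformity_iff_dist_tendsto_zero.mpr ?_
    refine squeeze_zero' (Filter.Eventually.of_forall fun _ => dist_nonneg) ?_ hd
    have hev : ∀ᶠ p : ℝ × ℝ in 𝓝[>] 0 ×ˢ 𝓝[>] 0, 0 < p.1 ∧ 0 < p.2 :=
      Filter.Eventually.prod_mk (la := 𝓝[>] (0 : ℝ)) (lb := 𝓝[>] (0 : ℝ)) self_mem_nhdsWithin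
        self_mem_nhdsWithin
    filter_upwards [hev] with p hp
    rcases le_total p.1 p.2 with h | h
    · have h1 := norm_apply_le_rtr (hm _ _ hp.1 h) a b
      rw [rtr_sub] at h1
      rw [dist_comm, dist_eq_norm, dist_comm, Real.dist_eq]
      exact h1.trans (le_abs_self _)
    · have h1 := norm_apply_le_rtr (hm _ _ hp.2 h) a b
      rw [rtr_sub] at h1
      rw [dist_eq_norm, Real.dist_eq]
      exact h1.trans (le_abs_self _)
  choose L hL using hentry
  exact ⟨Matrix.of L, tendsto_pi_nhds.mpr fun a => tendsto_pi_nhds.mpr fun b => hL a b⟩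

/-- The defining property of the geometric mean: it is the largest matrix `C` for which the block
matrix with entries `A`, `C`, `C`, `B` is positive semidefinite. -/
theorem geomMean_spec {A B : Matrix ι ι ℂ} (hA : A.PosSemidef) (hB : B.PosSemidef) :
    (fromBlocks A (geomMean A B) (geomMean A B) B).PosSemidef ∧
      ∀ C, (fromBlocks A C C B).PosSemidef → (geomMean A B - C).PosSemidef := by
  set M : ℝ → Matrix ι ι ℂ := fun ε => geomMeanPos (A + (ε : ℂ) • 1) (B + (ε : ℂ) • 1) with hM
  have hb : ∀ ε : ℝ, 0 < ε →
      (fromBlocks (A + (ε : ℂ) • 1) (M ε) (M ε) (B + (ε : ℂ) • 1)).PosSemidef := fun ε hε =>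
    geomMeanPos_block (add_smul_one_posDef hA hε) (add_smul_one_posDef hB hε).posSemidef
  have hadd : ∀ (X : Matrix ι ι ℂ) (ε δ : ℝ),
      X + (ε : ℂ) • 1 + ((δ - ε : ℝ) : ℂ) • 1 = X + (δ : ℂ) • 1 := fun X ε δ => by
    rw [add_assoc, ← add_smul, ← Complex.ofReal_add, add_sub_cancel]
  have hmono : ∀ ε δ : ℝ, 0 < ε → ε ≤ δ → (M δ - M ε).PosSemidef := by
    intro ε δ hε h
    refine geomMeanPos_max (add_smul_one_posDef hA (hε.trans_le h)) ?_
    have hp : (((δ - ε : ℝ) : ℂ) • (1 : Matrix ι ι ℂ)).PosSemidef :=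
      PosSemidef.smul_real PosSemidef.one (sub_nonneg.mpr h)
    have := block_add_posSemidef (hb ε hε) hp hp
    rwa [hadd, hadd] at this
  obtain ⟨L, hL⟩ := tendsto_of_monotone_psd (fun ε hε => geomMeanPos_posSemidef
    (add_smul_one_posDef hA hε) (add_smul_one_posDef hB hε).posSemidef) hmono
  have hG : geomMean A B = L := hL.limUnder_eq
  rw [hG]
  have hpert : ∀ X : Matrix ι ι ℂ,
      Filter.Tendsto (fun ε : ℝ => X + (ε : ℂ) • (1 : Matrix ι ι ℂ)) (𝓝[>] 0) (𝓝 X) := by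
    intro X
    have hc : Continuous fun ε : ℝ => X + (ε : ℂ) • (1 : Matrix ι ι ℂ) :=
      continuous_const.add (Complex.continuous_ofReal.smul continuous_const)
    have := (hc.tendsto 0).mono_left (nhdsWithin_le_nhds (s := Set.Ioi 0))
    simpa using this
  refine ⟨?_, fun C hC => ?_⟩
  · have ht : Filter.Tendsto (fun ε : ℝ => fromBlocks (A + (ε : ℂ) • 1) (M ε) (M ε)
        (B + (ε : ℂ) • 1)) (𝓝[>] 0) (𝓝 (fromBlocks A L L B)) := by
      have hc : Continuous fun q : Matrix ι ι ℂ × Matrix ι ι ℂ × Matrix ι ι ℂ =>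
          fromBlocks q.1 q.2.1 q.2.1 q.2.2 := by fun_prop
      exact (hc.tendsto (A, L, B)).comp ((hpert A).prodMk_nhds (hL.prodMk_nhds (hpert B)))
    refine isClosed_posSemidef.mem_of_tendsto ht ?_
    filter_upwards [self_mem_nhdsWithin] with ε hε using hb ε hε
  · refine isClosed_posSemidef.mem_of_tendsto (hL.sub_const C) ?_
    filter_upwards [self_mem_nhdsWithin] with ε hε
    have hp : (((ε : ℝ) : ℂ) • (1 : Matrix ι ι ℂ)).PosSemidef :=
      PosSemidef.smul_real PosSemidef.one (Set.mem_Ioi.mp hε).le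
    exact geomMeanPos_max (add_smul_one_posDef hA hε) (block_add_posSemidef hC hp hp)

lemma geomMean_posSemidef {A B : Matrix ι ι ℂ} (hA : A.PosSemidef) (hB : B.PosSemidef) :
    (geomMean A B).PosSemidef := by
  have := (geomMean_spec hA hB).2 0 (block_diag_posSemidef hA hB)
  rwa [sub_zero] at this

lemma exists_blocks_of_iterGeomMean (A : ℕ → Matrix ι ι ℂ) (k : ℕ) (σ : Matrix ι ι ℂ)
    (hσ : σ.PosSemidef) (hA : ∀ i, 1 ≤ i → i ≤ k → (A i).PosSemidef) :
    ∃ C : ℕ → Matrix ι ι ℂ, C 1 = iterGeomMean A k σ ∧ C (k + 1) = σ ∧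
      ∀ i, 1 ≤ i → i ≤ k → (fromBlocks (A i) (C i) (C i) (C (i + 1))).PosSemidef := by
  induction k generalizing σ with
  | zero => exact ⟨fun _ => σ, rfl, rfl, fun i h1 h2 => by omega⟩
  | succ k ih =>
    have hAk := hA (k + 1) (by omega) le_rfl
    obtain ⟨C, h1, h2, h3⟩ := ih (geomMean (A (k + 1)) σ) (geomMean_posSemidef hAk hσ)
      fun i hi1 hi2 => hA i hi1 (by omega)
    refine ⟨fun i => if i ≤ k + 1 then C i else σ, by simp [iterGeomMean, h1], by simp,
      fun i hi1 hi2 => ?_⟩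
    rcases hi2.lt_or_eq with hlt | rfl
    · simpa [hi2, Nat.lt_succ_iff.mp hlt] using h3 i hi1 (by omega)
    · simpa [h2] using (geomMean_spec hAk hσ).1

/-- The innermost mean is peeled off, and by maximality it dominates `C (k + 1)` at the next stage.
The slack `σ - C (k + 1) ≥ 0` in the hypotheses is what the induction passes on. -/
lemma iterGeomMean_sub_posSemidef (A : ℕ → Matrix ι ι ℂ) (k : ℕ) (σ : Matrix ι ι ℂ)
    (hσ : σ.PosSemidef) (C : ℕ → Matrix ι ι ℂ) (hC : (σ - C (k + 1)).PosSemidef)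
    (h : ∀ i, 1 ≤ i → i ≤ k → (fromBlocks (A i) (C i) (C i) (C (i + 1))).PosSemidef) :
    (iterGeomMean A k σ - C 1).PosSemidef := by
  induction k generalizing σ with
  | zero => exact hC
  | succ k ih =>
    have hb := h (k + 1) (by omega) le_rfl
    have h1 := block_add_posSemidef hb PosSemidef.zero hC
    rw [add_zero, add_sub_cancel] at h1
    have hAk := block_left hb
    exact ih (geomMean (A (k + 1)) σ) (geomMean_posSemidef hAk hσ)
      ((geomMean_spec hAk hσ).2 _ h1) fun i hi1 hi2 => h i hi1 (by omega)

theorem isLeast_dualMeanValues {k : ℕ} (hk : 1 ≤ k) {ρ σ : Matrix ι ι ℂ} (hρ : IsDensity ρ)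
    (hσ : σ.PosSemidef) (hd : Dominated ρ σ) : IsLeast (dualMeanValues k ρ σ) (imQ k ρ σ) := by
  refine ⟨?_, ?_⟩
  · obtain ⟨A, C, h, he, hv, -⟩ := exists_dual_optimum hk hρ hσ hd
    refine ⟨A, fun i h1 h2 => block_left (h.2.2 i h1 h2), he, ?_, hv.symm⟩
    have h1 := iterGeomMean_sub_posSemidef A k σ hσ C (by rw [h.2.1]; simpa using PosSemidef.zero)
      h.2.2
    have := h1.add h.1
    rwa [sub_add_sub_cancel] at this
  · rintro _ ⟨A, hA, he, h, rfl⟩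
    obtain ⟨C, h1, h2, h3⟩ := exists_blocks_of_iterGeomMean A k σ hσ hA
    have := imQ_le_dualValue (ρ := ρ) hk ⟨by rw [h1]; exact h, h2, h3⟩
    rwa [dualValue_of_equal hk he.rtr_eq] at this

end GeometricMean

/-! ### The harmonic Schur multiplier -/

section SchurMultiplier

variable {ι : Type*} [Fintype ι] [DecidableEq ι]

/-- A Hermitian solution of a Lyapunov equation with positive semidefinite right hand side is
positive semidefinite. -/
lemma posSemidef_of_lyapunov {A K : Matrix ι ι ℂ} (hA : A.PosDef) (hK : K.IsHermitian)
    (h : (A * K + K * A).PosSemidef) : K.PosSemidef := by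
  rw [hK.posSemidef_iff_eigenvalues_nonneg]
  intro i
  by_contra hneg
  simp only [Pi.zero_apply, not_le] at hneg
  set μ : ℝ := hK.eigenvalues i with hμ
  set v : ι → ℂ := ⇑(hK.eigenvectorBasis i) with hv
  have hKv : K *ᵥ v = (μ : ℂ) • v := by
    have := hK.mulVec_eigenvectorBasis i
    rw [← hv, ← hμ] at this
    rw [this, Complex.coe_smul]
  have hvK : star v ᵥ* K = (μ : ℂ) • star v := by
    have := congrArg star hKv
    rw [star_mulVec, hK.eq, star_smul] at this
    rw [this, Complex.star_def, Complex.conj_ofReal]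
  have hne : v ≠ 0 := by
    intro h0
    have := hK.eigenvectorBasis.orthonormal.ne_zero i
    exact this (by ext a; exact congrFun h0 a)
  have hAv : 0 < (star v ⬝ᵥ (A *ᵥ v)).re := hA.re_dotProduct_pos hne
  have hq := h.re_dotProduct_nonneg v
  rw [add_mulVec, ← mulVec_mulVec, ← mulVec_mulVec, hKv, dotProduct_add, dotProduct_mulVec _ K, hvK,
    mulVec_smul] at hq
  simp only [smul_dotProduct, dotProduct_smul, smul_eq_mul, map_add, RCLike.re_to_complex,
    Complex.re_ofReal_mul] at hq
  nlinarith [mul_pos_of_neg_of_neg hneg (neg_neg_of_pos hAv)]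

/-- The matrix of ratios of harmonic means of squares, with entries
`2 * e i * e j / (e i ^ 2 + e j ^ 2)`. -/
noncomputable def harmonicKernel (e : ι → ℝ) : Matrix ι ι ℂ :=
  Matrix.of fun i j => ((2 * e i * e j / (e i * e i + e j * e j) : ℝ) : ℂ)

lemma harmonicKernel_mul (e : ι → ℝ) (i j : ι) :
    harmonicKernel e i j * ((e i : ℂ) * e i + e j * e j) = 2 * e i * e j := by
  have : 2 * e i * e j / (e i * e i + e j * e j) * (e i * e i + e j * e j) = 2 * e i * e j := by
    by_cases h : e i * e i + e j * e j = 0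
    · have h1 : e i = 0 := by nlinarith [mul_self_nonneg (e i), mul_self_nonneg (e j)]
      simp [h1]
    · exact div_mul_cancel₀ _ h
  rw [harmonicKernel, of_apply]
  exact_mod_cast this

lemma harmonicKernel_isHermitian (e : ι → ℝ) : (harmonicKernel e).IsHermitian := by
  ext i j
  rw [conjTranspose_apply, harmonicKernel, of_apply, of_apply, Complex.star_def, Complex.conj_ofReal]
  congr 2
  · ring
  · ring

/-- With `A = diag(e²)` the kernel solves `A K + K A = 2 e eᵀ`, whose right-hand side is positive of
rank at most one. -/
lemma harmonicKernel_posSemidef (e : ι → ℝ) : (harmonicKernel e).PosSemidef := by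
  -- Zero entries are replaced by `1` to make the diagonal definite; the corresponding rows and
  -- columns of the kernel vanish.
  set a : ι → ℂ := fun i => if e i = 0 then 1 else (e i : ℂ) * e i with ha
  have hA : (diagonal a).PosDef := by
    rw [posDef_diagonal_iff]
    intro i
    simp only [ha]
    split_ifs with h
    · exact one_pos
    · exact_mod_cast mul_self_pos.mpr h
  refine posSemidef_of_lyapunov hA (harmonicKernel_isHermitian e) ?_
  have h1 := PosSemidef.smul_real (posSemidef_vecMulVec_self_star fun i => (e i : ℂ))
    (zero_le_two : (0 : ℝ) ≤ 2)
  convert h1 using 1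
  ext i j
  rw [Matrix.add_apply, diagonal_mul, mul_diagonal, Matrix.smul_apply, vecMulVec_apply]
  simp only [Pi.star_apply, Complex.star_def, Complex.conj_ofReal, smul_eq_mul, Complex.ofReal_ofNat]
  by_cases hi : e i = 0
  · simp [harmonicKernel, hi]
  by_cases hj : e j = 0
  · simp [harmonicKernel, hj]
  have := harmonicKernel_mul e i j
  simp only [ha, hi, hj, if_false]
  linear_combination this

lemma harmonicKernel_diag_le (e : ι → ℝ) :
    (1 - harmonicKernel e ⊙ (1 : Matrix ι ι ℂ)).PosSemidef := by
  have h : 1 - harmonicKernel e ⊙ (1 : Matrix ι ι ℂ) =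
      diagonal fun i => ((1 - 2 * e i * e i / (e i * e i + e i * e i) : ℝ) : ℂ) := by
    ext i j
    by_cases hij : i = j
    · subst hij
      simp [harmonicKernel]
    · simp [hij]
  rw [h]
  refine PosSemidef.diagonal fun i => ?_
  have : 0 ≤ 1 - 2 * e i * e i / (e i * e i + e i * e i) := by
    by_cases h0 : e i = 0
    · simp [h0]
    · have : 2 * e i * e i / (e i * e i + e i * e i) = 1 := by
        have := mul_self_pos.mpr h0
        rw [div_eq_one_iff_eq (by positivity)]
        ring
      rw [this, sub_self]
  show (0 : ℂ) ≤ _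
  exact_mod_cast this

/-- Kadison's inequality for Schur multiplication by a subunital positive semidefinite kernel. -/
lemma hadamard_kadison {S T : Matrix ι ι ℂ} (hS : S.PosSemidef)
    (h1 : (1 - S ⊙ (1 : Matrix ι ι ℂ)).PosSemidef) (hT : T.IsHermitian) :
    (S ⊙ (T * T) - (S ⊙ T) * (S ⊙ T)).PosSemidef := by
  have hSS : (fromBlocks S S S S).PosSemidef := by
    convert hS.submatrix (Sum.elim id id : ι ⊕ ι → ι) using 1
    ext (i | i) (j | j) <;> rfl
  have hTT : (fromBlocks 1 T T (T * T)).PosSemidef := by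
    have := block_posSemidef_of_factor 1 T
    simpa [hT.eq] using this
  -- The Schur product theorem, applied to blocks; raising the corner `S ⊙ 1` to `1` then allows a
  -- Schur complement.
  have hH := hSS.hadamard hTT
  have e : fromBlocks S S S S ⊙ fromBlocks 1 T T (T * T) =
      fromBlocks (S ⊙ 1) (S ⊙ T) (S ⊙ T) (S ⊙ (T * T)) := by
    ext (i | i) (j | j) <;> rfl
  rw [e] at hH
  have h2 := block_add_posSemidef hH h1 PosSemidef.zero
  rw [add_sub_cancel, add_zero] at h2
  have h3 : (S ⊙ T).IsHermitian := hS.1.hadamard hT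
  have h4 := block_one_posSemidef_iff.mp (show (fromBlocks 1 (S ⊙ T) (S ⊙ T)ᴴ
    (S ⊙ (T * T))).PosSemidef by rwa [h3.eq])
  rwa [h3.eq] at h4

/-- For positive semidefinite `E` there is a positive, trace nonincreasing map `Φ` which satisfies
Kadison's inequality and solves the Lyapunov equation `Φ T * E² + E² * Φ T = 2 * E * T * E`. -/
theorem exists_lyapunov_map {E : Matrix ι ι ℂ} (hE : E.PosSemidef) :
    ∃ Φ : Matrix ι ι ℂ → Matrix ι ι ℂ,
      (∀ T, Φ T * (E * E) + (E * E) * Φ T = (2 : ℂ) • (E * T * E)) ∧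
      (∀ X, Φ ((1 / 2 : ℂ) • (X * (E * E) + (E * E) * X)) = E * X * E) ∧
      (∀ T, T.PosSemidef → (Φ T).PosSemidef) ∧
      (∀ T, T.IsHermitian → (Φ T).IsHermitian) ∧
      (∀ T, T.IsHermitian → (Φ (T * T) - Φ T * Φ T).PosSemidef) ∧
      ∀ T, T.PosSemidef → rtr (Φ T) ≤ rtr T := by
  set U : Matrix ι ι ℂ := (hE.1.eigenvectorUnitary : Matrix ι ι ℂ) with hU
  set e := hE.1.eigenvalues with he
  set D : Matrix ι ι ℂ := diagonal fun i => (e i : ℂ) with hD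
  set S := harmonicKernel e with hS
  have hUU : Uᴴ * U = 1 := Unitary.coe_star_mul_self hE.1.eigenvectorUnitary
  have hUU' : U * Uᴴ = 1 := Unitary.coe_mul_star_self hE.1.eigenvectorUnitary
  have hED : E = U * D * Uᴴ := by
    have := cfc_eq_unitary hE.1 (fun t => t)
    rwa [cfc_id' ℝ E hE.1.isSelfAdjoint] at this
  have hc : ∀ X Y : Matrix ι ι ℂ, U * X * Uᴴ * (U * Y * Uᴴ) = U * (X * Y) * Uᴴ := fun X Y => by
    calc _ = U * X * (Uᴴ * U) * Y * Uᴴ := by simp only [Matrix.mul_assoc]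
      _ = _ := by rw [hUU, Matrix.mul_one]; simp only [Matrix.mul_assoc]
  have hc' : ∀ X Y : Matrix ι ι ℂ, Uᴴ * (X * Y) * U = Uᴴ * X * U * (Uᴴ * Y * U) := fun X Y => by
    calc _ = Uᴴ * X * (U * Uᴴ) * Y * U := by rw [hUU', Matrix.mul_one]; simp only [Matrix.mul_assoc]
      _ = _ := by simp only [Matrix.mul_assoc]
  have hED' : Uᴴ * E * U = D := by
    rw [hED]
    calc _ = (Uᴴ * U) * D * (Uᴴ * U) := by simp only [Matrix.mul_assoc]
      _ = D := by rw [hUU, Matrix.one_mul, Matrix.mul_one]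
  have hTU : ∀ T : Matrix ι ι ℂ, T = U * (Uᴴ * T * U) * Uᴴ := fun T => by
    calc T = (U * Uᴴ) * T * (U * Uᴴ) := by rw [hUU', Matrix.one_mul, Matrix.mul_one]
      _ = _ := by simp only [Matrix.mul_assoc]
  have hconj : ∀ X : Matrix ι ι ℂ, X.PosSemidef → (U * X * Uᴴ).PosSemidef := fun X hX =>
    hX.mul_mul_conjTranspose_same U
  have htr : ∀ X : Matrix ι ι ℂ, rtr (U * X * Uᴴ) = rtr X := fun X => by
    rw [rtr_mul_comm, ← Matrix.mul_assoc, hUU, Matrix.one_mul]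
  have hSp := harmonicKernel_posSemidef e
  have hS1 := harmonicKernel_diag_le e
  have hherm : ∀ T : Matrix ι ι ℂ, T.IsHermitian → (Uᴴ * T * U).IsHermitian := fun T hT =>
    isHermitian_conjTranspose_mul_mul U hT
  have hpsd : ∀ T : Matrix ι ι ℂ, T.PosSemidef → (Uᴴ * T * U).PosSemidef := fun T hT =>
    hT.conjTranspose_mul_mul_same U
  have hETE : ∀ T, E * T * E = U * (D * (Uᴴ * T * U) * D) * Uᴴ := fun T => by
    rw [hTU (E * T * E), hc', hc', hED']
  have hEE : E * E = U * (D * D) * Uᴴ := by rw [hED, hc]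
  have hEE' : Uᴴ * (E * E) * U = D * D := by rw [hc', hED']
  -- In the eigenbasis of `E` the Lyapunov equation is entrywise, so its solution is Schur
  -- multiplication by the harmonic kernel.
  refine ⟨fun T => U * (S ⊙ (Uᴴ * T * U)) * Uᴴ, fun T => ?_, fun X => ?_, fun T hT => ?_,
    fun T hT => ?_, fun T hT => ?_, fun T hT => ?_⟩
  · simp only []
    rw [hETE, hEE, hc, hc, ← Matrix.add_mul, ← Matrix.mul_add, ← Matrix.smul_mul,
      ← Matrix.mul_smul]
    set T' := Uᴴ * T * U
    congr 2
    ext i j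
    simp only [hD, diagonal_mul_diagonal, Matrix.add_apply, mul_diagonal, diagonal_mul,
      hadamard_apply, Matrix.smul_apply, smul_eq_mul]
    linear_combination T' i j * harmonicKernel_mul e i j
  · simp only []
    rw [Matrix.mul_smul, Matrix.smul_mul, Matrix.mul_add, Matrix.add_mul, hc', hc' _ X,
      hEE', hETE]
    set X' := Uᴴ * X * U
    congr 2
    ext i j
    simp only [hD, diagonal_mul_diagonal, Matrix.add_apply, mul_diagonal, diagonal_mul,
      hadamard_apply, Matrix.smul_apply, smul_eq_mul]
    linear_combination 1 / 2 * X' i j * harmonicKernel_mul e i j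
  · exact hconj _ (hSp.hadamard (hpsd T hT))
  · exact isHermitian_mul_mul_conjTranspose U (hSp.1.hadamard (hherm T hT))
  · have := hconj _ (hadamard_kadison hSp hS1 (hherm T hT))
    simp only []
    rwa [hc, hc', ← Matrix.sub_mul, ← Matrix.mul_sub]
  · rw [htr]
    conv_rhs => rw [hTU T, htr]
    have h1 : rtr (S ⊙ (Uᴴ * T * U)) =
        rtr ((S ⊙ (1 : Matrix ι ι ℂ)) * (Uᴴ * T * U)) := by
      have : S ⊙ (1 : Matrix ι ι ℂ) = diagonal fun i => S i i := by
        ext i j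
        by_cases hij : i = j
        · subst hij; simp
        · simp [hij]
      rw [this]
      simp [rtr, Matrix.trace, diagonal_mul]
    rw [h1, rtr_mul_comm]
    have := rtr_mul_le (hpsd T hT) hS1
    rwa [Matrix.mul_one] at this

/-- Trace inequality for powers under a positive trace nonincreasing Kadison map. -/
lemma rtr_pow_map_le {Φ : Matrix ι ι ℂ → Matrix ι ι ℂ}
    (hΦ : ∀ T, T.IsHermitian → (Φ T).IsHermitian)
    (hK : ∀ T, T.IsHermitian → (Φ (T * T) - Φ T * Φ T).PosSemidef)
    (htr : ∀ T, T.PosSemidef → rtr (Φ T) ≤ rtr T) (m : ℕ) {T : Matrix ι ι ℂ}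
    (hT : T.IsHermitian) : rtr ((Φ T * Φ T) ^ 2 ^ m) ≤ rtr ((T * T) ^ 2 ^ m) := by
  have hsq : ∀ X : Matrix ι ι ℂ, X.IsHermitian → (X * X).PosSemidef := fun X hX => by
    have := posSemidef_conjTranspose_mul_self X
    rwa [hX.eq] at this
  have hmono : rtr ((Φ T * Φ T) ^ 2 ^ m) ≤ rtr (Φ (T * T) ^ 2 ^ m) := by
    have := rtr_pow_mono (hsq _ (hΦ T hT)) (hK T hT) (2 ^ m - 1)
    rwa [Nat.sub_add_cancel Nat.one_le_two_pow] at this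
  refine hmono.trans ?_
  -- Each step applies Kadison's inequality to the square of the previous matrix, which doubles the
  -- power inside `Φ`.
  induction m generalizing T with
  | zero => simpa using htr _ (hsq T hT)
  | succ m ih =>
    have hTT := (hsq T hT).1
    have h1 : ∀ X : Matrix ι ι ℂ, X ^ 2 ^ (m + 1) = (X * X) ^ 2 ^ m := fun X => by
      rw [pow_succ', pow_mul, pow_two]
    rw [h1, h1]
    have := rtr_pow_mono (hsq _ (hΦ _ hTT)) (hK _ hTT) (2 ^ m - 1)
    rw [Nat.sub_add_cancel Nat.one_le_two_pow] at this
    exact this.trans (ih hTT this)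

end SchurMultiplier

/-! ### The sandwiched and the measured divergence -/

section Sandwiched

variable {ι : Type*} [Fintype ι] [DecidableEq ι]

/-- The trace functional inside the sandwiched divergence. -/
noncomputable def sandwichedQ (α : ℝ) (ρ σ : Matrix ι ι ℂ) : ℝ :=
  rtr (mpow (mpow σ ((1 - α) / (2 * α)) * ρ * mpow σ ((1 - α) / (2 * α))) α)

lemma mul_self_posSemidef {X : Matrix ι ι ℂ} (hX : X.IsHermitian) : (X * X).PosSemidef := by
  have := posSemidef_conjTranspose_mul_self X
  rwa [hX.eq] at this

lemma conj_posSemidef {X P : Matrix ι ι ℂ} (hX : X.PosSemidef) (hP : P.IsHermitian) :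
    (P * X * P).PosSemidef := by
  have := hX.conjTranspose_mul_mul_same P
  rwa [hP.eq] at this

lemma pow_two_pow_succ (X : Matrix ι ι ℂ) (m : ℕ) : X ^ 2 ^ (m + 1) = (X * X) ^ 2 ^ m := by
  rw [pow_succ', pow_mul, pow_two]

lemma mpow_mul_mpow_neg {σ : Matrix ι ι ℂ} (hσ : σ.PosSemidef) {r : ℝ} (hr : r ≠ 0) :
    mpow σ r * mpow σ (-r) = suppProj σ := by
  rw [mpow, mpow, cfc_mul_cfc, suppProj]
  refine cfc_congr_psd hσ fun t ht => ?_
  show t ^ r * t ^ (-r) = _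
  split_ifs with h
  · rw [h, Real.zero_rpow hr, zero_mul]
  · rw [← Real.rpow_add (lt_of_le_of_ne ht (Ne.symm h)), add_neg_cancel, Real.rpow_zero]

lemma mpow_conj_self {σ : Matrix ι ι ℂ} (hσ : σ.PosSemidef) :
    mpow σ (-1 / 2) * σ * mpow σ (-1 / 2) = suppProj σ := by
  have h1 : mpow σ (-1 / 2) * σ = mpow σ (1 / 2) := by
    conv_lhs => rw [← mpow_one hσ.1, mpow_mpow hσ, mpow_mul_mpow_of_ne hσ (by norm_num)]
    norm_num
  rw [h1]
  have := mpow_mul_mpow_neg hσ (r := 1 / 2) (by norm_num)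
  rwa [← neg_div] at this

lemma sandwiched_exponent {k : ℕ} (hk : 1 ≤ k) :
    (1 - alpha k) / (2 * alpha k) = -(1 / (2 * 2 ^ k)) := by
  have h1 := alpha_sub_one_mul hk
  have h2 := one_lt_alpha hk
  have h3 := one_lt_two_pow_real hk
  field_simp
  linarith

/-- A primal chain with tight links: `herm V_{n+1} = E_n T_n E_n`, where `E_n = σ^(2^n r)` runs from
`σ^r` to `σ^{-1/2}` by squaring. The start `T_0 = R^(α-1)` gives the gain `tr R^α`, and the Lyapunov
maps keep the cost below the same number. -/
theorem sandwichedQ_le_imQ {k : ℕ} (hk : 1 ≤ k) {ρ σ : Matrix ι ι ℂ} (hρ : ρ.PosSemidef)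
    (hσ : σ.PosSemidef) (hb : BddAbove (primalValues k ρ σ)) :
    sandwichedQ (alpha k) ρ σ ≤ imQ k ρ σ := by
  set α := alpha k with hα
  have hα1 := one_lt_alpha hk
  set r := (1 - α) / (2 * α) with hr
  have hr0 : r = -(1 / (2 * 2 ^ k)) := sandwiched_exponent hk
  set E : ℕ → Matrix ι ι ℂ := fun n => mpow σ (2 ^ n * r) with hE
  have hEp : ∀ n, (E n).PosSemidef := fun n => mpow_posSemidef hσ _
  have hEs : ∀ n, E n * E n = E (n + 1) := fun n => by
    have h2 : (2 : ℝ) ^ n ≠ 0 := by positivity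
    have hr1 : r < 0 := by rw [hr0]; exact neg_neg_of_pos (by positivity)
    simp only [hE]
    rw [mpow_mul_mpow_of_ne hσ (by
      have := mul_neg_of_pos_of_neg (show (0 : ℝ) < 2 ^ n by positivity) hr1
      exact ne_of_lt (by linarith)), pow_succ]
    congr 1; ring
  have hE0 : E 0 = mpow σ r := by simp [hE]
  have hEk : E k = mpow σ (-1 / 2) := by
    have h2 : (2 : ℝ) ^ k ≠ 0 := by positivity
    simp only [hE, hr0]
    congr 1
    field_simp
  set R := E 0 * ρ * E 0 with hR
  have hRp : R.PosSemidef := conj_posSemidef hρ (hEp 0).1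
  choose Φ hΦ1 _ hΦ3 hΦ4 hΦ5 hΦ6 using fun n => exists_lyapunov_map (hEp n)
  set T : ℕ → Matrix ι ι ℂ := fun n =>
    Nat.rec (mpow R (α - 1)) (fun n X => Φ n X * Φ n X) n with hT
  have hT0 : T 0 = mpow R (α - 1) := rfl
  have hTs : ∀ n, T (n + 1) = Φ n (T n) * Φ n (T n) := fun n => rfl
  have hTp : ∀ n, (T n).PosSemidef := by
    intro n
    induction n with
    | zero => exact mpow_posSemidef hRp _
    | succ n ih => exact mul_self_posSemidef (hΦ4 n _ ih.1)
  -- The Lyapunov equation gives the Hermitian part `E_n T_n E_n`, while `Vᴴ V` is `E_{n+1}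
  -- Φ_n(T_n)² E_{n+1}`; this dictates the choice of `T (n + 1)`.
  set V : ℕ → Matrix ι ι ℂ := fun i => Φ (i - 1) (T (i - 1)) * (E (i - 1) * E (i - 1)) with hV
  have hV' : ∀ n, V (n + 1) = Φ n (T n) * (E n * E n) := fun n => rfl
  have hherm : ∀ n, herm (V (n + 1)) = E n * T n * E n := fun n => by
    rw [hV', herm, conjTranspose_mul, conjTranspose_mul, (hEp n).1.eq, (hΦ4 n _ (hTp n).1).eq, hΦ1,
      smul_smul]
    norm_num
  have hchain : Chain k V := by
    refine ⟨?_, fun i h1 h2 => ?_⟩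
    · rw [hherm 0]
      exact conj_posSemidef (hTp 0) (hEp 0).1
    · obtain ⟨n, rfl⟩ : ∃ n, i = n + 1 := ⟨i - 1, by omega⟩
      rw [hherm, hV', conjTranspose_mul, conjTranspose_mul, (hEp n).1.eq, (hΦ4 n _ (hTp n).1).eq,
        hEs, hTs]
      have : E (n + 1) * (Φ n (T n) * Φ n (T n)) * E (n + 1) -
          E (n + 1) * Φ n (T n) * (Φ n (T n) * E (n + 1)) = 0 := by
        rw [sub_eq_zero]
        simp only [Matrix.mul_assoc]
      rw [this]
      exact PosSemidef.zero
  -- Going back one index trades a squaring in the definition of `T` for a squaring of the power.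
  have hdec : ∀ n m, rtr (T n ^ 2 ^ m) ≤ rtr (T 0 ^ 2 ^ (m + n)) := by
    intro n
    induction n with
    | zero => exact fun m => le_rfl
    | succ n ih =>
      intro m
      rw [hTs]
      refine (rtr_pow_map_le (hΦ4 n) (hΦ5 n) (hΦ6 n) m (hTp n).1).trans ?_
      rw [← pow_two_pow_succ]
      have := ih (m + 1)
      rwa [show m + 1 + n = m + (n + 1) by omega] at this
  have hTk : rtr (T k) ≤ sandwichedQ α ρ σ := by
    have := hdec k 0
    rw [pow_zero, pow_one, zero_add, hT0, mpow_pow hRp] at this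
    refine this.trans_eq ?_
    rw [sandwichedQ, ← hr, ← hE0, ← hR]
    congr 2
    push_cast
    exact alpha_sub_one_mul hk
  have h1 : rtr (ρ * herm (V 1)) = sandwichedQ α ρ σ := by
    rw [hherm 0, rtr_mul_conj, ← hR, hT0]
    conv_lhs => rw [← mpow_one hRp.1]
    rw [mpow_mpow hRp, mpow_mul_mpow_of_ne hRp (by linarith), sandwichedQ, ← hr, ← hE0, ← hR]
    congr 2; ring
  have h2 : rtr (σ * herm (V (k + 1))) ≤ sandwichedQ α ρ σ := by
    rw [hherm k, rtr_mul_conj, hEk, mpow_conj_self hσ, rtr_mul_comm]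
    refine le_trans ?_ hTk
    have := rtr_mul_le (hTp k) (one_sub_suppProj_posSemidef σ)
    rwa [Matrix.mul_one] at this
  refine le_trans ?_ (le_csSup hb (by rw [primalValues_eq hk]; exact ⟨V, hchain, rfl⟩))
  rw [h1]
  nlinarith [mul_le_mul_of_nonneg_left h2 (sub_nonneg.mpr hα1.le)]

lemma rtr_mul_pow_comm (A B : Matrix ι ι ℂ) (n : ℕ) : rtr ((A * B) ^ n) = rtr ((B * A) ^ n) := by
  cases n with
  | zero => simp
  | succ n =>
    have h : ∀ n, (A * B) ^ n * A = A * (B * A) ^ n := by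
      intro n
      induction n with
      | zero => simp
      | succ n ih => rw [pow_succ, Matrix.mul_assoc, Matrix.mul_assoc, ← Matrix.mul_assoc A B A,
          Matrix.mul_assoc A B A, ← Matrix.mul_assoc, ih, Matrix.mul_assoc, ← pow_succ]
    rw [pow_succ, ← Matrix.mul_assoc, h, rtr_mul_comm, ← Matrix.mul_assoc, ← pow_succ']

/-- A special case of the Araki-Lieb-Thirring inequality. -/
theorem rtr_conj_pow_le {D X : Matrix ι ι ℂ} (hD : D.PosSemidef) (hX : X.PosSemidef) (m : ℕ) :
    rtr ((D * X * D) ^ 2 ^ (m + 1)) ≤ rtr (((D * D) * (X * X) * (D * D)) ^ 2 ^ m) := by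
  obtain ⟨Φ, -, h2, -, h4, h5, h6⟩ := exists_lyapunov_map hD
  set N := X * (D * D) with hN
  have hNt : Nᴴ = D * D * X := by
    rw [hN, conjTranspose_mul, conjTranspose_mul, hD.1.eq, hX.1.eq]
  have hH : herm N = (1 / 2 : ℂ) • (X * (D * D) + D * D * X) := by rw [herm, hNt]
  have hHh := herm_isHermitian N
  -- `D X D` is the image of the Hermitian part of `X D²`, so the left side is controlled by powers
  -- of `(herm N)²`.
  have hΦ : Φ (herm N) = D * X * D := by rw [hH, h2]
  have h7 := rtr_pow_map_le h4 h5 h6 m hHh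
  rw [hΦ, ← pow_two_pow_succ] at h7
  refine h7.trans ?_
  have hP := posSemidef_conjTranspose_mul_self N
  have hQ := posSemidef_self_mul_conjTranspose N
  -- The difference is `(N - Nᴴ)ᴴ (N - Nᴴ) / 4`. Midpoint convexity then leaves `NᴴN` and `NNᴴ`,
  -- whose power traces agree.
  have h8 : (((1 / 2 : ℝ) : ℂ) • (Nᴴ * N + N * Nᴴ) - herm N * herm N).PosSemidef := by
    have := PosSemidef.smul_real (posSemidef_conjTranspose_mul_self (N - Nᴴ))
      (by norm_num : (0 : ℝ) ≤ 1 / 4)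
    convert this using 1
    rw [herm, conjTranspose_sub, conjTranspose_conjTranspose, Matrix.smul_mul, Matrix.mul_smul,
      smul_smul]
    have e1 : (N + Nᴴ) * (N + Nᴴ) = N * N + N * Nᴴ + Nᴴ * N + Nᴴ * Nᴴ := by noncomm_ring
    have e2 : (Nᴴ - N) * (N - Nᴴ) = Nᴴ * N + N * Nᴴ - N * N - Nᴴ * Nᴴ := by noncomm_ring
    rw [e1, e2]
    push_cast
    module
  have h9 := rtr_pow_mono (mul_self_posSemidef hHh) h8 (2 ^ m - 1)
  have h10 := rtr_pow_midpoint_le hP hQ (2 ^ m - 1)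
  rw [Nat.sub_add_cancel Nat.one_le_two_pow] at h9 h10
  have h11 := rtr_mul_pow_comm Nᴴ N (2 ^ m)
  have e : Nᴴ * N = (D * D) * (X * X) * (D * D) := by
    rw [hNt, hN]; simp only [Matrix.mul_assoc]
  rw [← e]
  linarith

end Sandwiched

/-! ### The measured divergence and its comparison with the sandwiched one -/

section Measured

variable {ι : Type*} [Fintype ι] [DecidableEq ι]

/-- The operator `∑ i, x i • M i`. -/
noncomputable def weightedSum {n : ℕ} (M : Fin n → Matrix ι ι ℂ) (x : Fin n → ℝ) : Matrix ι ι ℂ :=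
  ∑ i, (x i : ℂ) • M i

lemma weightedSum_posSemidef {n : ℕ} {M : Fin n → Matrix ι ι ℂ} (hM : ∀ i, (M i).PosSemidef)
    {x : Fin n → ℝ} (hx : ∀ i, 0 ≤ x i) : (weightedSum M x).PosSemidef :=
  posSemidef_sum _ fun i _ => PosSemidef.smul_real (hM i) (hx i)

lemma rtr_mul_weightedSum {n : ℕ} (M : Fin n → Matrix ι ι ℂ) (x : Fin n → ℝ) (A : Matrix ι ι ℂ) :
    rtr (A * weightedSum M x) = ∑ i, x i * rtr (M i * A) := by
  rw [weightedSum, Finset.mul_sum, rtr_sum]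
  refine Finset.sum_congr rfl fun i _ => ?_
  rw [Matrix.mul_smul, rtr_smul, rtr_mul_comm]

/-- The variance of a measurement is positive semidefinite. -/
lemma weightedSum_sq_sub_posSemidef {n : ℕ} {M : Fin n → Matrix ι ι ℂ}
    (hM : ∀ i, (M i).PosSemidef) (h1 : ∑ i, M i = 1) {x : Fin n → ℝ} (hx : ∀ i, 0 ≤ x i) :
    (weightedSum M (fun i => x i ^ 2) - weightedSum M x * weightedSum M x).PosSemidef := by
  have hXh := (weightedSum_posSemidef hM hx).1
  set X := weightedSum M x with hX
  have e : weightedSum M (fun i => x i ^ 2) - X * X =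
      ∑ i, ((x i : ℂ) • 1 - X) * M i * ((x i : ℂ) • 1 - X) := by
    have : ∀ i, ((x i : ℂ) • 1 - X) * M i * ((x i : ℂ) • 1 - X) =
        ((x i ^ 2 : ℝ) : ℂ) • M i - (x i : ℂ) • M i * X - X * ((x i : ℂ) • M i) + X * M i * X := by
      intro i
      simp only [Matrix.sub_mul, Matrix.mul_sub, Matrix.smul_mul, Matrix.mul_smul, Matrix.one_mul,
        Matrix.mul_one]
      push_cast
      module
    simp only [this, Finset.sum_add_distrib, Finset.sum_sub_distrib, ← Finset.sum_mul,
      ← Finset.mul_sum, h1, Matrix.mul_one]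
    rw [← weightedSum, ← weightedSum, ← hX]
    abel
  rw [e]
  refine posSemidef_sum _ fun i _ => conj_posSemidef (hM i) ?_
  refine IsHermitian.sub ?_ hXh
  rw [IsHermitian, conjTranspose_smul, conjTranspose_one, Complex.star_def, Complex.conj_ofReal]

/-- Each step replaces `D` by `D²` through `rtr_conj_pow_le`, and then `(∑ x_i M_i)²` by `∑ x_i²
M_i` through positivity of the variance. -/
lemma rtr_conj_weightedSum_pow_le {n : ℕ} {M : Fin n → Matrix ι ι ℂ}
    (hM : ∀ i, (M i).PosSemidef) (h1 : ∑ i, M i = 1) (m : ℕ) {D : Matrix ι ι ℂ}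
    (hD : D.PosSemidef) {x : Fin n → ℝ} (hx : ∀ i, 0 ≤ x i) :
    rtr ((D * weightedSum M x * D) ^ 2 ^ m) ≤
      rtr (D ^ 2 ^ m * weightedSum M (fun i => x i ^ 2 ^ m) * D ^ 2 ^ m) := by
  induction m generalizing D x with
  | zero => simp
  | succ m ih =>
    refine (rtr_conj_pow_le hD (weightedSum_posSemidef hM hx) m).trans ?_
    have hDD := mul_self_posSemidef hD.1
    have h2 := rtr_pow_mono
      (conj_posSemidef (mul_self_posSemidef (weightedSum_posSemidef hM hx).1) hDD.1)
      (B := D * D * weightedSum M (fun i => x i ^ 2) * (D * D)) (by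
        rw [← Matrix.sub_mul, ← Matrix.mul_sub]
        exact conj_posSemidef (weightedSum_sq_sub_posSemidef hM h1 hx) hDD.1) (2 ^ m - 1)
    rw [Nat.sub_add_cancel Nat.one_le_two_pow] at h2
    refine h2.trans ((ih hDD fun i => sq_nonneg (x i)).trans_eq ?_)
    simp only [← pow_two_pow_succ, ← pow_mul, ← pow_succ']

/-- Domination gives `ρ ≤ (tr ρ) P ≤ (tr ρ) c σ`, with `P` the support projection of `σ`. -/
lemma rtr_mul_eq_zero_of_dominated {M ρ σ : Matrix ι ι ℂ} (hM : M.PosSemidef)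
    (hρ : ρ.PosSemidef) (hσ : σ.PosSemidef) (hd : Dominated ρ σ) (h : rtr (M * σ) = 0) :
    rtr (M * ρ) = 0 := by
  obtain ⟨c, hc, hcp⟩ := exists_smul_sub_suppProj_posSemidef hσ
  have h1 := rtr_mul_le hM hcp
  rw [Matrix.mul_smul, rtr_smul, h, mul_zero] at h1
  have h2 := conj_posSemidef (rtr_smul_one_sub_posSemidef hρ) (suppProj_isHermitian σ)
  rw [Matrix.mul_sub, Matrix.sub_mul, hd.suppProj_mul hρ.1 hσ.1, hd.mul_suppProj hσ.1,
    Matrix.mul_smul, Matrix.mul_one, Matrix.smul_mul, suppProj_mul_self] at h2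
  have h3 := rtr_mul_le hM h2
  rw [Matrix.mul_smul, rtr_smul] at h3
  have := rtr_nonneg hρ
  have := rtr_mul_nonneg hM hρ
  nlinarith

theorem measured_le_sandwichedQ {k : ℕ} (hk : 1 ≤ k) {ρ σ : Matrix ι ι ℂ} (hρ : ρ.PosSemidef)
    (hσ : σ.PosSemidef) (hd : Dominated ρ σ) {n : ℕ} {M : Fin n → Matrix ι ι ℂ}
    (hM : ∀ i, (M i).PosSemidef) (h1 : ∑ i, M i = 1) :
    ∑ i, rtr (M i * ρ) ^ alpha k * rtr (M i * σ) ^ (1 - alpha k) ≤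
      sandwichedQ (alpha k) ρ σ := by
  set α := alpha k with hα
  have hα1 : 1 < α := one_lt_alpha hk
  set p := fun i => rtr (M i * ρ) with hp
  set q := fun i => rtr (M i * σ) with hq
  have hp0 : ∀ i, 0 ≤ p i := fun i => rtr_mul_nonneg (hM i) hρ
  have hq0 : ∀ i, 0 ≤ q i := fun i => rtr_mul_nonneg (hM i) hσ
  -- The equality case of Young's inequality, outcome by outcome; this linearizes the measured sum
  -- in the operator `∑ x_i M_i`.
  set x : Fin n → ℝ := fun i => (p i / q i) ^ (α - 1) with hx
  have hx0 : ∀ i, 0 ≤ x i := fun i => Real.rpow_nonneg (div_nonneg (hp0 i) (hq0 i)) _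
  have hterm : ∀ i, p i ^ α * q i ^ (1 - α) =
      α * (x i * p i) - (α - 1) * (x i ^ 2 ^ k * q i) := by
    intro i
    rcases (hq0 i).eq_or_lt with h0 | h0
    · have hp' : p i = 0 := rtr_mul_eq_zero_of_dominated (hM i) hρ hσ hd h0.symm
      rw [← h0, hp', Real.zero_rpow (by linarith)]
      ring
    · have hy : 0 ≤ p i / q i := div_nonneg (hp0 i) (hq0 i)
      have e1 : p i = p i / q i * q i := (div_mul_cancel₀ _ h0.ne').symm
      set y := p i / q i with hy'
      have e2 : x i * p i = y ^ α * q i := by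
        rw [e1, ← mul_assoc, hx]
        congr 1
        have := rpow_mul_rpow hy (a := α - 1) (b := 1) (by linarith)
        rw [Real.rpow_one, sub_add_cancel] at this
        exact this
      have e3 : x i ^ 2 ^ k = y ^ α := by
        rw [hx, ← Real.rpow_natCast, ← Real.rpow_mul hy]
        congr 1
        push_cast
        exact alpha_sub_one_mul hk
      have e4 : p i ^ α * q i ^ (1 - α) = y ^ α * q i := by
        rw [e1, Real.mul_rpow hy h0.le, mul_assoc, ← Real.rpow_add h0]
        norm_num
      rw [e2, e3, e4]
      ring
  have hs0 : (1 : ℝ) / (2 * 2 ^ k) ≠ 0 := by positivity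
  set D := mpow σ (1 / (2 * 2 ^ k)) with hD
  have hDp : D.PosSemidef := mpow_posSemidef hσ _
  set E := mpow σ ((1 - α) / (2 * α)) with hE
  have hEp : E.PosSemidef := mpow_posSemidef hσ _
  have hDE : D * E = suppProj σ := by
    rw [hD, hE, sandwiched_exponent hk, mpow_mul_mpow_neg hσ hs0]
  have hED : E * D = suppProj σ := by
    have := congrArg conjTranspose hDE
    rwa [conjTranspose_mul, hEp.1.eq, hDp.1.eq, (suppProj_isHermitian σ).eq] at this
  set X := weightedSum M x with hX
  have hXp : X.PosSemidef := weightedSum_posSemidef hM hx0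
  -- `D` and `E` are mutually inverse on the support of `σ`, so the product of the two conjugated
  -- operators has trace `tr ρX`.
  have hy := rtr_mul_le_young (conj_posSemidef hρ hEp.1) (conj_posSemidef hXp hDp.1) hα1
    (two_pow_eq_div hk)
  have e1 : rtr (E * ρ * E * (D * X * D)) = rtr (ρ * X) := by
    rw [rtr_mul_conj]
    have : D * (E * ρ * E) * D = ρ := by
      calc _ = (D * E) * ρ * (E * D) := by simp only [Matrix.mul_assoc]
        _ = ρ := by rw [hDE, hED, hd.suppProj_mul hρ.1 hσ.1, hd.mul_suppProj hσ.1]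
    rw [this]
  have hDk : D ^ 2 ^ k = mpow σ (1 / 2) := by
    rw [hD, mpow_pow hσ]
    congr 1
    have : (2 : ℝ) ^ k ≠ 0 := by positivity
    push_cast
    field_simp
  have h2 := rtr_conj_weightedSum_pow_le hM h1 k hDp hx0
  have e2 : ∀ Y, rtr (mpow σ (1 / 2) * Y * mpow σ (1 / 2)) = rtr (σ * Y) := fun Y => by
    rw [rtr_mul_comm, ← Matrix.mul_assoc, mpow_half_mul_half hσ]
  rw [hDk, e2, rtr_mul_weightedSum] at h2
  rw [e1, rtr_mul_weightedSum] at hy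
  calc ∑ i, p i ^ α * q i ^ (1 - α)
      = α * ∑ i, x i * p i - (α - 1) * ∑ i, x i ^ 2 ^ k * q i := by
        rw [Finset.mul_sum, Finset.mul_sum, ← Finset.sum_sub_distrib]
        exact Finset.sum_congr rfl fun i _ => hterm i
    _ ≤ sandwichedQ α ρ σ := by
        have := mul_le_mul_of_nonneg_left h2 (sub_nonneg.mpr hα1.le)
        have e : sandwichedQ α ρ σ = rtr (mpow (E * ρ * E) α) := rfl
        rw [e]
        linarith

lemma rtr_pos_of_dominated {ρ σ : Matrix ι ι ℂ} (hρ : IsDensity ρ) (hσ : σ.PosSemidef)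
    (hd : Dominated ρ σ) : 0 < rtr σ := by
  refine (rtr_nonneg hσ).lt_of_ne fun h => ?_
  have := rtr_mul_eq_zero_of_dominated PosSemidef.one hρ.1 hσ hd (by rw [Matrix.one_mul, ← h])
  rw [Matrix.one_mul, hρ.rtr_eq_one] at this
  exact one_ne_zero this

lemma bddAbove_measuredValues {k : ℕ} (hk : 1 ≤ k) {ρ σ : Matrix ι ι ℂ} (hρ : IsDensity ρ)
    (hσ : σ.PosSemidef) (hd : Dominated ρ σ) : BddAbove (measuredValues (alpha k) ρ σ) := by
  refine ⟨sandwichedQ (alpha k) ρ σ, ?_⟩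
  rintro _ ⟨n, M, hM, h1, rfl⟩
  exact measured_le_sandwichedQ hk hρ.1 hσ hd hM h1

/-- The trivial one-outcome measurement shows that the supremum is over a nonempty set and is
positive. -/
lemma rpow_mem_measuredValues (α : ℝ) {ρ : Matrix ι ι ℂ} (hρ : IsDensity ρ) (σ : Matrix ι ι ℂ) :
    rtr σ ^ (1 - α) ∈ measuredValues α ρ σ :=
  ⟨1, fun _ => 1, fun _ => PosSemidef.one, by simp, by simp [hρ.rtr_eq_one]⟩

lemma sSup_measuredValues_pos {k : ℕ} (hk : 1 ≤ k) {ρ σ : Matrix ι ι ℂ} (hρ : IsDensity ρ)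
    (hσ : σ.PosSemidef) (hd : Dominated ρ σ) : 0 < sSup (measuredValues (alpha k) ρ σ) :=
  (Real.rpow_pos_of_pos (rtr_pos_of_dominated hρ hσ hd) _).trans_le
    (le_csSup (bddAbove_measuredValues hk hρ hσ hd) (rpow_mem_measuredValues _ hρ σ))

lemma sSup_measuredValues_le {k : ℕ} (hk : 1 ≤ k) {ρ σ : Matrix ι ι ℂ} (hρ : IsDensity ρ)
    (hσ : σ.PosSemidef) (hd : Dominated ρ σ) :
    sSup (measuredValues (alpha k) ρ σ) ≤ sandwichedQ (alpha k) ρ σ := by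
  refine csSup_le ⟨_, rpow_mem_measuredValues _ hρ σ⟩ ?_
  rintro _ ⟨n, M, hM, h1, rfl⟩
  exact measured_le_sandwichedQ hk hρ.1 hσ hd hM h1

theorem measuredD_le_sandwichedD {k : ℕ} (hk : 1 ≤ k) {ρ σ : Matrix ι ι ℂ} (hρ : IsDensity ρ)
    (hσ : σ.PosSemidef) (hd : Dominated ρ σ) :
    measuredD (alpha k) ρ σ ≤ sandwichedD (alpha k) ρ σ :=
  mul_le_mul_of_nonneg_left (Real.log_le_log (sSup_measuredValues_pos hk hρ hσ hd)
    (sSup_measuredValues_le hk hρ hσ hd)) (one_div_pos.mpr (alpha_sub_one_pos hk)).le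

theorem sandwichedD_le_imD {k : ℕ} (hk : 1 ≤ k) {ρ σ : Matrix ι ι ℂ} (hρ : IsDensity ρ)
    (hσ : σ.PosSemidef) (hd : Dominated ρ σ) :
    sandwichedD (alpha k) ρ σ ≤ imD k ρ σ := by
  obtain ⟨x, -, -, -, hg, -⟩ := exists_primal_optimum hk hρ hσ hd
  exact mul_le_mul_of_nonneg_left (Real.log_le_log ((sSup_measuredValues_pos hk hρ hσ hd).trans_le
    (sSup_measuredValues_le hk hρ hσ hd)) (sandwichedQ_le_imQ hk hρ.1 hσ ⟨_, hg.2⟩))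
    (one_div_pos.mpr (alpha_sub_one_pos hk)).le

end Measured

/-! ### The geometric divergence and commuting matrices -/

section Intertwining

variable {ι : Type*} [Fintype ι] [DecidableEq ι]

/-- The functional calculus respects intertwining relations. -/
lemma cfc_mul_eq_mul_cfc {A B X : Matrix ι ι ℂ} (hA : A.IsHermitian) (hB : B.IsHermitian)
    (h : A * X = X * B) (f : ℝ → ℝ) : cfc f A * X = X * cfc f B := by
  set U : Matrix ι ι ℂ := (hA.eigenvectorUnitary : Matrix ι ι ℂ) with hU
  set W : Matrix ι ι ℂ := (hB.eigenvectorUnitary : Matrix ι ι ℂ) with hW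
  have hUU : Uᴴ * U = 1 := Unitary.coe_star_mul_self hA.eigenvectorUnitary
  have hUU' : U * Uᴴ = 1 := Unitary.coe_mul_star_self hA.eigenvectorUnitary
  have hWW : Wᴴ * W = 1 := Unitary.coe_star_mul_self hB.eigenvectorUnitary
  have hWW' : W * Wᴴ = 1 := Unitary.coe_mul_star_self hB.eigenvectorUnitary
  set Y := Uᴴ * X * W with hY
  have hX : X = U * Y * Wᴴ := by
    calc X = (U * Uᴴ) * X * (W * Wᴴ) := by rw [hUU', hWW', Matrix.one_mul, Matrix.mul_one]
      _ = _ := by simp only [hY, Matrix.mul_assoc]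
  have hl : ∀ g : ℝ → ℝ, cfc g A * X =
      U * (diagonal (fun i => ((g (hA.eigenvalues i) : ℝ) : ℂ)) * Y) * Wᴴ := fun g => by
    rw [cfc_eq_unitary hA, ← hU, hX]
    calc _ = U * diagonal (fun i => ((g (hA.eigenvalues i) : ℝ) : ℂ)) * (Uᴴ * U) * Y * Wᴴ := by
          simp only [Matrix.mul_assoc]
      _ = _ := by rw [hUU, Matrix.mul_one]; simp only [Matrix.mul_assoc]
  have hr : ∀ g : ℝ → ℝ, X * cfc g B =
      U * (Y * diagonal (fun i => ((g (hB.eigenvalues i) : ℝ) : ℂ))) * Wᴴ := fun g => by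
    rw [cfc_eq_unitary hB, ← hW, hX]
    calc _ = U * Y * (Wᴴ * W) * diagonal (fun i => ((g (hB.eigenvalues i) : ℝ) : ℂ)) * Wᴴ := by
          simp only [Matrix.mul_assoc]
      _ = _ := by rw [hWW, Matrix.mul_one]; simp only [Matrix.mul_assoc]
  have hcancel : ∀ P Q : Matrix ι ι ℂ, U * P * Wᴴ = U * Q * Wᴴ → P = Q := fun P Q hPQ => by
    have := congrArg (fun M => Uᴴ * M * W) hPQ
    have e : ∀ P : Matrix ι ι ℂ, Uᴴ * (U * P * Wᴴ) * W = P := fun P => by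
      calc _ = (Uᴴ * U) * P * (Wᴴ * W) := by simp only [Matrix.mul_assoc]
        _ = P := by rw [hUU, hWW, Matrix.one_mul, Matrix.mul_one]
    simpa only [e] using this
  have h0 : diagonal (fun i => ((hA.eigenvalues i : ℝ) : ℂ)) * Y =
      Y * diagonal (fun i => ((hB.eigenvalues i : ℝ) : ℂ)) := by
    apply hcancel
    have h1 := hl fun t => t
    have h2 := hr fun t => t
    rw [cfc_id' ℝ A hA.isSelfAdjoint] at h1
    rw [cfc_id' ℝ B hB.isSelfAdjoint] at h2
    rw [← h1, ← h2, h]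
  rw [hl, hr]
  congr 2
  ext i j
  have h1 := congrFun (congrFun h0 i) j
  simp only [diagonal_mul, mul_diagonal] at h1 ⊢
  -- Written in the two eigenbases, a nonzero entry of the intertwiner forces the eigenvalues to
  -- agree.
  by_cases hz : Y i j = 0
  · simp [hz]
  · have h2 : hA.eigenvalues i = hB.eigenvalues j := by
      have : (hA.eigenvalues i : ℂ) = hB.eigenvalues j :=
        mul_left_cancel₀ hz (by rw [← h1, mul_comm])
      exact_mod_cast this
    rw [h2, mul_comm]

lemma Commute.cfc_cfc {A B : Matrix ι ι ℂ} (hA : A.IsHermitian) (hB : B.IsHermitian)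
    (h : A * B = B * A) (f g : ℝ → ℝ) : cfc f A * cfc g B = cfc g B * cfc f A :=
  cfc_mul_eq_mul_cfc hA hA (cfc_mul_eq_mul_cfc hB hB h.symm g).symm f

/-- The eigenvalue relation says that `E` intertwines `A` with the scalar matrix `c`. -/
lemma cfc_mul_of_eigen {A E : Matrix ι ι ℂ} (hA : A.IsHermitian) {c : ℝ}
    (h : A * E = (c : ℂ) • E) (f : ℝ → ℝ) : cfc f A * E = (f c : ℂ) • E := by
  have h1 : (algebraMap ℝ (Matrix ι ι ℂ) c).IsHermitian := IsSelfAdjoint.algebraMap _ (.all c)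
  have h2 : ∀ c : ℝ, E * algebraMap ℝ (Matrix ι ι ℂ) c = (c : ℂ) • E := fun c => by
    rw [Algebra.algebraMap_eq_smul_one, Matrix.mul_smul, Matrix.mul_one, Complex.coe_smul]
  rw [cfc_mul_eq_mul_cfc hA h1 (by rw [h, h2]), cfc_algebraMap, h2]

/-- The projection onto the eigenspace of `A` for the eigenvalue `c`. -/
noncomputable def eigenProj (A : Matrix ι ι ℂ) (c : ℝ) : Matrix ι ι ℂ :=
  cfc (fun t : ℝ => if t = c then 1 else 0) A

lemma mul_eigenProj {A : Matrix ι ι ℂ} (hA : A.IsHermitian) (c : ℝ) :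
    A * eigenProj A c = (c : ℂ) • eigenProj A c := by
  have h := cfc_mul_cfc (fun t => t) (fun t : ℝ => if t = c then 1 else 0) A
  rw [cfc_id' ℝ A hA.isSelfAdjoint] at h
  rw [eigenProj, h, Complex.coe_smul, ← cfc_smul _ _ A (continuousOn_spectrum _ A)]
  congr 1
  ext t
  by_cases ht : t = c <;> simp [ht]

lemma sum_eigenProj {A : Matrix ι ι ℂ} (hA : A.IsHermitian) :
    ∑ c ∈ A.finite_real_spectrum.toFinset, eigenProj A c = 1 := by
  simp only [eigenProj]
  rw [← cfc_sum _ _ _ fun c _ => continuousOn_spectrum _ A, ← cfc_const_one ℝ A hA.isSelfAdjoint]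
  refine cfc_congr fun t ht => ?_
  simp only [Finset.sum_apply]
  rw [Finset.sum_ite_eq, if_pos (by rwa [Set.Finite.mem_toFinset])]

/-- Both sides act by the same scalar on each product of eigenprojections of `A` and `B`, and these
products sum to `1`. -/
lemma mpow_mul_of_commute {A B : Matrix ι ι ℂ} (hA : A.PosSemidef) (hB : B.PosSemidef)
    (h : A * B = B * A) (r : ℝ) : mpow (A * B) r = mpow A r * mpow B r := by
  have hAB : (A * B).IsHermitian := by
    rw [IsHermitian, conjTranspose_mul, hA.1.eq, hB.1.eq, h]
  have key : ∀ a ∈ A.finite_real_spectrum.toFinset, ∀ b ∈ B.finite_real_spectrum.toFinset,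
      mpow (A * B) r * (eigenProj A a * eigenProj B b) =
        mpow A r * mpow B r * (eigenProj A a * eigenProj B b) := by
    intro a ha b hb
    rw [Set.Finite.mem_toFinset] at ha hb
    have hc : eigenProj A a * eigenProj B b = eigenProj B b * eigenProj A a :=
      Commute.cfc_cfc hA.1 hB.1 h _ _
    have hb1 : ∀ (f : ℝ → ℝ), cfc f B * (eigenProj A a * eigenProj B b) =
        (f b : ℂ) • (eigenProj A a * eigenProj B b) := fun f => by
      rw [hc, ← Matrix.mul_assoc, cfc_mul_of_eigen hB.1 (mul_eigenProj hB.1 b), Matrix.smul_mul]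
    have ha1 : ∀ (f : ℝ → ℝ), cfc f A * (eigenProj A a * eigenProj B b) =
        (f a : ℂ) • (eigenProj A a * eigenProj B b) := fun f => by
      rw [← Matrix.mul_assoc, cfc_mul_of_eigen hA.1 (mul_eigenProj hA.1 a), Matrix.smul_mul]
    have hAB1 : A * B * (eigenProj A a * eigenProj B b) =
        ((a * b : ℝ) : ℂ) • (eigenProj A a * eigenProj B b) := by
      have h1 := ha1 fun t => t
      have h2 := hb1 fun t => t
      rw [cfc_id' ℝ A hA.1.isSelfAdjoint] at h1
      rw [cfc_id' ℝ B hB.1.isSelfAdjoint] at h2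
      rw [Matrix.mul_assoc, h2, Matrix.mul_smul, h1, smul_smul, mul_comm (b : ℂ),
        Complex.ofReal_mul]
    rw [mpow, cfc_mul_of_eigen hAB hAB1, Matrix.mul_assoc, mpow, mpow, hb1, Matrix.mul_smul, ha1,
      smul_smul, Real.mul_rpow (spectrum_nonneg hA ha) (spectrum_nonneg hB hb), mul_comm (_ : ℂ),
      Complex.ofReal_mul]
  calc mpow (A * B) r = mpow (A * B) r * ((∑ a ∈ A.finite_real_spectrum.toFinset, eigenProj A a) *
        ∑ b ∈ B.finite_real_spectrum.toFinset, eigenProj B b) := by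
        rw [sum_eigenProj hA.1, sum_eigenProj hB.1, Matrix.mul_one, Matrix.mul_one]
    _ = mpow A r * mpow B r * ((∑ a ∈ A.finite_real_spectrum.toFinset, eigenProj A a) *
        ∑ b ∈ B.finite_real_spectrum.toFinset, eigenProj B b) := by
        simp only [Finset.sum_mul, Finset.mul_sum]
        refine Finset.sum_congr rfl fun a ha => Finset.sum_congr rfl fun b hb => ?_
        first
          | exact key a ha b hb
          | exact key b hb a ha
    _ = _ := by rw [sum_eigenProj hA.1, sum_eigenProj hB.1, Matrix.mul_one, Matrix.mul_one]

end Intertwining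

/-! ### The geometric upper bound, its symmetric form, and commuting operators -/

section Geometric

variable {ι : Type*} [Fintype ι] [DecidableEq ι]

/-- The trace functional inside the geometric divergence. -/
noncomputable def geometricQ (α : ℝ) (ρ σ : Matrix ι ι ℂ) : ℝ :=
  rtr (mpow σ (1 / 2) * mpow (mpow σ (-1 / 2) * ρ * mpow σ (-1 / 2)) α * mpow σ (1 / 2))

lemma mpow_half_mul_neg_half_eq {σ : Matrix ι ι ℂ} (hσ : σ.PosSemidef) :
    mpow σ (1 / 2) * mpow σ (-1 / 2) = suppProj σ := by
  have := mpow_mul_mpow_neg hσ (r := 1 / 2) (by norm_num)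
  rwa [← neg_div] at this

lemma mpow_neg_half_mul_half_eq {σ : Matrix ι ι ℂ} (hσ : σ.PosSemidef) :
    mpow σ (-1 / 2) * mpow σ (1 / 2) = suppProj σ := by
  have := mpow_mul_mpow_neg hσ (r := -1 / 2) (by norm_num)
  rwa [← neg_div, neg_neg] at this

/-- An explicit dual point: all `A i` equal `σ^{1/2} G^α σ^{1/2}`, and `C i = σ^{1/2} G^{c_i}
σ^{1/2}` with exponents descending from `1` to `0`. -/
theorem imQ_le_geometricQ {k : ℕ} (hk : 1 ≤ k) {ρ σ : Matrix ι ι ℂ} (hρ : ρ.PosSemidef)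
    (hσ : σ.PosSemidef) (hd : Dominated ρ σ) :
    imQ k ρ σ ≤ geometricQ (alpha k) ρ σ := by
  set α := alpha k with hα
  have hα1 : 1 < α := one_lt_alpha hk
  set s := mpow σ (1 / 2) with hs
  set s' := mpow σ (-1 / 2) with hs'
  have hsH : sᴴ = s := (mpow_isHermitian σ _).eq
  have hss' : s * s' = suppProj σ := mpow_half_mul_neg_half_eq hσ
  have hs's : s' * s = suppProj σ := mpow_neg_half_mul_half_eq hσ
  set G := s' * ρ * s' with hG
  have hGp : G.PosSemidef := conj_posSemidef hρ (mpow_isHermitian σ _)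
  -- The solution of `c_i = (α + c_{i+1}) / 2` with `c_1 = 1`; then `c_{k+1} = 0` because `2^k (α -
  -- 1) = α`.
  set c : ℕ → ℝ := fun i => α - 2 ^ (i - 1) * (α - 1) with hc
  have hc0 : ∀ i, i ≤ k + 1 → 0 ≤ c i := fun i hi => by
    have h1 : (2 : ℝ) ^ (i - 1) ≤ 2 ^ k := pow_le_pow_right₀ one_le_two (by omega)
    have h2 := alpha_sub_one_mul hk
    have h3 := mul_le_mul_of_nonneg_right h1 (sub_nonneg.mpr hα1.le)
    simp only [hc]
    linarith
  have hchain : DualChain k ρ σ (fun _ => s * mpow G α * s) (fun i => s * mpow G (c i) * s) := by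
    refine ⟨?_, ?_, fun i h1 h2 => ?_⟩
    · have : s * mpow G (c 1) * s = ρ := by
        have h1 : c 1 = 1 := by simp [hc]
        rw [h1, mpow_one hGp.1, hG]
        calc _ = (s * s') * ρ * (s' * s) := by simp only [Matrix.mul_assoc]
          _ = ρ := by rw [hss', hs's, hd.suppProj_mul hρ.1 hσ.1, hd.mul_suppProj hσ.1]
      simp only [this, sub_self]
      exact PosSemidef.zero
    · have h1 : c (k + 1) = 0 := by
        have := alpha_sub_one_mul hk
        simp only [hc, Nat.add_sub_cancel]
        linarith
      -- The zeroth power is the identity, not the support projection, so the last link is exactly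
      -- `σ`.
      simp only [h1, mpow_zero hGp.1, Matrix.mul_one]
      exact mpow_half_mul_half hσ
    · have h3 := hc0 (i + 1) (by omega)
      have hci : α / 2 + c (i + 1) / 2 = c i := by
        obtain ⟨n, rfl⟩ : ∃ n, i = n + 1 := ⟨i - 1, by omega⟩
        simp only [hc, Nat.add_sub_cancel, pow_succ]
        ring
      have hb := block_conj_posSemidef
        (block_posSemidef_of_factor (mpow G (α / 2)) (mpow G (c (i + 1) / 2))) s s
      rw [(mpow_isHermitian G _).eq, (mpow_isHermitian G _).eq,
        mpow_mul_mpow_of_nonneg hGp (by linarith) (by linarith),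
        mpow_mul_mpow_of_nonneg hGp (by linarith) (by linarith),
        mpow_mul_mpow_of_nonneg hGp (by linarith) (by linarith),
        mpow_mul_mpow_of_nonneg hGp (by linarith) (by linarith), hci, add_comm (c (i + 1) / 2),
        hci, add_halves, add_halves, hsH] at hb
      exact hb
  have := imQ_le_dualValue hk hchain
  rwa [dualValue_of_equal hk fun _ _ _ => rfl] at this

theorem imD_le_geometricD {k : ℕ} (hk : 1 ≤ k) {ρ σ : Matrix ι ι ℂ} (hρ : IsDensity ρ)
    (hσ : σ.PosSemidef) (hd : Dominated ρ σ) :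
    imD k ρ σ ≤ geometricD (alpha k) ρ σ :=
  mul_le_mul_of_nonneg_left (Real.log_le_log (imQ_pos_of_dominated hk hρ hσ hd)
    (imQ_le_geometricQ hk hρ.1 hσ hd)) (one_div_pos.mpr (alpha_sub_one_pos hk)).le

lemma mpow_mul_suppProj {σ : Matrix ι ι ℂ} (hσ : σ.PosSemidef) {r : ℝ} (hr : r ≠ 0) :
    mpow σ r * suppProj σ = mpow σ r := by
  rw [suppProj, mpow, cfc_mul_cfc]
  refine cfc_congr_psd hσ fun t _ => ?_
  show t ^ r * (if t = 0 then 0 else 1) = t ^ r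
  split_ifs with h
  · rw [h, Real.zero_rpow hr, zero_mul]
  · rw [mul_one]

/-- Characterization of negative powers through the Moore-Penrose inverse. -/
lemma mpow_neg_eq_of_inverse {H K P : Matrix ι ι ℂ} (hH : H.PosSemidef) (hP : P.IsHermitian)
    (hKH : K * H = P) (hHP : H * P = H) (hKP : K * P = K) (r : ℝ) :
    mpow H (-r) = mpow K r := by
  have e1 : mpow H (-1) * H = suppProj H := by
    have := mpow_mul_mpow_neg hH (r := -1) (by norm_num)
    rwa [neg_neg, mpow_one hH.1] at this
  have e2 : H * mpow H (-1) = suppProj H := by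
    have := mpow_mul_mpow_neg hH (r := 1) (by norm_num)
    rwa [mpow_one hH.1] at this
  have h1 : P * suppProj H = P := by rw [← hKH, Matrix.mul_assoc, mul_suppProj hH.1]
  have h2 : suppProj H * P = suppProj H := by rw [← e1, Matrix.mul_assoc, hHP]
  -- Each projection absorbs the other, so they coincide and `K` is the Moore-Penrose inverse of
  -- `H`.
  have h3 : P = suppProj H := by
    have := congrArg conjTranspose h2
    rw [conjTranspose_mul, hP.eq, (suppProj_isHermitian H).eq, h1] at this
    exact this
  have h4 : suppProj H * mpow H (-1) = mpow H (-1) := by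
    rw [← e1, Matrix.mul_assoc, e2, mpow_mul_suppProj hH (by norm_num)]
  have h5 : K = mpow H (-1) := by
    rw [← hKP, h3, ← e2, ← Matrix.mul_assoc, hKH, h3, h4]
  rw [h5, mpow_mpow hH, neg_one_mul]

/-- For `X = σ^{-1/2} ρ^{1/2}` one has `G = X Xᴴ` and `K = Xᴴ X`, so `X` intertwines them and moves
powers of `G` to powers of `K`. Equality of the supports makes `K` the Moore-Penrose inverse of
`ρ^{-1/2} σ ρ^{-1/2}`. -/
theorem geometricD_eq_geometricD' {α : ℝ} (hα : 1 < α) {ρ σ : Matrix ι ι ℂ} (hρ : ρ.PosSemidef)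
    (hσ : σ.PosSemidef) (h1 : Dominated ρ σ) (h2 : Dominated σ ρ) :
    geometricD α ρ σ = geometricD' α ρ σ := by
  rw [geometricD, geometricD']
  refine congrArg (fun X => 1 / (α - 1) * Real.log (rtr X)) ?_
  set s := mpow σ (1 / 2) with hs
  set s' := mpow σ (-1 / 2) with hs'
  set t := mpow ρ (1 / 2) with ht
  set t' := mpow ρ (-1 / 2) with ht'
  have hsH : s'ᴴ = s' := (mpow_isHermitian σ _).eq
  have htH : tᴴ = t := (mpow_isHermitian ρ _).eq
  have hss' : s * s' = suppProj σ := mpow_half_mul_neg_half_eq hσ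
  have hs's : s' * s = suppProj σ := mpow_neg_half_mul_half_eq hσ
  have htt' : t * t' = suppProj ρ := mpow_half_mul_neg_half_eq hρ
  have ht't : t' * t = suppProj ρ := mpow_neg_half_mul_half_eq hρ
  have htt : t * t = ρ := mpow_half_mul_half hρ
  have hsσs : s' * (s' * σ) = suppProj σ := by
    have e1 : s' * s' = mpow σ (-1) := by
      rw [hs', mpow_mul_mpow_of_ne hσ (by norm_num)]; norm_num
    have e2 := mpow_mul_mpow_neg hσ (r := -1) (by norm_num)
    rwa [neg_neg, mpow_one hσ.1, ← e1, Matrix.mul_assoc] at e2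
  have hPt : suppProj σ * t = t := by
    have e1 : t = ρ * mpow ρ (-1 / 2) := by
      nth_rw 1 [← mpow_one hρ.1]
      rw [mpow_mul_mpow_of_ne hρ (by norm_num)]; norm_num [ht]
    rw [e1, ← Matrix.mul_assoc, h1.suppProj_mul hρ.1 hσ.1]
  have htP : t * suppProj σ = t := by
    have := congrArg conjTranspose hPt
    rwa [conjTranspose_mul, htH, (suppProj_isHermitian σ).eq] at this
  set G := s' * ρ * s' with hG
  set K := t * (s' * s') * t with hK
  have hGp : G.PosSemidef := conj_posSemidef hρ (mpow_isHermitian σ _)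
  have hKp : K.PosSemidef := conj_posSemidef (mul_self_posSemidef hsH) htH
  have hHp : (t' * σ * t').PosSemidef := conj_posSemidef hσ (mpow_isHermitian ρ _)
  have hKH : K * (t' * σ * t') = suppProj ρ := by
    calc _ = t * (s' * s') * (t * t') * σ * t' := by simp only [hK, Matrix.mul_assoc]
      _ = t * (s' * s') * (suppProj ρ * σ) * t' := by rw [htt']; simp only [Matrix.mul_assoc]
      _ = t * (s' * (s' * σ)) * t' := by
        rw [h2.suppProj_mul hσ.1 hρ.1]; simp only [Matrix.mul_assoc]
      _ = suppProj ρ := by rw [hsσs, htP, htt']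
  have hneg : mpow (t' * σ * t') (1 - α) = mpow K (α - 1) := by
    have := mpow_neg_eq_of_inverse hHp (suppProj_isHermitian ρ) hKH
      (by rw [Matrix.mul_assoc, mpow_mul_suppProj hρ (by norm_num)])
      (by rw [hK, Matrix.mul_assoc, mpow_mul_suppProj hρ (by norm_num)]) (α - 1)
    rwa [neg_sub] at this
  have hint : G * (s' * t) = (s' * t) * K := by
    rw [hG, hK, ← htt]; simp only [Matrix.mul_assoc]
  have hf : mpow G (α - 1) * (s' * t) = (s' * t) * mpow K (α - 1) :=
    cfc_mul_eq_mul_cfc hGp.1 hKp.1 hint _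
  have hGα : mpow G α = mpow G (α - 1) * (s' * t) * (t * s') := by
    calc mpow G α = mpow G (α - 1) * mpow G 1 := by
          rw [mpow_mul_mpow_of_ne hGp (by linarith)]; congr 1; ring
      _ = _ := by rw [mpow_one hGp.1, hG, ← htt]; simp only [Matrix.mul_assoc]
  rw [hneg, hGα, hf]
  calc _ = (s * s') * t * mpow K (α - 1) * (t * (s' * s)) := by simp only [Matrix.mul_assoc]
    _ = _ := by rw [hss', hs's, hPt, htP]

/-- For commuting states the iterated mean divergence is the classical Rényi divergence. -/
theorem imQ_eq_of_commute {k : ℕ} (hk : 1 ≤ k) {ρ σ : Matrix ι ι ℂ} (hρ : IsDensity ρ)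
    (hσ : σ.PosSemidef) (hd : Dominated ρ σ) (hc : ρ * σ = σ * ρ) :
    imQ k ρ σ = rtr (mpow ρ (alpha k) * mpow σ (1 - alpha k)) := by
  have hα1 := one_lt_alpha hk
  have hcp : ∀ b : ℝ, ρ * mpow σ b = mpow σ b * ρ := fun b =>
    (cfc_mul_eq_mul_cfc hσ.1 hσ.1 hc.symm _).symm
  have hconj : ∀ b : ℝ, b ≠ 0 → mpow σ b * ρ * mpow σ b = ρ * mpow σ (2 * b) := fun b hb => by
    rw [← hcp, Matrix.mul_assoc, mpow_mul_mpow_of_ne hσ (by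
      rw [← two_mul]; exact mul_ne_zero two_ne_zero hb), two_mul]
  have hpow : ∀ b a : ℝ, mpow (ρ * mpow σ b) a = mpow ρ a * mpow σ (b * a) := fun b a => by
    rw [mpow_mul_of_commute hρ.1 (mpow_posSemidef hσ b) (hcp b), mpow_mpow hσ]
  have hr : (1 - alpha k) / (2 * alpha k) ≠ 0 := div_ne_zero (by linarith) (by linarith)
  -- The geometric upper bound and the sandwiched lower bound collapse to the same classical
  -- expression.
  refine le_antisymm ?_ ?_
  · refine (imQ_le_geometricQ hk hρ.1 hσ hd).trans_eq ?_
    rw [geometricQ, hconj _ (by norm_num), hpow, rtr_mul_comm, ← Matrix.mul_assoc,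
      mpow_half_mul_half hσ, rtr_mul_comm, Matrix.mul_assoc]
    have e : mpow σ (2 * (-1 / 2) * alpha k) * σ = mpow σ (1 - alpha k) := by
      nth_rw 2 [← mpow_one hσ.1]
      rw [mpow_mul_mpow_of_ne hσ (by linarith)]
      congr 1; ring
    rw [e]
  · obtain ⟨x, -, -, -, hg, -⟩ := exists_primal_optimum hk hρ hσ hd
    refine le_trans (le_of_eq ?_) (sandwichedQ_le_imQ hk hρ.1 hσ ⟨_, hg.2⟩)
    rw [sandwichedQ, hconj _ hr, hpow]
    congr 3
    field_simp

end Geometric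

end IteratedMean

theorem proposition3p1 {ι : Type u} [Fintype ι] [DecidableEq ι]
    (ρ σ : Matrix ι ι ℂ) (hρ : IsDensity ρ) (hσ : σ.PosSemidef) (hρσ : Dominated ρ σ)
    (k : ℕ) (hk : 1 ≤ k) :
    -- the maximum in the definition is attained
    IsGreatest (primalValues k ρ σ) (imQ k ρ σ) ∧
    -- (1) rescaling
    IsGreatest (rescaledValues k ρ σ) (imQ k ρ σ) ∧
    -- (2) dual formulations
    (IsLeast (dualSumValues k ρ σ) (imQ k ρ σ) ∧
      IsLeast (dualEqualValues k ρ σ) (imQ k ρ σ) ∧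
      IsLeast (dualMeanValues k ρ σ) (imQ k ρ σ)) ∧
    -- (3) submultiplicativity
    (∀ {ι₁ : Type v} [Fintype ι₁] [DecidableEq ι₁] {ι₂ : Type w} [Fintype ι₂] [DecidableEq ι₂]
      (ρ₁ σ₁ : Matrix ι₁ ι₁ ℂ) (ρ₂ σ₂ : Matrix ι₂ ι₂ ℂ),
      IsDensity ρ₁ → σ₁.PosSemidef → Dominated ρ₁ σ₁ →
      IsDensity ρ₂ → σ₂.PosSemidef → Dominated ρ₂ σ₂ →
      imD k (ρ₁ ⊗ₖ ρ₂) (σ₁ ⊗ₖ σ₂) ≤ imD k ρ₁ σ₁ + imD k ρ₂ σ₂) ∧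
    -- (4) relation to other Rényi divergences
    (BddAbove (measuredValues (alpha k) ρ σ) ∧
      measuredD (alpha k) ρ σ ≤ sandwichedD (alpha k) ρ σ ∧
      sandwichedD (alpha k) ρ σ ≤ imD k ρ σ ∧
      imD k ρ σ ≤ geometricD (alpha k) ρ σ ∧
      (Dominated σ ρ → geometricD (alpha k) ρ σ = geometricD' (alpha k) ρ σ)) ∧
    -- (5) decreasing in `k`
    (2 ≤ k → imD k ρ σ ≤ imD (k - 1) ρ σ) ∧
    -- (6) data processing
    (∀ {κ : Type x} [Fintype κ] [DecidableEq κ] (E : Matrix ι ι ℂ →ₗ[ℂ] Matrix κ κ ℂ),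
      IsCPTP E → imD k (E ρ) (E σ) ≤ imD k ρ σ) ∧
    -- (7) reduction to the classical divergence
    (Commute ρ σ →
      imD k ρ σ = 1 / (alpha k - 1) *
        Real.log (rtr (mpow ρ (alpha k) * mpow σ (1 - alpha k)))) := by
  obtain ⟨x, -, -, -, hg, hr⟩ := exists_primal_optimum hk hρ hσ hρσ
  have hQ : imQ k ρ σ = x ^ alpha k := hg.csSup_eq
  refine ⟨hQ ▸ hg, hQ ▸ hr, ⟨isLeast_dualSumValues hk hρ hσ hρσ, isLeast_dualEqualValues hk hρ hσ hρσ,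
    isLeast_dualMeanValues hk hρ hσ hρσ⟩, ?_, ⟨bddAbove_measuredValues hk hρ hσ hρσ,
    measuredD_le_sandwichedD hk hρ hσ hρσ, sandwichedD_le_imD hk hρ hσ hρσ,
    imD_le_geometricD hk hρ hσ hρσ,
    geometricD_eq_geometricD' (one_lt_alpha hk) hρ.1 hσ hρσ⟩,
    fun h => imD_le_imD_pred h hρ hσ hρσ, fun E hE => imD_map_le hk hρ hσ hρσ hE, fun hc => ?_⟩
  · intro _ _ _ _ _ _ ρ₁ σ₁ ρ₂ σ₂ h1 h2 h3 h4 h5 h6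
    exact imD_kronecker_le hk h1 h2 h3 h4 h5 h6
  · rw [imD, imQ_eq_of_commute hk hρ hσ hρσ hc]
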